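/- **Setting.** Fix $\theta\in(0,1)$, $R>0$ with $\theta R=1-e^{-R}$, $\mathrm{Le}>0$, $\ell>0$, $\alpha\in(0,1)$. All functions are real valued. *Spaces.* A pair $\mathbf u=(u_1,u_2)$ consists of $u_1$ on $\mathbb R\times[-\ell/2,\ell/2]$ and $u_2$ on $[0,\infty)\times[-\ell/2,\ell/2]$; $u_1$ may jump at $x=0$ and $x=R$, $u_2$ at $x=R$. For $k\in\{0,1,2,\dots\}$, $\mathcal X_{k+\alpha}$ is the space of pairs such that, separately on each of the strips $x\le 0$ (only for $u_1$), $0\le x\le R$ and $x\ge R$, the functions $u_j$ are of class $C^{k+\alpha}_b$ up to the boundary of the strip, $D^\gamma u_j(\cdot,-\ell/2)=D^\gamma u_j(\cdot,\ell/2)$ for $|\gamma|\le k$, and $D^\gamma u_1\to0$ as $x\to\pm\infty$, $D^\gamma u_2\to0$ as $x\to+\infty$ for each $y$ and $|\gamma|\le k$. It is normed by $\|\mathbf u\|_{k+\alpha}=\sum_{|\gamma|<k}\|D^\gamma \mathbf u\|_\infty+\sum_{|\gamma|=k}\|D^\gamma\mathbf u\|_\alpha$, with $\|\mathbf f\|_\infty=\sup|f_1|+\sup|f_2|$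 and $\|\mathbf f\|_\alpha$ the sum of the $C^\alpha_b$-norms over the five strip pieces. $C^{k+\alpha}_\sharp$ is the space of $C^{k+\alpha}$ functions on $[-\ell/2,\ell/2]$ whose derivatives of order $\le k$ agree at the two end points. For a function $\zeta$ on $[-\ell/2,\ell/2)$, $\zeta^\sharp$ is its $\ell$-periodic extension, and $[f]_{x_0}=f(x_0^+)-f(x_0^-)$. *Linear operators.* For $\mathbf v=(\zeta,\upsilon)\in\mathcal X_{2+\alpha}$ let $\mathscr L\mathbf v=(\Delta\zeta+\zeta_x,\ \mathrm{Le}^{-1}\Delta\upsilon+\upsilon_x)$, $\mathscr B_0\mathbf f=([f_1]_0,[f_1]_R)$ and $$\mathscr B\mathbf v=\Big([\zeta]_0,\ [\zeta]_R,\ \mathrm{Le}[\zeta_x]_0+\upsilon(0^+),\ \mathrm{Le}\,\upsilon(0^+)+\upsilon_x(0^+),\ \zeta(R^+)+\theta R[\zeta_x]_R,\ \mathrm{Le}[\zeta_x]_R+[\upsilon]_R,\ \mathrm{Le}[\upsilon]_R+[\upsilon_x]_R\Big).$$ $\widetilde{\mathscr B}$ is $\mathscr B$ with the fifth entry replaced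 by $\frac12(\zeta(R^+)+\zeta(R^-))+\theta R[\zeta_x]_R$, and $\mathscr B_*\mathbf v=(\widetilde{\mathscr B}\mathbf v,\mathscr B_0\mathscr L\mathbf v)$. The domain $D(L_\alpha)$ is the set of $\mathbf u\in\mathcal X_{2+\alpha}$ with $\mathscr B\mathbf u=0$, $\mathscr B_0\mathscr L\mathbf u=0$, $(\mathscr L\mathbf u)_1\to0$ as $x\to\pm\infty$ and $(\mathscr L\mathbf u)_2\to0$ as $x\to+\infty$, with the norm of $\mathcal X_{2+\alpha}$. *Lifting.* Let $\eta$ be smooth with $\chi_{(-R/4,R/4)}\le\eta\le\chi_{(-R/2,R/2)}$, and $\varphi\ge0$ smooth, even, compactly supported in $(-1,1)$ with $\int\varphi=1$. Put $$(N_1\zeta)(x,y)=\tfrac12\eta(x)\big(\chi_{[0,\infty)}(x)-\chi_{(-\infty,0]}(x)\big)\int\varphi(\sigma)\zeta^\sharp(y+\sigma x^3)\,d\sigma,$$ $$(N_2\zeta)(x,y)=|x|\eta(x)\int\varphi(\sigma)\zeta^\sharp(y+\sigma|x|)\,d\sigma,\qquad N_3\zeta=\tfrac x4N_2\zeta,\qquad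 \tau_R(x,y)=(x-R,y).$$ For $\mathbf h=(h_1,\dots,h_9)$ let $$(\mathscr N\mathbf h)_1=N_1h_1+(N_1h_2)\circ\tau_R+\tfrac{N_2h_3}{2\mathrm{Le}}+\tfrac{(N_2h_5)\circ\tau_R}{2\theta R}+N_3\big(h_8-\tfrac{1}{\mathrm{Le}}h_3-h_1''\big)+\big[N_3\big(h_9-\tfrac1{\theta R}h_5-h_2''\big)\big]\circ\tau_R,$$ $$(\mathscr N\mathbf h)_2=\big[N_1\big(h_6-\tfrac{\mathrm{Le}}{\theta R}h_5\big)\big]\circ\tau_R+N_2h_4+\tfrac12\big[N_2\big(h_7-\mathrm{Le}\,h_6+\tfrac{\mathrm{Le}^2}{\theta R}h_5\big)\big]\circ\tau_R .$$ Let $\mathcal Z$ be the normed space of all $\mathbf h\in(C^{2+\alpha}_\sharp)^2\times(C^{1+\alpha}_\sharp)^5\times(C^{\alpha}_\sharp)^2$ with $h_6-\frac{\mathrm{Le}}{\theta R}h_5\in C^{2+\alpha}_\sharp$, the norm of the latter function being included in the norm of $\mathbf h$. *Nonlinear terms.* Let $\delta>0$ with $(-2\delta,2\delta)\subset(-R,R)$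 and let $\beta$ be smooth, compactly supported in $(-2\delta,2\delta)$, equal to $1$ on $[-\delta,\delta]$. Let $$\Theta^{(0)}(x)=\begin{cases}1&x\le0\\1+\frac{1-x-e^{-x}}R&0<x<R\\\theta e^{R-x}&x\ge R\end{cases}\qquad \Phi^{(0)}(x)=\begin{cases}0&x\le0\\\frac{e^{-\mathrm{Le}x}-1}{\mathrm{Le}R}+\frac xR&0<x<R\\1+\frac{1-e^{\mathrm{Le}R}}{\mathrm{Le}R\,e^{\mathrm{Le}x}}&x\ge R\end{cases}$$ with derivatives taken piecewise. For $\mathbf v=(\zeta,\upsilon)$ let $\varrho(x,y)=\theta^{-1}\beta(x-R)\zeta(R^+,y)-R\,\mathrm{Le}^{-1}\beta(x)\upsilon(0^+,y)$ and, for functions $W(x)$, $w_x,w_{xy},w_{xx}$ of $(x,y)$ and $\kappa\in\mathbb R$, $$\mathcal E_1(W;w_x)=\frac{\varrho W_{xx}+w_x}{1+\varrho_x},$$ $$\mathcal E_2(\kappa,W;w_x,w_{xy},w_{xx})=\frac{(\kappa\varrho_x+\varrho_{yy})(\varrho W_{xx}+w_x)+2\varrho_y^2W_{xx}+2\varrho_yw_{xy}}{1+\varrho_x}+\frac{\varrho_{xx}(1+\varrho_y^2)(\varrho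 W_{xx}+w_x)}{(1+\varrho_x)^3}$$ $$\qquad-\frac{2\varrho_y\varrho_{xy}(\varrho W_{xx}+w_x)+(\varrho_y^2-\varrho_x^2)(\varrho W_{xxx}+W_{xx}+w_{xx})-2\varrho_x(\varrho W_{xxx}-\varrho_y^2W_{xx}+w_{xx})}{(1+\varrho_x)^2}.$$ Put $\mathscr F_1=\mathcal E_1(\Theta^{(0)};\zeta_x)$, $\mathscr F_2=\mathcal E_2(1,\Theta^{(0)};\zeta_x,\zeta_{xy},\zeta_{xx})$, $\mathscr G_1=\mathcal E_1(\Phi^{(0)};\upsilon)$, $\mathscr G_2=\mathcal E_2(\mathrm{Le},\Phi^{(0)};\upsilon,\upsilon_y,\upsilon_x)$. With all traces of $\zeta$ at $x=R^+$ and all traces of $\upsilon$ at $x=0^+$, let $$\Lambda_R=\frac{\zeta_x+\Delta\zeta-\theta^{-1}\zeta_{yy}\zeta_x-2\theta^{-1}\zeta_y\zeta_{xy}+\theta^{-2}\zeta_y^2(\zeta_{xx}-\zeta-\theta)-\theta^{-1}\zeta\zeta_{yy}}{\theta-\zeta-\zeta_x},$$ $$\Lambda_0=\frac{\mathrm{Le}\,\upsilon_x+\Delta\upsilon+\frac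 R{\mathrm{Le}}[\upsilon_{yy}(\mathrm{Le}\,\upsilon+\upsilon_x)+2\upsilon_y\upsilon_{xy}]+\frac{R^2}{\mathrm{Le}^2}\upsilon_y^2(-\mathrm{Le}^2\upsilon+R^{-1}\mathrm{Le}^2+\upsilon_{xx})}{\mathrm{Le}^2+R\,\mathrm{Le}(\mathrm{Le}\,\upsilon+\upsilon_x)},$$ and $\Lambda(\mathbf v)(x,y)=a(x)\Lambda_R(y)-b(x)\Lambda_0(y)$ with arbitrary smooth $a,b:\mathbb R\to\mathbb R$ (the choice $a=\beta(\cdot-R)$, $b=R\beta$ expresses the time derivative of $\varrho$; the choice $a=b=1$ is also covered). Finally $\mathscr F(\mathbf v)=(\Lambda\mathscr F_1-\mathscr F_2,\ \Lambda D_x\mathscr G_1+D_x\Lambda\,\mathscr G_1-\mathrm{Le}^{-1}D_x\mathscr G_2)$, and $\mathscr H(\mathbf v)$ has entries $\mathscr H_j=0$ for $j\ne4,7$, $$\mathscr H_4=-\frac{R\,\mathrm{Le}\,\upsilon_y(0^+,\cdot)^2}{\mathrm{Le}^2+R^2\upsilon_y(0^+,\cdot)^2},\qquad \mathscr H_7=\frac{\mathrm{Le}\,\zeta_y(R^+,\cdot)^2}{R(\theta^2+\zeta_y(R^+,\cdot)^2)}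 .$$ Let $\mathcal I$ be the set of $\mathbf u\in\mathcal X_{2+\alpha}$ with $\mathscr B\mathbf u=\mathscr H(\mathbf u)$ and $\mathscr B_0(\mathscr L\mathbf u+\mathscr F(\mathbf u))=0$. **Lemma.** (i) $\mathscr B_*$ is bounded from $\mathcal X_{2+\alpha}$ to $\mathcal Z$, $\mathscr N$ is bounded from $\mathcal Z$ to $\mathcal X_{2+\alpha}$, and $\mathscr B_*\mathscr N=I$ on $\mathcal Z$ (so $\mathcal Z$ is exactly the range of $\mathscr B_*$). The bounded operator $P=I-\mathscr N\mathscr B_*$ is a projection of $\mathcal X_{2+\alpha}$ onto the kernel of $\mathscr B_*$, which coincides with $D(L_\alpha)$. (ii) There are $r_0,r_1,r_2>0$ and a map $\Upsilon:D(L_\alpha)\to(I-P)(\mathcal X_{2+\alpha})$, of class $C^\infty$ on the ball $B(0,r_1)\subset D(L_\alpha)$, with $\Upsilon(0)=0$, such that the neighbourhood $U=\{\mathbf u\in\mathcal X_{2+\alpha}:\|P\mathbf u\|_{2+\alpha}<r_1,\ \|(I-P)\mathbf u\|_{2+\alpha}<r_2\}$ of $0$ contains the ball $B(0,r_0)\subset\mathcal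 X_{2+\alpha}$ and $$\mathcal I\cap U=\{\mathbf v+\Upsilon(\mathbf v):\ \mathbf v\in D(L_\alpha),\ \|\mathbf v\|_{2+\alpha}<r_1\}.$$ -/

import Mathlib

open scoped NNReal ContDiff BoundedContinuousFunction
open Set Filter Topology

namespace ThickFlame

/-- The parameters of the problem: the ignition temperature `θ`, the width `R` of the reaction zone
(tied to `θ` by `θ R = 1 - exp (-R)`), the Lewis number `Le`, the width `ℓ` of the strip and the
Hölder exponent `α`. -/
structure Params where
  θ : ℝ
  R : ℝ
  Le : ℝ
  ℓ : ℝ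
  α : ℝ≥0
  θ_pos : 0 < θ
  θ_lt_one : θ < 1
  R_pos : 0 < R
  θ_mul_R : θ * R = 1 - Real.exp (-R)
  Le_pos : 0 < Le
  ℓ_pos : 0 < ℓ
  α_pos : 0 < α
  α_lt_one : α < 1

/-- The auxiliary functions: the cut-off `β` used to fix the two fronts, the cut-off `η` and the
even mollifier `φ` used in the lifting operator. -/
structure Cutoffs (p : Params) where
  β : ℝ → ℝ
  δ : ℝ
  η : ℝ → ℝ
  φ : ℝ → ℝ
  β_smooth : ContDiff ℝ ∞ β
  δ_pos : 0 < δ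
  δ_small : Ioo (-2 * δ) (2 * δ) ⊆ Ioo (-p.R) p.R
  β_one : ∀ x ∈ Icc (-δ) δ, β x = 1
  β_compact : HasCompactSupport β
  β_supp : tsupport β ⊆ Ioo (-2 * δ) (2 * δ)
  η_smooth : ContDiff ℝ ∞ η
  η_lower : ∀ x, (Ioo (-p.R / 4) (p.R / 4)).indicator (fun _ => (1 : ℝ)) x ≤ η x
  η_upper : ∀ x, η x ≤ (Ioo (-p.R / 2) (p.R / 2)).indicator (fun _ => (1 : ℝ)) x
  φ_smooth : ContDiff ℝ ∞ φ
  φ_even : ∀ s, φ (-s) = φ s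
  φ_nonneg : ∀ s, 0 ≤ φ s
  φ_compact : HasCompactSupport φ
  φ_supp : tsupport φ ⊆ Ioo (-1) 1
  φ_integral : ∫ s, φ s = 1

/-- The three parts `x ≤ 0`, `0 ≤ x ≤ R`, `R ≤ x` of the `x`-axis. -/
inductive Reg
  | minus
  | mid
  | plus

/-- The closed interval which carries each part. -/
def Reg.ivl (p : Params) : Reg → Set ℝ
  | .minus => Iic 0
  | .mid => Icc 0 p.R
  | .plus => Ici p.R

/-- A pair `(f₁, f₂)`, with `f₁` on the strip and `f₂` on the half strip `x ≥ 0`, which is continuous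
up to the boundary on each part separately, consists of five pieces: the restrictions of `f₁` to
`x ≤ 0`, `0 ≤ x ≤ R`, `R ≤ x` (called `m1`, `c1`, `p1`) and of `f₂` to `0 ≤ x ≤ R`, `R ≤ x` (called
`c2`, `p2`). At an interface each piece takes its own one-sided limit. -/
inductive Piece
  | m1
  | c1
  | p1
  | c2
  | p2

def Piece.reg : Piece → Reg
  | .m1 => .minus
  | .c1 => .mid
  | .p1 => .plus
  | .c2 => .mid
  | .p2 => .plus

/-- The closed period cell `[-ℓ/2, ℓ/2]`. -/
def cell (p : Params) : Set ℝ := Icc (-(p.ℓ / 2)) (p.ℓ / 2)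

/-- The closed strip `I × [-ℓ/2, ℓ/2]` which carries a piece. -/
def Piece.dom (p : Params) (i : Piece) : Set (ℝ × ℝ) := (i.reg.ivl p) ×ˢ cell p

/-- Value of a function of `(x, y)` defined on a set `K` (and `0` outside of `K`). -/
noncomputable def ev {K : Set (ℝ × ℝ)} (f : K →ᵇ ℝ) (x y : ℝ) : ℝ :=
  open Classical in if h : (x, y) ∈ K then f ⟨(x, y), h⟩ else 0

/-- Value of a function of `y` defined on a set `K` (and `0` outside of `K`). -/
noncomputable def ev1 {K : Set ℝ} (f : K →ᵇ ℝ) (y : ℝ) : ℝ :=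
  open Classical in if h : y ∈ K then f ⟨y, h⟩ else 0

theorem ev_zero {K : Set (ℝ × ℝ)} (x y : ℝ) : ev (0 : K →ᵇ ℝ) x y = 0 := by
  simp [ev]

theorem ev_add {K : Set (ℝ × ℝ)} (f g : K →ᵇ ℝ) (x y : ℝ) :
    ev (f + g) x y = ev f x y + ev g x y := by
  unfold ev; split_ifs <;> simp

theorem ev_smul {K : Set (ℝ × ℝ)} (c : ℝ) (f : K →ᵇ ℝ) (x y : ℝ) :
    ev (c • f) x y = c * ev f x y := by
  unfold ev; split_ifs <;> simp

theorem ev1_zero {K : Set ℝ} (y : ℝ) : ev1 (0 : K →ᵇ ℝ) y = 0 := by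
  simp [ev1]

theorem ev1_add {K : Set ℝ} (f g : K →ᵇ ℝ) (y : ℝ) : ev1 (f + g) y = ev1 f y + ev1 g y := by
  unfold ev1; split_ifs <;> simp

theorem ev1_smul {K : Set ℝ} (c : ℝ) (f : K →ᵇ ℝ) (y : ℝ) : ev1 (c • f) y = c * ev1 f y := by
  unfold ev1; split_ifs <;> simp

/-! ### Hölder norm of a bounded continuous function -/

/-- `‖f‖_{C_b^α(K)}`: the sup-norm plus the Hölder seminorm. On subsets of `ℝ × ℝ` the distance is
the maximum of the distances of the coordinates, which gives a norm equivalent to that of the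
Euclidean distance. -/
noncomputable def holNorm {E : Type*} [MetricSpace E] (α : ℝ≥0) (f : E →ᵇ ℝ) : ℝ :=
  ‖f‖ + nnHolderNorm α (f : E → ℝ)

section holNorm

variable {E : Type*} [MetricSpace E] {α : ℝ≥0}

theorem norm_le_holNorm (f : E →ᵇ ℝ) : ‖f‖ ≤ holNorm α f := by
  simp [holNorm]

theorem holNorm_nonneg (f : E →ᵇ ℝ) : 0 ≤ holNorm α f :=
  (norm_nonneg f).trans (norm_le_holNorm f)

theorem holNorm_zero : holNorm α (0 : E →ᵇ ℝ) = 0 := by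
  simp [holNorm]

theorem holNorm_add {f g : E →ᵇ ℝ} (hf : MemHolder α (f : E → ℝ)) (hg : MemHolder α (g : E → ℝ)) :
    holNorm α (f + g) ≤ holNorm α f + holNorm α g := by
  have h := hf.nnHolderNorm_add_le hg
  have h' : (nnHolderNorm α ((f : E → ℝ) + (g : E → ℝ)) : ℝ)
      ≤ nnHolderNorm α (f : E → ℝ) + nnHolderNorm α (g : E → ℝ) := by exact_mod_cast h
  have h2 := norm_add_le f g
  simp only [holNorm, BoundedContinuousFunction.coe_add]
  linarith

theorem holNorm_smul {f : E →ᵇ ℝ} (hf : MemHolder α (f : E → ℝ)) (c : ℝ) :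
    holNorm α (c • f) = |c| * holNorm α f := by
  have h := hf.nnHolderNorm_smul c
  have h' : (nnHolderNorm α (c • (f : E → ℝ)) : ℝ) = |c| * nnHolderNorm α (f : E → ℝ) := by
    rw [h]; simp
  have h2 : ((c • f : E →ᵇ ℝ) : E → ℝ) = c • (f : E → ℝ) := by ext; simp
  simp only [holNorm, h2, h', norm_smul, Real.norm_eq_abs]
  ring

end holNorm

/-! ### The spaces `X_{k+α}` of pairs of (real valued) functions -/

/-- The pairs of class `C^{k+α}`, each with the family of its derivatives: `u i (a, b)` is the
derivative `D_x^a D_y^b` of the piece `i`, up to the boundary of its strip, for `a + b ≤ k` (and `0`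
for `a + b > k`). All these derivatives are bounded and continuous, take the same values at
`y = -ℓ/2` and `y = ℓ/2`, and vanish as `x → ± ∞`; those of order `k` are `α`-Hölder continuous. -/
def XSub (p : Params) (k : ℕ) :
    Submodule ℝ ((i : Piece) → ℕ × ℕ → (Piece.dom p i →ᵇ ℝ)) where
  carrier := {u |
    (∀ i a b, k < a + b → u i (a, b) = 0) ∧
    (∀ i a b, a + b < k → ∀ x ∈ i.reg.ivl p, ∀ y ∈ cell p,
      HasDerivWithinAt (fun s => ev (u i (a, b)) s y) (ev (u i (a + 1, b)) x y) (i.reg.ivl p) x) ∧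
    (∀ i a b, a + b < k → ∀ x ∈ i.reg.ivl p, ∀ y ∈ cell p,
      HasDerivWithinAt (fun s => ev (u i (a, b)) x s) (ev (u i (a, b + 1)) x y) (cell p) y) ∧
    (∀ i a b, a + b ≤ k → ∀ x ∈ i.reg.ivl p,
      ev (u i (a, b)) x (-(p.ℓ / 2)) = ev (u i (a, b)) x (p.ℓ / 2)) ∧
    (∀ i a b, a + b ≤ k → i.reg = Reg.minus → ∀ y ∈ cell p,
      Tendsto (fun x => ev (u i (a, b)) x y) atBot (𝓝 0)) ∧
    (∀ i a b, a + b ≤ k → i.reg = Reg.plus → ∀ y ∈ cell p,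
      Tendsto (fun x => ev (u i (a, b)) x y) atTop (𝓝 0)) ∧
    (∀ i a b, a + b = k → MemHolder p.α (u i (a, b) : Piece.dom p i → ℝ))}
  zero_mem' := by
    refine ⟨?_, ?_, ?_, ?_, ?_, ?_, ?_⟩
    · intros; rfl
    · intros; simp only [Pi.zero_apply, ev_zero]; exact hasDerivWithinAt_const _ _ _
    · intros; simp only [Pi.zero_apply, ev_zero]; exact hasDerivWithinAt_const _ _ _
    · intros; simp only [Pi.zero_apply, ev_zero]
    · intros; simp only [Pi.zero_apply, ev_zero]; exact tendsto_const_nhds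
    · intros; simp only [Pi.zero_apply, ev_zero]; exact tendsto_const_nhds
    · intros
      simp only [Pi.zero_apply, BoundedContinuousFunction.coe_zero]
      exact memHolder_zero
  add_mem' := by
    rintro u v ⟨h1, h2, h3, h4, h5, h6, h7⟩ ⟨g1, g2, g3, g4, g5, g6, g7⟩
    refine ⟨?_, ?_, ?_, ?_, ?_, ?_, ?_⟩
    · intro i a b h; simp [h1 i a b h, g1 i a b h]
    · intro i a b h x hx y hy
      simp only [Pi.add_apply, ev_add]
      exact (h2 i a b h x hx y hy).add (g2 i a b h x hx y hy)
    · intro i a b h x hx y hy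
      simp only [Pi.add_apply, ev_add]
      exact (h3 i a b h x hx y hy).add (g3 i a b h x hx y hy)
    · intro i a b h x hx
      simp only [Pi.add_apply, ev_add, h4 i a b h x hx, g4 i a b h x hx]
    · intro i a b h hi y hy
      simp only [Pi.add_apply, ev_add]
      simpa using (h5 i a b h hi y hy).add (g5 i a b h hi y hy)
    · intro i a b h hi y hy
      simp only [Pi.add_apply, ev_add]
      simpa using (h6 i a b h hi y hy).add (g6 i a b h hi y hy)
    · intro i a b h
      simp only [Pi.add_apply, BoundedContinuousFunction.coe_add]
      exact (h7 i a b h).add (g7 i a b h)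
  smul_mem' := by
    rintro c u ⟨h1, h2, h3, h4, h5, h6, h7⟩
    refine ⟨?_, ?_, ?_, ?_, ?_, ?_, ?_⟩
    · intro i a b h; simp [h1 i a b h]
    · intro i a b h x hx y hy
      simp only [Pi.smul_apply, ev_smul]
      exact (h2 i a b h x hx y hy).const_mul c
    · intro i a b h x hx y hy
      simp only [Pi.smul_apply, ev_smul]
      exact (h3 i a b h x hx y hy).const_mul c
    · intro i a b h x hx
      simp only [Pi.smul_apply, ev_smul, h4 i a b h x hx]
    · intro i a b h hi y hy
      simp only [Pi.smul_apply, ev_smul]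
      simpa using (h5 i a b h hi y hy).const_mul c
    · intro i a b h hi y hy
      simp only [Pi.smul_apply, ev_smul]
      simpa using (h6 i a b h hi y hy).const_mul c
    · intro i a b h
      have h2 : ((c • u i (a, b) : Piece.dom p i →ᵇ ℝ) : Piece.dom p i → ℝ)
          = c • (u i (a, b) : Piece.dom p i → ℝ) := by ext; simp
      simp only [Pi.smul_apply]
      rw [h2]
      exact (h7 i a b h).smul

/-- The space `X_{k+α}`. -/
def X (p : Params) (k : ℕ) : Type := ↥(XSub p k)

noncomputable instance (p : Params) (k : ℕ) : AddCommGroup (X p k) :=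
  inferInstanceAs (AddCommGroup ↥(XSub p k))

noncomputable instance (p : Params) (k : ℕ) : Module ℝ (X p k) :=
  inferInstanceAs (Module ℝ ↥(XSub p k))

/-- `‖f‖_∞ = sup |f₁| + sup |f₂|`. -/
noncomputable def pairSup {p : Params} (f : (i : Piece) → (Piece.dom p i →ᵇ ℝ)) : ℝ :=
  max (max ‖f .m1‖ ‖f .c1‖) ‖f .p1‖ + max ‖f .c2‖ ‖f .p2‖

/-- `‖f‖_α`: the sum of the `C_b^α`-norms of the five pieces. -/
noncomputable def pairHol {p : Params} (f : (i : Piece) → (Piece.dom p i →ᵇ ℝ)) : ℝ :=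
  holNorm p.α (f .m1) + (holNorm p.α (f .c1) + holNorm p.α (f .c2))
    + (holNorm p.α (f .p1) + holNorm p.α (f .p2))

/-- `‖u‖_{k+α}`: the sum of `‖D^γ u‖_∞` over `|γ| < k` and of `‖D^γ u‖_α` over `|γ| = k`. -/
noncomputable instance (p : Params) (k : ℕ) : Norm (X p k) where
  norm u := (∑ m ∈ Finset.range k, ∑ γ ∈ Finset.HasAntidiagonal.antidiagonal m, pairSup fun i => u.1 i γ)
    + ∑ γ ∈ Finset.HasAntidiagonal.antidiagonal k, pairHol fun i => u.1 i γ

section pairNorms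

variable {p : Params}

theorem pairSup_nonneg (f : (i : Piece) → (Piece.dom p i →ᵇ ℝ)) : 0 ≤ pairSup f := by
  unfold pairSup; positivity

theorem pairHol_nonneg (f : (i : Piece) → (Piece.dom p i →ᵇ ℝ)) : 0 ≤ pairHol f := by
  unfold pairHol
  have := fun i => holNorm_nonneg (α := p.α) (f i)
  have h1 := this .m1
  have h2 := this .c1
  have h3 := this .p1
  have h4 := this .c2
  have h5 := this .p2
  linarith

theorem pairSup_add (f g : (i : Piece) → (Piece.dom p i →ᵇ ℝ)) :
    pairSup (fun i => f i + g i) ≤ pairSup f + pairSup g := by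
  unfold pairSup
  have h : ∀ i, ‖f i + g i‖ ≤ ‖f i‖ + ‖g i‖ := fun i => norm_add_le _ _
  have a1 : max (max ‖f .m1 + g .m1‖ ‖f .c1 + g .c1‖) ‖f .p1 + g .p1‖
      ≤ max (max ‖f .m1‖ ‖f .c1‖) ‖f .p1‖ + max (max ‖g .m1‖ ‖g .c1‖) ‖g .p1‖ := by
    refine max_le (max_le ?_ ?_) ?_
    · exact (h _).trans (add_le_add (by simp) (by simp))
    · exact (h _).trans (add_le_add (by simp) (by simp))
    · exact (h _).trans (add_le_add (by simp) (by simp))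
  have a2 : max ‖f .c2 + g .c2‖ ‖f .p2 + g .p2‖
      ≤ max ‖f .c2‖ ‖f .p2‖ + max ‖g .c2‖ ‖g .p2‖ := by
    refine max_le ?_ ?_
    · exact (h _).trans (add_le_add (by simp) (by simp))
    · exact (h _).trans (add_le_add (by simp) (by simp))
  linarith

theorem pairHol_add {f g : (i : Piece) → (Piece.dom p i →ᵇ ℝ)}
    (hf : ∀ i, MemHolder p.α (f i : Piece.dom p i → ℝ))
    (hg : ∀ i, MemHolder p.α (g i : Piece.dom p i → ℝ)) :
    pairHol (fun i => f i + g i) ≤ pairHol f + pairHol g := by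
  unfold pairHol
  have h := fun i => holNorm_add (hf i) (hg i)
  have h1 := h .m1
  have h2 := h .c1
  have h3 := h .p1
  have h4 := h .c2
  have h5 := h .p2
  linarith

theorem pairSup_smul (c : ℝ) (f : (i : Piece) → (Piece.dom p i →ᵇ ℝ)) :
    pairSup (fun i => c • f i) = |c| * pairSup f := by
  unfold pairSup
  simp only [norm_smul, Real.norm_eq_abs, mul_add, mul_max_of_nonneg _ _ (abs_nonneg c)]

theorem pairHol_smul (c : ℝ) {f : (i : Piece) → (Piece.dom p i →ᵇ ℝ)}
    (hf : ∀ i, MemHolder p.α (f i : Piece.dom p i → ℝ)) :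
    pairHol (fun i => c • f i) = |c| * pairHol f := by
  unfold pairHol
  simp only [holNorm_smul (hf _)]
  ring

theorem eq_zero_of_pairSup {f : (i : Piece) → (Piece.dom p i →ᵇ ℝ)} (h : pairSup f = 0) (i : Piece) :
    f i = 0 := by
  unfold pairSup at h
  have e1 : 0 ≤ max (max ‖f .m1‖ ‖f .c1‖) ‖f .p1‖ := by positivity
  have e2 : 0 ≤ max ‖f .c2‖ ‖f .p2‖ := by positivity
  have z1 : max (max ‖f .m1‖ ‖f .c1‖) ‖f .p1‖ ≤ 0 := by linarith
  have z2 : max ‖f .c2‖ ‖f .p2‖ ≤ 0 := by linarith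
  simp only [max_le_iff, norm_le_zero_iff] at z1 z2
  cases i
  · exact z1.1.1
  · exact z1.1.2
  · exact z1.2
  · exact z2.1
  · exact z2.2

theorem pairSup_le_pairHol (f : (i : Piece) → (Piece.dom p i →ᵇ ℝ)) : pairSup f ≤ pairHol f := by
  unfold pairSup pairHol
  have h := fun i => norm_le_holNorm (α := p.α) (f i)
  have h' := fun i => holNorm_nonneg (α := p.α) (f i)
  have a1 : max (max ‖f .m1‖ ‖f .c1‖) ‖f .p1‖
      ≤ holNorm p.α (f .m1) + holNorm p.α (f .c1) + holNorm p.α (f .p1) := by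
    have := h .m1
    have := h .c1
    have := h .p1
    have := h' .m1
    have := h' .c1
    have := h' .p1
    refine max_le (max_le ?_ ?_) ?_ <;> linarith
  have a2 : max ‖f .c2‖ ‖f .p2‖ ≤ holNorm p.α (f .c2) + holNorm p.α (f .p2) := by
    have := h .c2
    have := h .p2
    have := h' .c2
    have := h' .p2
    refine max_le ?_ ?_ <;> linarith
  linarith

end pairNorms

theorem X.norm_core (p : Params) (k : ℕ) : NormedSpace.Core ℝ (X p k) where
  norm_nonneg u := add_nonneg
    (Finset.sum_nonneg fun _ _ => Finset.sum_nonneg fun _ _ => pairSup_nonneg _)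
    (Finset.sum_nonneg fun _ _ => pairHol_nonneg _)
  norm_smul c u := by
    change (∑ m ∈ Finset.range k, ∑ γ ∈ Finset.HasAntidiagonal.antidiagonal m, pairSup fun i => c • u.1 i γ)
      + ∑ γ ∈ Finset.HasAntidiagonal.antidiagonal k, pairHol (fun i => c • u.1 i γ)
      = ‖c‖ * ((∑ m ∈ Finset.range k, ∑ γ ∈ Finset.HasAntidiagonal.antidiagonal m, pairSup fun i => u.1 i γ)
      + ∑ γ ∈ Finset.HasAntidiagonal.antidiagonal k, pairHol fun i => u.1 i γ)
    rw [mul_add, Finset.mul_sum, Finset.mul_sum]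
    congr 1
    · refine Finset.sum_congr rfl fun m _ => ?_
      rw [Finset.mul_sum]
      exact Finset.sum_congr rfl fun γ _ => pairSup_smul c _
    · refine Finset.sum_congr rfl fun γ hγ => pairHol_smul c fun i => ?_
      exact u.2.2.2.2.2.2.2 i γ.1 γ.2 (Finset.HasAntidiagonal.mem_antidiagonal.1 hγ)
  norm_triangle u v := by
    change (∑ m ∈ Finset.range k, ∑ γ ∈ Finset.HasAntidiagonal.antidiagonal m, pairSup fun i => u.1 i γ + v.1 i γ)
      + ∑ γ ∈ Finset.HasAntidiagonal.antidiagonal k, pairHol (fun i => u.1 i γ + v.1 i γ)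
      ≤ ((∑ m ∈ Finset.range k, ∑ γ ∈ Finset.HasAntidiagonal.antidiagonal m, pairSup fun i => u.1 i γ)
      + ∑ γ ∈ Finset.HasAntidiagonal.antidiagonal k, pairHol fun i => u.1 i γ)
      + ((∑ m ∈ Finset.range k, ∑ γ ∈ Finset.HasAntidiagonal.antidiagonal m, pairSup fun i => v.1 i γ)
      + ∑ γ ∈ Finset.HasAntidiagonal.antidiagonal k, pairHol fun i => v.1 i γ)
    rw [add_add_add_comm]
    refine add_le_add ?_ ?_
    · simp only [← Finset.sum_add_distrib]
      exact Finset.sum_le_sum fun m _ => Finset.sum_le_sum fun γ _ => pairSup_add _ _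
    · simp only [← Finset.sum_add_distrib]
      refine Finset.sum_le_sum fun γ hγ => pairHol_add (fun i => ?_) (fun i => ?_)
      · exact u.2.2.2.2.2.2.2 i γ.1 γ.2 (Finset.HasAntidiagonal.mem_antidiagonal.1 hγ)
      · exact v.2.2.2.2.2.2.2 i γ.1 γ.2 (Finset.HasAntidiagonal.mem_antidiagonal.1 hγ)
  norm_eq_zero_iff u := by
    constructor
    · intro h
      change (∑ m ∈ Finset.range k, ∑ γ ∈ Finset.HasAntidiagonal.antidiagonal m, pairSup fun i => u.1 i γ)
        + ∑ γ ∈ Finset.HasAntidiagonal.antidiagonal k, pairHol (fun i => u.1 i γ) = 0 at h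
      have n1 : 0 ≤ ∑ m ∈ Finset.range k, ∑ γ ∈ Finset.HasAntidiagonal.antidiagonal m,
          pairSup fun i => u.1 i γ :=
        Finset.sum_nonneg fun _ _ => Finset.sum_nonneg fun _ _ => pairSup_nonneg _
      have n2 : 0 ≤ ∑ γ ∈ Finset.HasAntidiagonal.antidiagonal k, pairHol fun i => u.1 i γ :=
        Finset.sum_nonneg fun _ _ => pairHol_nonneg _
      have z1 := le_antisymm (by linarith) n1
      have z2 := le_antisymm (by linarith) n2
      refine Subtype.ext (funext fun i => funext fun γ => ?_)
      obtain ⟨a, b⟩ := γ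
      rcases lt_trichotomy (a + b) k with hk | hk | hk
      · rw [Finset.sum_eq_zero_iff_of_nonneg
          (fun _ _ => Finset.sum_nonneg fun _ _ => pairSup_nonneg _)] at z1
        have z3 := z1 (a + b) (Finset.mem_range.2 hk)
        rw [Finset.sum_eq_zero_iff_of_nonneg (fun _ _ => pairSup_nonneg _)] at z3
        exact eq_zero_of_pairSup (z3 (a, b) (Finset.HasAntidiagonal.mem_antidiagonal.2 rfl)) i
      · rw [Finset.sum_eq_zero_iff_of_nonneg (fun _ _ => pairHol_nonneg _)] at z2
        have z3 := z2 (a, b) (Finset.HasAntidiagonal.mem_antidiagonal.2 hk)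
        exact eq_zero_of_pairSup (le_antisymm ((pairSup_le_pairHol _).trans z3.le)
          (pairSup_nonneg _)) i
      · exact u.2.1 i a b hk
    · rintro rfl
      change (∑ m ∈ Finset.range k, ∑ γ ∈ Finset.HasAntidiagonal.antidiagonal m,
          pairSup fun i => (0 : Piece.dom p i →ᵇ ℝ))
        + ∑ γ ∈ Finset.HasAntidiagonal.antidiagonal k, pairHol (fun i => (0 : Piece.dom p i →ᵇ ℝ)) = 0
      simp [pairSup, pairHol, holNorm_zero]

noncomputable instance (p : Params) (k : ℕ) : NormedAddCommGroup (X p k) :=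
  NormedAddCommGroup.ofCore (X.norm_core p k)

noncomputable instance (p : Params) (k : ℕ) : NormedSpace ℝ (X p k) :=
  NormedSpace.ofCore (X.norm_core p k)

/-! ### The spaces `C_♯^{k+α}` of functions on `[-ℓ/2, ℓ/2]` -/

/-- Functions on `[-ℓ/2, ℓ/2]` of class `C^{k+α}` which match at the end points with all their
derivatives up to the order `k`; `ζ j` is the derivative of order `j ≤ k` (and `0` for `j > k`). -/
def CSub (p : Params) (k : ℕ) : Submodule ℝ (ℕ → (cell p →ᵇ ℝ)) where
  carrier := {ζ |
    (∀ j, k < j → ζ j = 0) ∧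
    (∀ j, j < k → ∀ y ∈ cell p, HasDerivWithinAt (ev1 (ζ j)) (ev1 (ζ (j + 1)) y) (cell p) y) ∧
    (∀ j, j ≤ k → ev1 (ζ j) (-(p.ℓ / 2)) = ev1 (ζ j) (p.ℓ / 2)) ∧
    MemHolder p.α (ζ k : cell p → ℝ)}
  zero_mem' := by
    refine ⟨?_, ?_, ?_, ?_⟩
    · intros; rfl
    · intro j _ y _
      have : ev1 ((0 : ℕ → (cell p →ᵇ ℝ)) j) = fun _ => 0 := by
        funext s; simp only [Pi.zero_apply, ev1_zero]
      rw [this]; simp only [Pi.zero_apply, ev1_zero]; exact hasDerivWithinAt_const _ _ _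
    · intros; simp only [Pi.zero_apply, ev1_zero]
    · simp only [Pi.zero_apply, BoundedContinuousFunction.coe_zero]
      exact memHolder_zero
  add_mem' := by
    rintro u v ⟨h1, h2, h3, h4⟩ ⟨g1, g2, g3, g4⟩
    refine ⟨?_, ?_, ?_, ?_⟩
    · intro j h; simp [h1 j h, g1 j h]
    · intro j h y hy
      have : ev1 ((u + v) j) = ev1 (u j) + ev1 (v j) := by
        funext s; simp only [Pi.add_apply, ev1_add]
      rw [this]; simp only [Pi.add_apply, ev1_add]
      exact (h2 j h y hy).add (g2 j h y hy)
    · intro j h; simp only [Pi.add_apply, ev1_add, h3 j h, g3 j h]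
    · simp only [Pi.add_apply, BoundedContinuousFunction.coe_add]
      exact h4.add g4
  smul_mem' := by
    rintro c u ⟨h1, h2, h3, h4⟩
    refine ⟨?_, ?_, ?_, ?_⟩
    · intro j h; simp [h1 j h]
    · intro j h y hy
      have : ev1 ((c • u) j) = fun s => c * ev1 (u j) s := by
        funext s; simp only [Pi.smul_apply, ev1_smul]
      rw [this]; simp only [Pi.smul_apply, ev1_smul]
      exact (h2 j h y hy).const_mul c
    · intro j h; simp only [Pi.smul_apply, ev1_smul, h3 j h]
    · have h5 : ((c • u k : cell p →ᵇ ℝ) : cell p → ℝ) = c • (u k : cell p → ℝ) := by ext; simp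
      simp only [Pi.smul_apply]
      rw [h5]
      exact h4.smul

/-- The space `C_♯^{k+α}([-ℓ/2, ℓ/2])`. -/
def CPer (p : Params) (k : ℕ) : Type := ↥(CSub p k)

noncomputable instance (p : Params) (k : ℕ) : AddCommGroup (CPer p k) :=
  inferInstanceAs (AddCommGroup ↥(CSub p k))

noncomputable instance (p : Params) (k : ℕ) : Module ℝ (CPer p k) :=
  inferInstanceAs (Module ℝ ↥(CSub p k))

noncomputable instance (p : Params) (k : ℕ) : Norm (CPer p k) where
  norm ζ := (∑ j ∈ Finset.range k, ‖ζ.1 j‖) + holNorm p.α (ζ.1 k)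

theorem CPer.norm_core (p : Params) (k : ℕ) : NormedSpace.Core ℝ (CPer p k) where
  norm_nonneg u := add_nonneg (Finset.sum_nonneg fun _ _ => norm_nonneg _) (holNorm_nonneg _)
  norm_smul c u := by
    change (∑ j ∈ Finset.range k, ‖c • u.1 j‖) + holNorm p.α (c • u.1 k)
      = ‖c‖ * ((∑ j ∈ Finset.range k, ‖u.1 j‖) + holNorm p.α (u.1 k))
    rw [holNorm_smul u.2.2.2.2, mul_add, Finset.mul_sum]
    simp only [norm_smul, Real.norm_eq_abs]
  norm_triangle u v := by
    change (∑ j ∈ Finset.range k, ‖u.1 j + v.1 j‖) + holNorm p.α (u.1 k + v.1 k)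
      ≤ ((∑ j ∈ Finset.range k, ‖u.1 j‖) + holNorm p.α (u.1 k))
        + ((∑ j ∈ Finset.range k, ‖v.1 j‖) + holNorm p.α (v.1 k))
    rw [add_add_add_comm, ← Finset.sum_add_distrib]
    exact add_le_add (Finset.sum_le_sum fun _ _ => norm_add_le _ _)
      (holNorm_add u.2.2.2.2 v.2.2.2.2)
  norm_eq_zero_iff u := by
    constructor
    · intro h
      change (∑ j ∈ Finset.range k, ‖u.1 j‖) + holNorm p.α (u.1 k) = 0 at h
      have n1 : 0 ≤ ∑ j ∈ Finset.range k, ‖u.1 j‖ := Finset.sum_nonneg fun _ _ => norm_nonneg _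
      have n2 : 0 ≤ holNorm p.α (u.1 k) := holNorm_nonneg _
      have z1 := le_antisymm (by linarith) n1
      have z2 := le_antisymm (by linarith) n2
      refine Subtype.ext (funext fun j => ?_)
      rcases lt_trichotomy j k with hk | hk | hk
      · rw [Finset.sum_eq_zero_iff_of_nonneg (fun _ _ => norm_nonneg _)] at z1
        exact norm_eq_zero.1 (z1 j (Finset.mem_range.2 hk))
      · subst hk
        exact norm_le_zero_iff.1 ((norm_le_holNorm _).trans z2.le)
      · exact u.2.1 j hk
    · rintro rfl
      change (∑ j ∈ Finset.range k, ‖(0 : cell p →ᵇ ℝ)‖) + holNorm p.α (0 : cell p →ᵇ ℝ) = 0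
      simp [holNorm_zero]

noncomputable instance (p : Params) (k : ℕ) : NormedAddCommGroup (CPer p k) :=
  NormedAddCommGroup.ofCore (CPer.norm_core p k)

noncomputable instance (p : Params) (k : ℕ) : NormedSpace ℝ (CPer p k) :=
  NormedSpace.ofCore (CPer.norm_core p k)

/-- The derivative of order `j` of a function of class `C_♯^{k+α}`. -/
noncomputable def CPer.d {p : Params} {k : ℕ} (ζ : CPer p k) (j : ℕ) : ℝ → ℝ := ev1 (ζ.1 j)

theorem CPer.d_add {p : Params} {k : ℕ} (ζ ξ : CPer p k) (j : ℕ) (y : ℝ) :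
    (ζ + ξ).d j y = ζ.d j y + ξ.d j y := ev1_add _ _ _

theorem CPer.d_smul {p : Params} {k : ℕ} (c : ℝ) (ζ : CPer p k) (j : ℕ) (y : ℝ) :
    (c • ζ).d j y = c * ζ.d j y := ev1_smul _ _ _

/-- The data `h = (h₁, …, h₉)` of the lifting: `h₁, h₂` of class `C_♯^{2+α}`, `h₃, …, h₇` of class
`C_♯^{1+α}`, `h₈, h₉` of class `C_♯^α`, such that `h₆ - (Le / (θ R)) h₅` is of class `C_♯^{2+α}`.
The last function is stored as the third entry of the first factor, so that its norm is part of
the norm of the data. -/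
noncomputable def DataSub (p : Params) :
    Submodule ℝ ((Fin 3 → CPer p 2) × (Fin 5 → CPer p 1) × (Fin 2 → CPer p 0)) where
  carrier := {h | ∀ y ∈ cell p,
    (h.1 2).d 0 y = (h.2.1 3).d 0 y - p.Le / (p.θ * p.R) * (h.2.1 2).d 0 y}
  zero_mem' := by
    intro y _
    have : ∀ k, (0 : CPer p k).d 0 y = 0 := fun k => ev1_zero y
    simp [this]
  add_mem' := by
    intro h g hh hg y hy
    have h1 := hh y hy
    have h2 := hg y hy
    simp only [Prod.fst_add, Prod.snd_add, Pi.add_apply, CPer.d_add, h1, h2]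
    ring
  smul_mem' := by
    intro c h hh y hy
    have h1 := hh y hy
    simp only [Prod.smul_fst, Prod.smul_snd, Pi.smul_apply, CPer.d_smul, h1]
    ring

/-- The normed space of the data. -/
abbrev Data (p : Params) : Type := ↥(DataSub p)

/-- The functions `h₁, …, h₉` (numbered from `0` to `8` here). -/
noncomputable def Data.fn {p : Params} (h : Data p) : Fin 9 → ℝ → ℝ :=
  ![(h.1.1 0).d 0, (h.1.1 1).d 0,
    (h.1.2.1 0).d 0, (h.1.2.1 1).d 0, (h.1.2.1 2).d 0, (h.1.2.1 3).d 0, (h.1.2.1 4).d 0,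
    (h.1.2.2 0).d 0, (h.1.2.2 1).d 0]

/-! ### The linear operators -/

/-- A pair of functions, given piecewise (values outside the strip of a piece are irrelevant). -/
abbrev PairFun : Type := Piece → ℝ → ℝ → ℝ

/-- The pair `D_x^a D_y^b u`. -/
noncomputable def X.D {p : Params} {k : ℕ} (u : X p k) (a b : ℕ) : PairFun :=
  fun i x y => ev (u.1 i (a, b)) x y

theorem X.D_zero {p : Params} {k : ℕ} (a b : ℕ) (i : Piece) (x y : ℝ) :
    (0 : X p k).D a b i x y = 0 := ev_zero _ _

theorem X.D_add {p : Params} {k : ℕ} (u v : X p k) (a b : ℕ) (i : Piece) (x y : ℝ) :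
    (u + v).D a b i x y = u.D a b i x y + v.D a b i x y := ev_add _ _ _ _

theorem X.D_smul {p : Params} {k : ℕ} (c : ℝ) (u : X p k) (a b : ℕ) (i : Piece) (x y : ℝ) :
    (c • u).D a b i x y = c * u.D a b i x y := ev_smul _ _ _ _

/-- The elliptic operator `(Δζ + ζ_x, Le⁻¹ Δυ + υ_x)`. -/
noncomputable def Lop {p : Params} (u : X p 2) : PairFun := fun i x y =>
  match i with
  | .m1 | .c1 | .p1 => u.D 2 0 i x y + u.D 0 2 i x y + u.D 1 0 i x y
  | .c2 | .p2 => p.Le⁻¹ * (u.D 2 0 i x y + u.D 0 2 i x y) + u.D 1 0 i x y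

/-- The jumps of the first component at `x = 0` and at `x = R`. -/
noncomputable def B0 (p : Params) (f : PairFun) (y : ℝ) : Fin 2 → ℝ :=
  ![f .c1 0 y - f .m1 0 y, f .p1 p.R y - f .c1 p.R y]

/-- The boundary operator `𝓑`. -/
noncomputable def Bop {p : Params} (u : X p 2) (y : ℝ) : Fin 7 → ℝ :=
  ![u.D 0 0 .c1 0 y - u.D 0 0 .m1 0 y,
    u.D 0 0 .p1 p.R y - u.D 0 0 .c1 p.R y,
    p.Le * (u.D 1 0 .c1 0 y - u.D 1 0 .m1 0 y) + u.D 0 0 .c2 0 y,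
    p.Le * u.D 0 0 .c2 0 y + u.D 1 0 .c2 0 y,
    u.D 0 0 .p1 p.R y + p.θ * p.R * (u.D 1 0 .p1 p.R y - u.D 1 0 .c1 p.R y),
    p.Le * (u.D 1 0 .p1 p.R y - u.D 1 0 .c1 p.R y) + (u.D 0 0 .p2 p.R y - u.D 0 0 .c2 p.R y),
    p.Le * (u.D 0 0 .p2 p.R y - u.D 0 0 .c2 p.R y) + (u.D 1 0 .p2 p.R y - u.D 1 0 .c2 p.R y)]

/-- The operator `𝓑_* = (𝓑̃, 𝓑₀ 𝓛)`, where `𝓑̃` is `𝓑` with the trace of the first component at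
`x = R⁺` in the fifth entry replaced by the mean of the two one-sided traces. -/
noncomputable def Bstar {p : Params} (u : X p 2) (y : ℝ) : Fin 9 → ℝ :=
  ![Bop u y 0, Bop u y 1, Bop u y 2, Bop u y 3,
    (u.D 0 0 .p1 p.R y + u.D 0 0 .c1 p.R y) / 2
      + p.θ * p.R * (u.D 1 0 .p1 p.R y - u.D 1 0 .c1 p.R y),
    Bop u y 5, Bop u y 6, B0 p (Lop u) y 0, B0 p (Lop u) y 1]

theorem Bop_add {p : Params} (u v : X p 2) (y : ℝ) : Bop (u + v) y = Bop u y + Bop v y := by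
  funext j; fin_cases j <;> simp [Bop, X.D_add] <;> ring

theorem Bop_smul {p : Params} (c : ℝ) (u : X p 2) (y : ℝ) : Bop (c • u) y = c • Bop u y := by
  funext j; fin_cases j <;> simp [Bop, X.D_smul] <;> ring

theorem Lop_add {p : Params} (u v : X p 2) : Lop (u + v) = Lop u + Lop v := by
  funext i x y; cases i <;> simp [Lop, X.D_add] <;> ring

theorem Lop_smul {p : Params} (c : ℝ) (u : X p 2) : Lop (c • u) = c • Lop u := by
  funext i x y; cases i <;> simp [Lop, X.D_smul] <;> ring

theorem B0_add (p : Params) (f g : PairFun) (y : ℝ) : B0 p (f + g) y = B0 p f y + B0 p g y := by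
  funext j; fin_cases j <;> simp [B0] <;> ring

theorem B0_smul (p : Params) (c : ℝ) (f : PairFun) (y : ℝ) : B0 p (c • f) y = c • B0 p f y := by
  funext j; fin_cases j <;> simp [B0] <;> ring

/-- The (real) domain of `L_α`: the functions `u ∈ X_{2+α}` such that `𝓑 u = 0`, `𝓑₀ 𝓛 u = 0` and
`𝓛 u` vanishes as `x → ± ∞`, with the norm of `X_{2+α}`. -/
noncomputable def DL (p : Params) : Submodule ℝ (X p 2) where
  carrier := {u |
    (∀ y ∈ cell p, Bop u y = 0) ∧
    (∀ y ∈ cell p, B0 p (Lop u) y = 0) ∧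
    (∀ y ∈ cell p, Tendsto (fun x => Lop u .m1 x y) atBot (𝓝 0)) ∧
    (∀ y ∈ cell p, Tendsto (fun x => Lop u .p1 x y) atTop (𝓝 0)) ∧
    (∀ y ∈ cell p, Tendsto (fun x => Lop u .p2 x y) atTop (𝓝 0))}
  zero_mem' := by
    have hB : ∀ y, Bop (0 : X p 2) y = 0 := by
      intro y; simpa using Bop_smul (0 : ℝ) (0 : X p 2) y
    have hL : Lop (0 : X p 2) = 0 := by simpa using Lop_smul (0 : ℝ) (0 : X p 2)
    refine ⟨fun y _ => hB y, fun y _ => ?_, fun y _ => ?_, fun y _ => ?_, fun y _ => ?_⟩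
    · rw [hL]; simpa using B0_smul p 0 0 y
    all_goals rw [hL]; exact tendsto_const_nhds
  add_mem' := by
    rintro u v ⟨h1, h2, h3, h4, h5⟩ ⟨g1, g2, g3, g4, g5⟩
    refine ⟨fun y hy => ?_, fun y hy => ?_, fun y hy => ?_, fun y hy => ?_, fun y hy => ?_⟩
    · rw [Bop_add, h1 y hy, g1 y hy, add_zero]
    · rw [Lop_add, B0_add, h2 y hy, g2 y hy, add_zero]
    · rw [Lop_add]; simpa using (h3 y hy).add (g3 y hy)
    · rw [Lop_add]; simpa using (h4 y hy).add (g4 y hy)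
    · rw [Lop_add]; simpa using (h5 y hy).add (g5 y hy)
  smul_mem' := by
    rintro c u ⟨h1, h2, h3, h4, h5⟩
    refine ⟨fun y hy => ?_, fun y hy => ?_, fun y hy => ?_, fun y hy => ?_, fun y hy => ?_⟩
    · rw [Bop_smul, h1 y hy, smul_zero]
    · rw [Lop_smul, B0_smul, h2 y hy, smul_zero]
    · rw [Lop_smul]; simpa using (h3 y hy).const_mul c
    · rw [Lop_smul]; simpa using (h4 y hy).const_mul c
    · rw [Lop_smul]; simpa using (h5 y hy).const_mul c

/-! ### The lifting operator -/

/-- The `ℓ`-periodic extension to `ℝ` of a function on `[-ℓ/2, ℓ/2)`. -/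
noncomputable def sharp (p : Params) (f : ℝ → ℝ) (y : ℝ) : ℝ :=
  f (y - p.ℓ * ⌊(y + p.ℓ / 2) / p.ℓ⌋)

section lifting

variable {p : Params} (c : Cutoffs p)

noncomputable def N1 (ζ : ℝ → ℝ) (x y : ℝ) : ℝ :=
  1 / 2 * c.η x * ((Ici (0 : ℝ)).indicator (fun _ => (1 : ℝ)) x
    - (Iic (0 : ℝ)).indicator (fun _ => (1 : ℝ)) x)
    * ∫ s, c.φ s * sharp p ζ (y + s * x ^ 3)

noncomputable def N2 (ζ : ℝ → ℝ) (x y : ℝ) : ℝ :=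
  |x| * c.η x * ∫ s, c.φ s * sharp p ζ (y + s * |x|)

noncomputable def N3 (ζ : ℝ → ℝ) (x y : ℝ) : ℝ := x / 4 * N2 c ζ x y

/-- First component of the lifting. -/
noncomputable def lift1 (h : Data p) (x y : ℝ) : ℝ :=
  N1 c (h.fn 0) x y + N1 c (h.fn 1) (x - p.R) y
    + N2 c (h.fn 2) x y / (2 * p.Le) + N2 c (h.fn 4) (x - p.R) y / (2 * p.θ * p.R)
    + N3 c (fun s => h.fn 7 s - 1 / p.Le * h.fn 2 s - (h.1.1 0).d 2 s) x y
    + N3 c (fun s => h.fn 8 s - 1 / (p.θ * p.R) * h.fn 4 s - (h.1.1 1).d 2 s) (x - p.R) y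

/-- Second component of the lifting. -/
noncomputable def lift2 (h : Data p) (x y : ℝ) : ℝ :=
  N1 c (fun s => h.fn 5 s - p.Le / (p.θ * p.R) * h.fn 4 s) (x - p.R) y
    + N2 c (h.fn 3) x y
    + 1 / 2 * N2 c (fun s => h.fn 6 s - p.Le * h.fn 5 s + p.Le ^ 2 / (p.θ * p.R) * h.fn 4 s)
        (x - p.R) y

/-- The pair `𝓝 h`. -/
noncomputable def lift (h : Data p) : PairFun := fun i =>
  match i with
  | .m1 | .c1 | .p1 => lift1 c h
  | .c2 | .p2 => lift2 c h

end lifting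

/-! ### The travelling wave and the nonlinear terms -/

/-- The temperature profile of the planar front, one smooth formula for each part. -/
noncomputable def Theta0 (p : Params) : Reg → ℝ → ℝ
  | .minus => fun _ => 1
  | .mid => fun x => 1 + (1 - x - Real.exp (-x)) / p.R
  | .plus => fun x => p.θ * Real.exp (p.R - x)

/-- The concentration profile of the planar front, one smooth formula for each part. -/
noncomputable def Phi0 (p : Params) : Reg → ℝ → ℝ
  | .minus => fun _ => 0
  | .mid => fun x => (Real.exp (-(p.Le * x)) - 1) / (p.Le * p.R) + x / p.R
  | .plus => fun x =>
      1 + (1 - Real.exp (p.Le * p.R)) / (p.Le * p.R * Real.exp (p.Le * x))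

section nonlinear

variable {p : Params} (c : Cutoffs p)

/-- `D_x^m D_y^n ϱ` for `ϱ = θ⁻¹ β(x - R) ζ(R⁺, y) - R Le⁻¹ β(x) υ(0⁺, y)`. -/
noncomputable def rho (u : X p 2) (m n : ℕ) (x y : ℝ) : ℝ :=
  p.θ⁻¹ * iteratedDeriv m c.β (x - p.R) * u.D 0 n .p1 p.R y
    - p.R * p.Le⁻¹ * iteratedDeriv m c.β x * u.D 0 n .c2 0 y

/-- Common form of `𝓕₁` and `𝓖₁`: here `w2` is the value of the second derivative of the profile
and `wx` the value of the derivative of the perturbation. -/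
noncomputable def nl1 (u : X p 2) (w2 wx : ℝ) (x y : ℝ) : ℝ :=
  (rho c u 0 0 x y * w2 + wx) / (1 + rho c u 1 0 x y)

/-- Common form of `𝓕₂` (with `κ = 1`) and `𝓖₂` (with `κ = Le`): `w2`, `w3` are the values of the
second and third derivatives of the profile and `wx`, `wxy`, `wxx` the values of the derivatives
of the perturbation. -/
noncomputable def nl2 (κ : ℝ) (u : X p 2) (w2 w3 wx wxy wxx : ℝ) (x y : ℝ) : ℝ :=
  let r := rho c u 0 0 x y
  let rx := rho c u 1 0 x y
  let ry := rho c u 0 1 x y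
  let rxx := rho c u 2 0 x y
  let rxy := rho c u 1 1 x y
  let ryy := rho c u 0 2 x y
  ((κ * rx + ryy) * (r * w2 + wx) + 2 * ry ^ 2 * w2 + 2 * ry * wxy) / (1 + rx)
    - (2 * ry * rxy * (r * w2 + wx) + (ry ^ 2 - rx ^ 2) * (r * w3 + w2 + wxx)
        - 2 * rx * (r * w3 - ry ^ 2 * w2 + wxx)) / (1 + rx) ^ 2
    + rxx * (1 + ry ^ 2) * (r * w2 + wx) / (1 + rx) ^ 3

noncomputable def F1 (u : X p 2) (i : Piece) (x y : ℝ) : ℝ :=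
  nl1 c u (iteratedDeriv 2 (Theta0 p i.reg) x) (u.D 1 0 i x y) x y

noncomputable def F2 (u : X p 2) (i : Piece) (x y : ℝ) : ℝ :=
  nl2 c 1 u (iteratedDeriv 2 (Theta0 p i.reg) x) (iteratedDeriv 3 (Theta0 p i.reg) x)
    (u.D 1 0 i x y) (u.D 1 1 i x y) (u.D 2 0 i x y) x y

noncomputable def G1 (u : X p 2) (i : Piece) (x y : ℝ) : ℝ :=
  nl1 c u (iteratedDeriv 2 (Phi0 p i.reg) x) (u.D 0 0 i x y) x y

noncomputable def G2 (u : X p 2) (i : Piece) (x y : ℝ) : ℝ :=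
  nl2 c p.Le u (iteratedDeriv 2 (Phi0 p i.reg) x) (iteratedDeriv 3 (Phi0 p i.reg) x)
    (u.D 0 0 i x y) (u.D 0 1 i x y) (u.D 1 0 i x y) x y

/-- The factor of `Λ` which comes from the ignition interface (all traces are taken at `R⁺`). -/
noncomputable def LamR (u : X p 2) (y : ℝ) : ℝ :=
  let z := u.D 0 0 .p1 p.R y
  let zx := u.D 1 0 .p1 p.R y
  let zy := u.D 0 1 .p1 p.R y
  let zxx := u.D 2 0 .p1 p.R y
  let zxy := u.D 1 1 .p1 p.R y
  let zyy := u.D 0 2 .p1 p.R y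
  (p.θ - z - zx)⁻¹ *
    (zx + (zxx + zyy) - p.θ⁻¹ * zyy * zx - 2 * p.θ⁻¹ * zy * zxy
      + (p.θ ^ 2)⁻¹ * zy ^ 2 * (zxx - z - p.θ) - p.θ⁻¹ * z * zyy)

/-- The factor of `Λ` which comes from the trailing interface (all traces are taken at `0⁺`). -/
noncomputable def LamZero (u : X p 2) (y : ℝ) : ℝ :=
  let w := u.D 0 0 .c2 0 y
  let wx := u.D 1 0 .c2 0 y
  let wy := u.D 0 1 .c2 0 y
  let wxx := u.D 2 0 .c2 0 y
  let wxy := u.D 1 1 .c2 0 y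
  let wyy := u.D 0 2 .c2 0 y
  (p.Le ^ 2 + p.R * p.Le * (p.Le * w + wx))⁻¹ *
    (p.Le * wx + (wxx + wyy)
      + p.R * p.Le⁻¹ * (wyy * (p.Le * w + wx) + 2 * wy * wxy)
      + p.R ^ 2 * (p.Le ^ 2)⁻¹ * wy ^ 2 * (-p.Le ^ 2 * w + p.R⁻¹ * p.Le ^ 2 + wxx))

/-- `Λ`, with weights `a` and `b` in front of its two factors. The weights `a = β(· - R)`, `b = R β`
give the time derivative of `ϱ`. -/
noncomputable def Lam (a b : ℝ → ℝ) (u : X p 2) (x y : ℝ) : ℝ :=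
  a x * LamR u y - b x * LamZero u y

/-- The nonlinear term `𝓕`. -/
noncomputable def Fop (a b : ℝ → ℝ) (u : X p 2) : PairFun := fun i x y =>
  match i with
  | .m1 | .c1 | .p1 => Lam a b u x y * F1 c u i x y - F2 c u i x y
  | .c2 | .p2 =>
      Lam a b u x y * derivWithin (fun s => G1 c u i s y) (i.reg.ivl p) x
        + derivWithin (fun s => Lam a b u s y) (i.reg.ivl p) x * G1 c u i x y
        - p.Le⁻¹ * derivWithin (fun s => G2 c u i s y) (i.reg.ivl p) x

/-- The nonlinear boundary term `𝓗`. -/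
noncomputable def Hop (u : X p 2) (y : ℝ) : Fin 7 → ℝ :=
  ![0, 0, 0,
    -(p.R * p.Le * u.D 0 1 .c2 0 y ^ 2) / (p.Le ^ 2 + p.R ^ 2 * u.D 0 1 .c2 0 y ^ 2),
    0, 0,
    p.Le * u.D 0 1 .p1 p.R y ^ 2 / (p.R * (p.θ ^ 2 + u.D 0 1 .p1 p.R y ^ 2))]

/-- The set of the functions of `X_{2+α}` which satisfy the nonlinear boundary condition
`𝓑 u = 𝓗(u)` and the compatibility condition `𝓑₀ (𝓛 u + 𝓕(u)) = 0`. -/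
def compatSet (a b : ℝ → ℝ) : Set (X p 2) :=
  {u | (∀ y ∈ cell p, Bop u y = Hop u y) ∧
    ∀ y ∈ cell p, B0 p (Lop u + Fop c a b u) y = 0}

end nonlinear

end ThickFlame

/-! Linear part. Each of the five strip pieces carries the family of its derivatives up to the
boundary, so `𝓑_*` is a combination of trace maps into the spaces `C_♯^{m+α}`. The one entry of
unexpected regularity is `h₆ - (Le / (θ R)) h₅`: the jumps of `ζ_x` at `R`, which have only class
`C^{1+α}`, cancel in it (`bs_mem`).

The right inverse rests on averages `∫ ψ(t) g(y + t s) dt`. Integration by parts in `t`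
(`IsKer.mul_avg`) trades a factor `s` and a derivative of `g` for a derivative of `ψ`. Hence `x`
times an average of a `C^{1+α}` function, and `x²` times an average of a `C^α` function, are of
class `C^{2+α}` up to `x = 0`. As `φ` is even, `|x|` may be replaced by `x` inside the averages, so
every building block is, on each side of its interface, plus or minus the restriction of one
`C^{2+α}` function on the plane (`isJet_core1`, `isJet_core2`, `isJet_core3`). The moments of `φ`,
`φ'`, `φ''` determine the boundary values: the first core prescribes the trace, the second the
normal derivative, the third the second normal derivative. The first core also has the tangential
derivative `ζ''`, which is why `h₁''` and `h₂''` are subtracted in the argument of `N₃`. The cut-off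
keeps the blocks of one interface away from the other, and the nine equations are then solved
triangularly (`Bs_liftN`). Given `𝓑_* 𝓝 = I`, the statements on `P` are algebra; the kernel is
`D(L_α)` because `[ζ]_R = 0` identifies the mean trace at `R` with the trace at `R⁺`, and because
decay of all derivatives is built into `X_{2+α}` (`Bs_eq_zero_iff`).

Nonlinear part. The factor `β` is locally constant at `0` and at `±R`, so all `x`-derivatives of `ϱ`
vanish on the interfaces, and the traces of the first component of `𝓕` are polynomial in traces of
`u`, except for the denominators of `Λ`. For small `u` these do not vanish and can be multiplied
away. So `u ∈ 𝓘` means that `𝓑_* u` is concentrated in the entries 4, 7, 8, 9, and that these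
entries `k` solve `k + q(u, k) = 0` with `q` of second order at `0` (`mem_compatSet_iff`,
`bdryRem_quad`). Writing `u = v + 𝓝 k` with `v = P u` gives an equation of the same kind for `(v,
k)`. The map `(v, k) ↦ (v, k + q)` has the identity as derivative at `0`, and the inverse function
theorem gives `k = h(v)` (`Quad.exists_solution`), hence `Υ = 𝓝 ∘ h`.

The inverse function theorem asks for complete spaces. Since `q` sees `u` only through traces with
values in the complete spaces `C_♯^{m+α}`, it extends to the completion of `X_{2+α}`; the equation
is solved there, and the solution is restricted to `D(L_α)`. No completeness of `X_{2+α}` itself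
enters. -/

namespace ThickFlame

/-! ### Bounded Hölder functions on a set -/

/-- `f` is bounded by `C` and `α`-Hölder continuous with constant `C` on `s`. -/
def BHOn {E : Type*} [PseudoMetricSpace E] (α : ℝ≥0) (C : ℝ) (f : E → ℝ) (s : Set E) : Prop :=
  (∀ x ∈ s, |f x| ≤ C) ∧ ∀ x ∈ s, ∀ y ∈ s, |f x - f y| ≤ C * dist x y ^ (α : ℝ)

namespace BHOn

variable {E : Type*} [PseudoMetricSpace E] {α : ℝ≥0} {C D : ℝ} {f g : E → ℝ} {s : Set E}

theorem mono (h : BHOn α C f s) (hC : C ≤ D) : BHOn α D f s :=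
  ⟨fun x hx => (h.1 x hx).trans hC, fun x hx y hy => (h.2 x hx y hy).trans
    (mul_le_mul_of_nonneg_right hC (Real.rpow_nonneg dist_nonneg _))⟩

theorem congr (h : BHOn α C f s) (hfg : ∀ x ∈ s, g x = f x) : BHOn α C g s :=
  ⟨fun x hx => by rw [hfg x hx]; exact h.1 x hx,
    fun x hx y hy => by rw [hfg x hx, hfg y hy]; exact h.2 x hx y hy⟩

theorem add (hf : BHOn α C f s) (hg : BHOn α D g s) :
    BHOn α (C + D) (fun x => f x + g x) s := by
  refine ⟨fun x hx => (abs_add_le _ _).trans (add_le_add (hf.1 x hx) (hg.1 x hx)),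
    fun x hx y hy => ?_⟩
  have h1 := hf.2 x hx y hy
  have h2 := hg.2 x hx y hy
  have h3 := abs_add_le (f x - f y) (g x - g y)
  rw [show f x + g x - (f y + g y) = f x - f y + (g x - g y) by ring]
  linarith [add_mul C D (dist x y ^ (α : ℝ))]

theorem const_mul (hf : BHOn α C f s) (c : ℝ) : BHOn α (|c| * C) (fun x => c * f x) s := by
  refine ⟨fun x hx => ?_, fun x hx y hy => ?_⟩
  · rw [abs_mul]; exact mul_le_mul_of_nonneg_left (hf.1 x hx) (abs_nonneg c)
  · rw [← mul_sub, abs_mul, mul_assoc]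
    exact mul_le_mul_of_nonneg_left (hf.2 x hx y hy) (abs_nonneg c)

/-- The difference of products splits as `f(x)(g(x) - g(y)) + (f(x) - f(y))g(y)`; each half
contributes `C D`, hence the factor `2`. -/
theorem mul (hf : BHOn α C f s) (hg : BHOn α D g s) :
    BHOn α (2 * (C * D)) (fun x => f x * g x) s := by
  have hC : ∀ x ∈ s, 0 ≤ C := fun x hx => (abs_nonneg _).trans (hf.1 x hx)
  have hD : ∀ x ∈ s, 0 ≤ D := fun x hx => (abs_nonneg _).trans (hg.1 x hx)
  refine ⟨fun x hx => ?_, fun x hx y hy => ?_⟩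
  · rw [abs_mul]
    have := mul_le_mul (hf.1 x hx) (hg.1 x hx) (abs_nonneg _) (hC x hx)
    nlinarith [mul_nonneg (hC x hx) (hD x hx)]
  · rw [show f x * g x - f y * g y = f x * (g x - g y) + (f x - f y) * g y by ring]
    refine (abs_add_le _ _).trans ?_
    rw [abs_mul, abs_mul]
    have h1 := mul_le_mul (hf.1 x hx) (hg.2 x hx y hy) (abs_nonneg _) (hC x hx)
    have h2 := mul_le_mul (hf.2 x hx y hy) (hg.1 y hy) (abs_nonneg _)
      (mul_nonneg (hC x hx) (Real.rpow_nonneg dist_nonneg _))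
    linarith

/-- Since `K ≥ 1` and `α ≤ 1`, one has `K ^ α ≤ K`, so the single constant `C * K` serves both the
bound and the Hölder estimate. -/
theorem comp {E' : Type*} [PseudoMetricSpace E'] {t : Set E'} {φ : E' → E} {K : ℝ}
    (hα : α ≤ 1) (hK : 1 ≤ K)
    (hf : BHOn α C f s) (hφ : ∀ x ∈ t, φ x ∈ s)
    (hL : ∀ x ∈ t, ∀ y ∈ t, dist (φ x) (φ y) ≤ K * dist x y) :
    BHOn α (C * K) (fun x => f (φ x)) t := by
  have hC : ∀ x ∈ t, 0 ≤ C := fun x hx => (abs_nonneg _).trans (hf.1 _ (hφ x hx))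
  refine ⟨fun x hx => (hf.1 _ (hφ x hx)).trans (le_mul_of_one_le_right (hC x hx) hK),
    fun x hx y hy => (hf.2 _ (hφ x hx) _ (hφ y hy)).trans ?_⟩
  rw [mul_assoc]
  refine mul_le_mul_of_nonneg_left ?_ (hC x hx)
  calc dist (φ x) (φ y) ^ (α : ℝ) ≤ (K * dist x y) ^ (α : ℝ) :=
        Real.rpow_le_rpow dist_nonneg (hL x hx y hy) α.2
    _ = K ^ (α : ℝ) * dist x y ^ (α : ℝ) := Real.mul_rpow (by linarith) dist_nonneg
    _ ≤ K * dist x y ^ (α : ℝ) := by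
        refine mul_le_mul_of_nonneg_right ?_ (Real.rpow_nonneg dist_nonneg _)
        simpa using Real.rpow_le_rpow_of_exponent_le hK (show (α : ℝ) ≤ 1 by exact_mod_cast hα)

/-- At distances at most `1` the distance is dominated by its power `α`; at larger distances the
trivial bound `2 * C` on the difference suffices. -/
theorem of_lipschitz (hα : α ≤ 1) (hb : ∀ x ∈ s, |f x| ≤ C)
    (hL : ∀ x ∈ s, ∀ y ∈ s, |f x - f y| ≤ C * dist x y) : BHOn α (2 * C) f s := by
  have hC : ∀ x ∈ s, 0 ≤ C := fun x hx => (abs_nonneg _).trans (hb x hx)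
  refine ⟨fun x hx => by linarith [hb x hx, hC x hx], fun x hx y hy => ?_⟩
  rcases le_total (dist x y) 1 with hd | hd
  · have h1 : dist x y ≤ dist x y ^ (α : ℝ) := by
      simpa using Real.rpow_le_rpow_of_exponent_ge_of_imp dist_nonneg hd
        (show (α : ℝ) ≤ 1 by exact_mod_cast hα) (by simp)
    have h2 := mul_le_mul_of_nonneg_left h1 (hC x hx)
    have h3 := mul_nonneg (hC x hx) (Real.rpow_nonneg (dist_nonneg (x := x) (y := y)) (α : ℝ))
    linarith [hL x hx y hy]
  · have h1 : 1 ≤ dist x y ^ (α : ℝ) := Real.one_le_rpow hd α.2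
    have h2 : |f x - f y| ≤ 2 * C := by
      have := abs_sub (f x) (f y)
      linarith [hb x hx, hb y hy]
    exact h2.trans (le_mul_of_one_le_right (by linarith [hC x hx]) h1)

theorem holderWith (h : BHOn α C f s) (hC : 0 ≤ C) :
    HolderWith C.toNNReal α (fun x : s => f x) := by
  intro x y
  have := h.2 x x.2 y y.2
  rw [edist_dist, edist_dist, ENNReal.ofReal_rpow_of_nonneg dist_nonneg α.coe_nonneg,
    ← ENNReal.ofReal_coe_nnreal, ← ENNReal.ofReal_mul (NNReal.coe_nonneg _), Real.coe_toNNReal C hC]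
  exact ENNReal.ofReal_le_ofReal (by simpa [Real.dist_eq, Subtype.dist_eq] using this)

theorem continuousOn (h : BHOn α C f s) (hα : 0 < α) : ContinuousOn f s := by
  rcases s.eq_empty_or_nonempty with rfl | ⟨x, hx⟩
  · exact continuousOn_empty _
  · have hC : 0 ≤ C := (abs_nonneg _).trans (h.1 x hx)
    rw [continuousOn_iff_continuous_domRestrict]
    exact (h.holderWith hC).continuous hα

/-- Both conditions are closed under pointwise limits. This is what keeps Hölder bounds in the limit
of a Cauchy sequence. -/
theorem tendsto {F : ℕ → E → ℝ} (hF : ∀ᶠ n in atTop, BHOn α C (F n) s)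
    (hlim : ∀ x ∈ s, Tendsto (fun n => F n x) atTop (𝓝 (f x))) : BHOn α C f s := by
  refine ⟨fun x hx => ?_, fun x hx y hy => ?_⟩
  · exact le_of_tendsto (hlim x hx).abs (hF.mono fun n hn => hn.1 x hx)
  · exact le_of_tendsto ((hlim x hx).sub (hlim y hy)).abs (hF.mono fun n hn => hn.2 x hx y hy)

end BHOn

/-! ### Comparison with the Hölder norm of bounded continuous functions -/

section holNorm

variable {E : Type*} [MetricSpace E] {α : ℝ≥0} {s : Set E}

theorem holNorm_le_of_BHOn {C : ℝ} (hC : 0 ≤ C) {f : E → ℝ} {F : s →ᵇ ℝ} (h : BHOn α C f s)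
    (hF : ∀ x : s, F x = f x) : holNorm α F ≤ 2 * C := by
  have h1 : ‖F‖ ≤ C := (BoundedContinuousFunction.norm_le hC).2 fun x => by
    rw [hF, Real.norm_eq_abs]; exact h.1 x x.2
  have h2 : (F : s → ℝ) = fun x : s => f x := funext hF
  have h3 : nnHolderNorm α (F : s → ℝ) ≤ C.toNNReal := by
    rw [h2]; exact (h.holderWith hC).nnholderNorm_le
  have h4 : (nnHolderNorm α (F : s → ℝ) : ℝ) ≤ C := by
    have := NNReal.coe_le_coe.2 h3
    rwa [Real.coe_toNNReal C hC] at this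
  unfold holNorm; linarith

theorem abs_sub_le_nnHolderNorm {F : s →ᵇ ℝ} (hF : MemHolder α (F : s → ℝ)) (x y : s) :
    |F x - F y| ≤ nnHolderNorm α (F : s → ℝ) * dist x y ^ (α : ℝ) := by
  have := hF.holderWith x y
  rw [edist_dist, edist_dist, ENNReal.ofReal_rpow_of_nonneg dist_nonneg α.coe_nonneg,
    ← ENNReal.ofReal_coe_nnreal, ← ENNReal.ofReal_mul (NNReal.coe_nonneg _)] at this
  have h2 := (ENNReal.ofReal_le_ofReal_iff
    (mul_nonneg (NNReal.coe_nonneg _) (Real.rpow_nonneg dist_nonneg _))).1 this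
  simpa [Real.dist_eq] using h2

theorem BHOn_of_memHolder {f : E → ℝ} {F : s →ᵇ ℝ} (hF : MemHolder α (F : s → ℝ))
    (h : ∀ x : s, F x = f x) : BHOn α (holNorm α F) f s := by
  refine ⟨fun x hx => ?_, fun x hx y hy => ?_⟩
  · have := F.norm_coe_le_norm ⟨x, hx⟩
    rw [h, Real.norm_eq_abs] at this
    exact this.trans (norm_le_holNorm F)
  · have := abs_sub_le_nnHolderNorm hF ⟨x, hx⟩ ⟨y, hy⟩
    rw [h, h] at this
    refine this.trans (mul_le_mul_of_nonneg_right ?_ (Real.rpow_nonneg dist_nonneg _))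
    simp [holNorm]

end holNorm

/-! ### The spaces `C_♯^{k+α}` -/

section CPer

variable {p : Params} {k : ℕ}

theorem Params.α_le_one (p : Params) : p.α ≤ 1 := p.α_lt_one.le

theorem left_mem_cell (p : Params) : -(p.ℓ / 2) ∈ cell p := by
  have := p.ℓ_pos; constructor <;> linarith

theorem right_mem_cell (p : Params) : p.ℓ / 2 ∈ cell p := by
  have := p.ℓ_pos; constructor <;> linarith

instance (p : Params) : CompactSpace (cell p) := isCompact_iff_compactSpace.1 isCompact_Icc

theorem ev1_of_mem {K : Set ℝ} (f : K →ᵇ ℝ) {y : ℝ} (hy : y ∈ K) : ev1 f y = f ⟨y, hy⟩ := by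
  simp [ev1, hy]

theorem CPer.norm_def (ζ : CPer p k) :
    ‖ζ‖ = (∑ j ∈ Finset.range k, ‖ζ.1 j‖) + holNorm p.α (ζ.1 k) := rfl

theorem CPer.norm_apply_le (ζ : CPer p k) (j : ℕ) : ‖ζ.1 j‖ ≤ ‖ζ‖ := by
  rcases lt_trichotomy j k with h | rfl | h
  · rw [CPer.norm_def]
    have := Finset.single_le_sum (f := fun j => ‖ζ.1 j‖) (fun i _ => norm_nonneg _)
      (Finset.mem_range.2 h)
    have h2 := holNorm_nonneg (α := p.α) (ζ.1 k)
    linarith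
  · rw [CPer.norm_def]
    have : 0 ≤ ∑ j ∈ Finset.range j, ‖ζ.1 j‖ := Finset.sum_nonneg fun i _ => norm_nonneg _
    linarith [norm_le_holNorm (α := p.α) (ζ.1 j)]
  · rw [ζ.2.1 j h]; simp

theorem CPer.holNorm_le (ζ : CPer p k) : holNorm p.α (ζ.1 k) ≤ ‖ζ‖ := by
  rw [CPer.norm_def]
  have : 0 ≤ ∑ j ∈ Finset.range k, ‖ζ.1 j‖ := Finset.sum_nonneg fun i _ => norm_nonneg _
  linarith

theorem CPer.d_of_mem (ζ : CPer p k) (j : ℕ) {y : ℝ} (hy : y ∈ cell p) :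
    ζ.d j y = ζ.1 j ⟨y, hy⟩ := ev1_of_mem _ hy

theorem CPer.abs_d_le (ζ : CPer p k) (j : ℕ) (y : ℝ) : |ζ.d j y| ≤ ‖ζ‖ := by
  by_cases hy : y ∈ cell p
  · rw [ζ.d_of_mem j hy]
    exact ((ζ.1 j).norm_coe_le_norm _).trans (ζ.norm_apply_le j)
  · simp [CPer.d, ev1, hy]

theorem CPer.BHOn_d (ζ : CPer p k) : BHOn p.α ‖ζ‖ (ζ.d k) (cell p) :=
  (BHOn_of_memHolder ζ.2.2.2.2 fun x => (ζ.d_of_mem k x.2).symm).mono ζ.holNorm_le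

theorem CPer.hasDerivWithinAt (ζ : CPer p k) {j : ℕ} (hj : j < k) {y : ℝ} (hy : y ∈ cell p) :
    HasDerivWithinAt (ζ.d j) (ζ.d (j + 1) y) (cell p) y := ζ.2.2.1 j hj y hy

theorem CPer.d_match (ζ : CPer p k) (j : ℕ) : ζ.d j (-(p.ℓ / 2)) = ζ.d j (p.ℓ / 2) := by
  rcases le_or_gt j k with h | h
  · exact ζ.2.2.2.1 j h
  · simp [CPer.d, ζ.2.1 j h, ev1_zero]

theorem uniqueDiffOn_cell (p : Params) : UniqueDiffOn ℝ (cell p) :=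
  uniqueDiffOn_Icc (by linarith [p.ℓ_pos])

/-- Derivatives within the cell are unique, so the function of order `0` determines the whole
family. Linearity of maps into `C_♯^{k+α}` therefore needs checking only at order `0`. -/
theorem CPer.ext_d {ζ ξ : CPer p k} (h : ∀ y ∈ cell p, ζ.d 0 y = ξ.d 0 y) : ζ = ξ := by
  have key : ∀ j ≤ k, ∀ y ∈ cell p, ζ.d j y = ξ.d j y := by
    intro j
    induction j with
    | zero => exact fun _ => h
    | succ j ih =>
      intro hj y hy
      have h1 := ζ.hasDerivWithinAt (Nat.lt_of_succ_le hj) hy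
      have h2 := ξ.hasDerivWithinAt (Nat.lt_of_succ_le hj) hy
      have ih' := ih (Nat.le_of_succ_le hj)
      exact (uniqueDiffOn_cell p y hy).eq_deriv _ h1 (h2.congr ih' (ih' y hy))
  refine Subtype.ext (funext fun j => ?_)
  rcases le_or_gt j k with hj | hj
  · ext ⟨y, hy⟩
    have := key j hj y hy
    rwa [ζ.d_of_mem, ξ.d_of_mem] at this
  · rw [ζ.2.1 j hj, ξ.2.1 j hj]

/-- A family of functions which has the properties of the derivatives of a function of class
`C_♯^{k+α}`. -/
structure IsCPer (p : Params) (k : ℕ) (C : ℝ) (g : ℕ → ℝ → ℝ) : Prop where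
  deriv : ∀ j < k, ∀ y ∈ cell p, HasDerivWithinAt (g j) (g (j + 1) y) (cell p) y
  per : ∀ j ≤ k, g j (-(p.ℓ / 2)) = g j (p.ℓ / 2)
  bound : ∀ j ≤ k, ∀ y ∈ cell p, |g j y| ≤ C
  hol : BHOn p.α C (g k) (cell p)

theorem IsCPer.nonneg {C : ℝ} {g : ℕ → ℝ → ℝ} (h : IsCPer p k C g) : 0 ≤ C :=
  (abs_nonneg _).trans (h.bound 0 (Nat.zero_le _) _ (left_mem_cell p))

theorem IsCPer.continuousOn {C : ℝ} {g : ℕ → ℝ → ℝ} (h : IsCPer p k C g) {j : ℕ} (hj : j ≤ k) :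
    ContinuousOn (g j) (cell p) := by
  rcases hj.lt_or_eq with hj | rfl
  · exact fun y hy => (h.deriv j hj y hy).continuousWithinAt
  · exact h.hol.continuousOn p.α_pos

open Classical in
/-- The element of `C_♯^{k+α}` with the given family of derivatives. -/
noncomputable def IsCPer.toCPer {C : ℝ} {g : ℕ → ℝ → ℝ} (h : IsCPer p k C g) : CPer p k :=
  let G : ℕ → (cell p →ᵇ ℝ) := fun j => if hj : j ≤ k then
    BoundedContinuousFunction.mkOfCompact
      ⟨(cell p).domRestrict (g j), continuousOn_iff_continuous_domRestrict.1 (h.continuousOn hj)⟩ else 0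
  have hG : ∀ j ≤ k, ∀ y (hy : y ∈ cell p), G j ⟨y, hy⟩ = g j y := by
    intro j hj y hy; simp only [G, hj, dite_true]; rfl
  have hG' : ∀ j ≤ k, ∀ y ∈ cell p, ev1 (G j) y = g j y := by
    intro j hj y hy; rw [ev1_of_mem _ hy, hG j hj]
  ⟨G, fun j hj => by simp [G, not_le.2 hj],
    fun j hj y hy => by
      rw [hG' _ hj y hy]
      exact (h.deriv j hj y hy).congr (hG' j hj.le) (hG' j hj.le y hy),
    fun j hj => by
      rw [hG' j hj _ (left_mem_cell p), hG' j hj _ (right_mem_cell p)]; exact h.per j hj,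
    by
      have : (G k : cell p → ℝ) = fun x : cell p => g k x := funext fun x => hG k le_rfl x x.2
      rw [this]; exact (h.hol.holderWith h.nonneg).memHolder⟩

theorem IsCPer.toCPer_d {C : ℝ} {g : ℕ → ℝ → ℝ} (h : IsCPer p k C g) {j : ℕ} (hj : j ≤ k) {y : ℝ}
    (hy : y ∈ cell p) : h.toCPer.d j y = g j y := by
  rw [CPer.d_of_mem _ _ hy]; simp only [IsCPer.toCPer, hj, dite_true]; rfl

/-- There are `k` sup-norms below the top order, while the top order counts twice, once for the
sup-norm and once for the seminorm. -/
theorem CPer.norm_le {C : ℝ} (ζ : CPer p k) (hC : 0 ≤ C)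
    (hb : ∀ j ≤ k, ∀ y ∈ cell p, |ζ.d j y| ≤ C) (hH : BHOn p.α C (ζ.d k) (cell p)) :
    ‖ζ‖ ≤ (k + 2) * C := by
  rw [CPer.norm_def]
  have h1 : ∑ j ∈ Finset.range k, ‖ζ.1 j‖ ≤ ∑ j ∈ Finset.range k, C := by
    refine Finset.sum_le_sum fun j hj => (BoundedContinuousFunction.norm_le hC).2 fun y => ?_
    have := hb j (Finset.mem_range.1 hj).le y y.2
    rwa [ζ.d_of_mem j y.2] at this
  have h2 := holNorm_le_of_BHOn hC hH (F := ζ.1 k) fun x => (ζ.d_of_mem k x.2).symm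
  simp only [Finset.sum_const, Finset.card_range, nsmul_eq_mul] at h1
  linarith

theorem IsCPer.norm_toCPer_le {C : ℝ} {g : ℕ → ℝ → ℝ} (h : IsCPer p k C g) :
    ‖h.toCPer‖ ≤ (k + 2) * C :=
  h.toCPer.norm_le h.nonneg (fun j hj y hy => by rw [h.toCPer_d hj hy]; exact h.bound j hj y hy)
    (h.hol.congr fun y hy => h.toCPer_d le_rfl hy)

/-- A continuous linear map into `C_♯^{k+α}`, given by the derivatives of its values. -/
noncomputable def CPer.mkL {V : Type*} [NormedAddCommGroup V] [NormedSpace ℝ V]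
    (G : V → ℕ → ℝ → ℝ) (K : ℝ) (hG : ∀ v, IsCPer p k (K * ‖v‖) (G v))
    (hadd : ∀ v w y, G (v + w) 0 y = G v 0 y + G w 0 y)
    (hsmul : ∀ (c : ℝ) v y, G (c • v) 0 y = c * G v 0 y) : V →L[ℝ] CPer p k :=
  LinearMap.mkContinuous
    { toFun := fun v => (hG v).toCPer
      map_add' := fun v w => CPer.ext_d fun y hy => by
        rw [CPer.d_add, (hG _).toCPer_d (Nat.zero_le _) hy, (hG _).toCPer_d (Nat.zero_le _) hy,
          (hG _).toCPer_d (Nat.zero_le _) hy, hadd]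
      map_smul' := fun c v => CPer.ext_d fun y hy => by
        rw [RingHom.id_apply, CPer.d_smul, (hG _).toCPer_d (Nat.zero_le _) hy,
          (hG _).toCPer_d (Nat.zero_le _) hy, hsmul] }
    ((k + 2) * K) fun v => by
      rw [mul_assoc]; exact (hG v).norm_toCPer_le

theorem CPer.mkL_d {V : Type*} [NormedAddCommGroup V] [NormedSpace ℝ V]
    {G : V → ℕ → ℝ → ℝ} {K : ℝ} (hG : ∀ v, IsCPer p k (K * ‖v‖) (G v))
    (hadd : ∀ v w y, G (v + w) 0 y = G v 0 y + G w 0 y)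
    (hsmul : ∀ (c : ℝ) v y, G (c • v) 0 y = c * G v 0 y) (v : V) {j : ℕ} (hj : j ≤ k) {y : ℝ}
    (hy : y ∈ cell p) : (CPer.mkL G K hG hadd hsmul v).d j y = G v j y :=
  (hG v).toCPer_d hj hy

theorem CPer.lipschitz_d (ζ : CPer p k) {j : ℕ} (hj : j < k) {x y : ℝ} (hx : x ∈ cell p)
    (hy : y ∈ cell p) : |ζ.d j x - ζ.d j y| ≤ ‖ζ‖ * dist x y := by
  have := (convex_Icc (-(p.ℓ / 2)) (p.ℓ / 2)).norm_image_sub_le_of_norm_hasDerivWithin_le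
    (fun z hz => ζ.hasDerivWithinAt hj hz) (fun z _ => ζ.abs_d_le (j + 1) z) hy hx
  simpa [Real.dist_eq] using this

theorem CPer.BHOn_d_of_le (ζ : CPer p k) {j : ℕ} (hj : j ≤ k) :
    BHOn p.α (2 * ‖ζ‖) (ζ.d j) (cell p) := by
  rcases hj.lt_or_eq with hj | rfl
  · exact BHOn.of_lipschitz p.α_le_one (fun x _ => ζ.abs_d_le j x)
      fun x hx y hy => ζ.lipschitz_d hj hx hy
  · exact ζ.BHOn_d.mono (by linarith [norm_nonneg ζ])

/-- The derivative of order `m`, as a map from `C_♯^{n+α}` to `C_♯^{k+α}`. -/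
noncomputable def CPer.der (p : Params) {n k : ℕ} (m : ℕ) (h : m + k ≤ n) :
    CPer p n →L[ℝ] CPer p k :=
  CPer.mkL (fun ζ j => ζ.d (m + j)) 2
    (fun ζ =>
      { deriv := fun j hj y hy => ζ.hasDerivWithinAt (by omega) hy
        per := fun j _ => ζ.d_match _
        bound := fun j _ y _ => (ζ.abs_d_le _ y).trans (by linarith [norm_nonneg ζ])
        hol := ζ.BHOn_d_of_le (by omega) })
    (fun _ _ _ => CPer.d_add _ _ _ _) (fun _ _ _ => CPer.d_smul _ _ _ _)

theorem CPer.der_d {n k m : ℕ} (h : m + k ≤ n) (ζ : CPer p n) {j : ℕ} (hj : j ≤ k) {y : ℝ}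
    (hy : y ∈ cell p) : (CPer.der p m h ζ).d j y = ζ.d (m + j) y :=
  CPer.mkL_d _ _ _ ζ hj hy

end CPer

/-! ### Periodic extension -/

section sharp

variable {p : Params} {f f' : ℝ → ℝ}

theorem sharp_eq_sub (p : Params) (f : ℝ → ℝ) (y : ℝ) :
    ∃ n : ℤ, y - p.ℓ * n ∈ Ico (-(p.ℓ / 2)) (p.ℓ / 2) ∧ sharp p f y = f (y - p.ℓ * n) := by
  refine ⟨⌊(y + p.ℓ / 2) / p.ℓ⌋, ?_, rfl⟩
  have h1 := Int.floor_le ((y + p.ℓ / 2) / p.ℓ)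
  have h2 := Int.lt_floor_add_one ((y + p.ℓ / 2) / p.ℓ)
  rw [le_div_iff₀ p.ℓ_pos] at h1
  rw [div_lt_iff₀ p.ℓ_pos] at h2
  constructor <;> linarith

theorem sharp_periodic (p : Params) (f : ℝ → ℝ) : Function.Periodic (sharp p f) p.ℓ := by
  intro y
  have : (y + p.ℓ + p.ℓ / 2) / p.ℓ = (y + p.ℓ / 2) / p.ℓ + 1 := by
    have := p.ℓ_pos.ne'; field_simp; ring
  unfold sharp
  rw [this, Int.floor_add_one]; push_cast
  congr 1; ring

theorem sharp_sub_int (p : Params) (f : ℝ → ℝ) (y : ℝ) (n : ℤ) :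
    sharp p f (y - p.ℓ * n) = sharp p f y := by
  rw [mul_comm]; exact (sharp_periodic p f).sub_int_mul_eq n

theorem sharp_of_mem (hf : f (-(p.ℓ / 2)) = f (p.ℓ / 2)) {y : ℝ} (hy : y ∈ cell p) :
    sharp p f y = f y := by
  rcases hy.2.lt_or_eq with h | rfl
  · have : ⌊(y + p.ℓ / 2) / p.ℓ⌋ = 0 := by
      rw [Int.floor_eq_zero_iff]
      have := p.ℓ_pos
      refine ⟨div_nonneg (by linarith [hy.1]) this.le, (div_lt_one this).2 (by linarith)⟩
    simp [sharp, this]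
  · have : ⌊(p.ℓ / 2 + p.ℓ / 2) / p.ℓ⌋ = 1 := by
      rw [add_halves, div_self p.ℓ_pos.ne']; simp
    simp only [sharp, this]
    rw [← hf]; congr 1; push_cast; ring

theorem sharp_add (p : Params) (f g : ℝ → ℝ) (y : ℝ) :
    sharp p (fun s => f s + g s) y = sharp p f y + sharp p g y := rfl

theorem sharp_const_mul (p : Params) (c : ℝ) (f : ℝ → ℝ) (y : ℝ) :
    sharp p (fun s => c * f s) y = c * sharp p f y := rfl

theorem abs_sharp_le {C : ℝ} (hb : ∀ y ∈ cell p, |f y| ≤ C) (y : ℝ) : |sharp p f y| ≤ C := by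
  obtain ⟨n, hn, e⟩ := sharp_eq_sub p f y
  rw [e]; exact hb _ (Ico_subset_Icc_self hn)

theorem sharp_congr (p : Params) {f g : ℝ → ℝ} (h : ∀ y ∈ cell p, f y = g y) (y : ℝ) :
    sharp p f y = sharp p g y := by
  have := sharp_eq_sub p (fun s => f s - g s) y
  obtain ⟨n, hn, e⟩ := this
  have e' : sharp p f y - sharp p g y = f (y - p.ℓ * n) - g (y - p.ℓ * n) := e
  rw [h _ (Ico_subset_Icc_self hn)] at e'
  linarith

/-- Inside the cell nothing changes; at an end point the two one-sided derivatives are glued, which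
is possible because both `f` and `f'` match. Periodicity gives the remaining points. -/
theorem hasDerivAt_sharp (hd : ∀ y ∈ cell p, HasDerivWithinAt f (f' y) (cell p) y)
    (hf : f (-(p.ℓ / 2)) = f (p.ℓ / 2)) (hf' : f' (-(p.ℓ / 2)) = f' (p.ℓ / 2)) (y : ℝ) :
    HasDerivAt (sharp p f) (sharp p f' y) y := by
  have hW : ∀ z ∈ cell p, HasDerivWithinAt (sharp p f) (sharp p f' z) (cell p) z := by
    intro z hz
    rw [sharp_of_mem hf' hz]
    exact (hd z hz).congr (fun w hw => sharp_of_mem hf hw) (sharp_of_mem hf hz)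
  have hℓ := p.ℓ_pos
  have key : ∀ z ∈ Ico (-(p.ℓ / 2)) (p.ℓ / 2), HasDerivAt (sharp p f) (sharp p f' z) z := by
    intro z hz
    rcases hz.1.lt_or_eq with h | rfl
    · exact (hW z (Ico_subset_Icc_self hz)).hasDerivAt (Icc_mem_nhds h hz.2)
    · have h1 : HasDerivWithinAt (sharp p f) (sharp p f' (-(p.ℓ / 2))) (Ici (-(p.ℓ / 2)))
          (-(p.ℓ / 2)) :=
        (hW _ (left_mem_cell p)).mono_of_mem_nhdsWithin (Icc_mem_nhdsGE hz.2)
      have h2 : HasDerivWithinAt (sharp p f) (sharp p f' (p.ℓ / 2)) (Iic (p.ℓ / 2)) (p.ℓ / 2) :=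
        (hW _ (right_mem_cell p)).mono_of_mem_nhdsWithin (Icc_mem_nhdsLE hz.2)
      -- The derivative from the left at the left end point is the one at the right end point, moved
      -- by one period.
      have h3 : HasDerivWithinAt (sharp p f) (sharp p f' (-(p.ℓ / 2))) (Iic (-(p.ℓ / 2)))
          (-(p.ℓ / 2)) := by
        have e : p.ℓ / 2 = -(p.ℓ / 2) + p.ℓ := by ring
        rw [e, sharp_periodic p f'] at h2
        have h4 := h2.scomp (-(p.ℓ / 2)) (h := fun s => s + p.ℓ) (s := Iic (-(p.ℓ / 2)))
          ((hasDerivAt_id _).add_const p.ℓ).hasDerivWithinAt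
          (fun s hs => add_le_add_left (mem_Iic.1 hs) p.ℓ)
        rw [one_smul] at h4
        refine h4.congr (fun s _ => ?_) ?_ <;> simp [(sharp_periodic p f) _]
      have := h3.union h1
      rwa [Iic_union_Ici, hasDerivWithinAt_univ] at this
  obtain ⟨n, hn, -⟩ := sharp_eq_sub p f y
  have h1 := key _ hn
  rw [sharp_sub_int] at h1
  have h2 := h1.comp_sub_const y (p.ℓ * n)
  refine h2.congr_of_eventuallyEq (Eventually.of_forall fun s => ?_)
  simp [sharp_sub_int]

/-- After a shift the smaller point `a` lies in the cell. If the other point `b` does too, the bound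
is the given one. If `b` lies in the next cell, the path is cut at the common end point, and the two
resulting terms give the factor `2`. Otherwise `b - a` exceeds the period, whereas representatives
of both points in the cell are at most one period apart. -/
theorem BHOn_sharp {C : ℝ} (h : BHOn p.α C f (cell p)) (hf : f (-(p.ℓ / 2)) = f (p.ℓ / 2)) :
    BHOn p.α (2 * C) (sharp p f) univ := by
  have hℓ := p.ℓ_pos
  have hC : 0 ≤ C := (abs_nonneg _).trans (h.1 _ (left_mem_cell p))
  have hα : 0 ≤ (p.α : ℝ) := p.α.2
  have key : ∀ y y' : ℝ, y ≤ y' → |sharp p f y - sharp p f y'| ≤ 2 * C * dist y y' ^ (p.α : ℝ) := by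
    intro y y' hyy
    obtain ⟨n, hn, -⟩ := sharp_eq_sub p f y
    rw [← sharp_sub_int p f y n, ← sharp_sub_int p f y' n,
      ← dist_sub_right y y' (p.ℓ * n)]
    have hle : y - p.ℓ * n ≤ y' - p.ℓ * n := by linarith
    generalize y - p.ℓ * n = a at hn hle
    generalize y' - p.ℓ * n = b at hle
    have ha := Ico_subset_Icc_self hn
    have hd : dist a b = b - a := by rw [dist_comm, Real.dist_eq, abs_of_nonneg (by linarith)]
    have hpos : 0 ≤ C * dist a b ^ (p.α : ℝ) := mul_nonneg hC (Real.rpow_nonneg dist_nonneg _)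
    rw [sharp_of_mem hf ha]
    rcases le_or_gt b (p.ℓ / 2) with h1 | h1
    · have hb : b ∈ cell p := ⟨by linarith [hn.1], h1⟩
      rw [sharp_of_mem hf hb]
      linarith [h.2 a ha b hb]
    · rcases le_or_gt b (3 * p.ℓ / 2) with h2 | h2
      · have hb : b - p.ℓ ∈ cell p := ⟨by linarith, by linarith⟩
        rw [← (sharp_periodic p f).sub_eq b, sharp_of_mem hf hb]
        have e1 := h.2 a ha _ (right_mem_cell p)
        have e2 := h.2 _ (left_mem_cell p) _ hb
        have m1 : dist a (p.ℓ / 2) ^ (p.α : ℝ) ≤ dist a b ^ (p.α : ℝ) := by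
          refine Real.rpow_le_rpow dist_nonneg ?_ hα
          rw [hd, dist_comm, Real.dist_eq, abs_of_nonneg (by linarith [ha.2])]; linarith
        have m2 : dist (-(p.ℓ / 2)) (b - p.ℓ) ^ (p.α : ℝ) ≤ dist a b ^ (p.α : ℝ) := by
          refine Real.rpow_le_rpow dist_nonneg ?_ hα
          rw [hd, dist_comm, Real.dist_eq, abs_of_nonneg (by linarith)]; linarith [hn.2]
        have m1' := mul_le_mul_of_nonneg_left m1 hC
        have m2' := mul_le_mul_of_nonneg_left m2 hC
        have := abs_sub_le (f a) (f (p.ℓ / 2)) (f (b - p.ℓ))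
        rw [hf] at e2
        linarith
      · obtain ⟨m, hm, e⟩ := sharp_eq_sub p f b
        rw [e]
        have hm' := Ico_subset_Icc_self hm
        have e1 := h.2 a ha _ hm'
        have m1 : dist a (b - p.ℓ * m) ^ (p.α : ℝ) ≤ dist a b ^ (p.α : ℝ) := by
          refine Real.rpow_le_rpow dist_nonneg ?_ hα
          rw [hd, Real.dist_eq, abs_le]
          constructor <;> linarith [ha.1, ha.2, hm.1, hm.2, hn.2]
        have m1' := mul_le_mul_of_nonneg_left m1 hC
        linarith
  refine ⟨fun y _ => (abs_sharp_le h.1 y).trans (by linarith), fun y _ y' _ => ?_⟩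
  rcases le_total y y' with hy | hy
  · exact key y y' hy
  · rw [abs_sub_comm, dist_comm]; exact key y' y hy

end sharp

/-- The `ℓ`-periodic extension of the derivative of order `j`. -/
noncomputable def CPer.ext {p : Params} {k : ℕ} (ζ : CPer p k) (j : ℕ) : ℝ → ℝ := sharp p (ζ.d j)

section ext

variable {p : Params} {k : ℕ}

theorem CPer.hasDerivAt_ext (ζ : CPer p k) {j : ℕ} (hj : j < k) (y : ℝ) :
    HasDerivAt (ζ.ext j) (ζ.ext (j + 1) y) y :=
  hasDerivAt_sharp (fun _ hy => ζ.hasDerivWithinAt hj hy) (ζ.d_match j) (ζ.d_match _) y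

theorem CPer.ext_of_mem (ζ : CPer p k) (j : ℕ) {y : ℝ} (hy : y ∈ cell p) : ζ.ext j y = ζ.d j y :=
  sharp_of_mem (ζ.d_match j) hy

theorem CPer.abs_ext_le (ζ : CPer p k) (j : ℕ) (y : ℝ) : |ζ.ext j y| ≤ ‖ζ‖ :=
  abs_sharp_le (fun y _ => ζ.abs_d_le j y) y

theorem CPer.BHOn_ext (ζ : CPer p k) {j : ℕ} (hj : j ≤ k) : BHOn p.α (4 * ‖ζ‖) (ζ.ext j) univ :=
  (BHOn_sharp (ζ.BHOn_d_of_le hj) (ζ.d_match j)).mono (by linarith)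

theorem CPer.ext_add (ζ ξ : CPer p k) (j : ℕ) (y : ℝ) :
    (ζ + ξ).ext j y = ζ.ext j y + ξ.ext j y := by
  unfold CPer.ext; rw [← sharp_add]; congr 1; funext s; exact CPer.d_add _ _ _ _

theorem CPer.ext_smul (c : ℝ) (ζ : CPer p k) (j : ℕ) (y : ℝ) :
    (c • ζ).ext j y = c * ζ.ext j y := by
  unfold CPer.ext; rw [← sharp_const_mul]; congr 1; funext s; exact CPer.d_smul _ _ _ _

theorem CPer.continuous_ext (ζ : CPer p k) {j : ℕ} (hj : j ≤ k) : Continuous (ζ.ext j) :=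
  continuousOn_univ.1 ((ζ.BHOn_ext hj).continuousOn p.α_pos)

end ext

/-! ### Completeness -/

theorem CPer.sub_d {p : Params} {k : ℕ} (ζ ξ : CPer p k) (j : ℕ) (y : ℝ) :
    (ζ - ξ).d j y = ζ.d j y - ξ.d j y := by
  have := CPer.d_add (ζ - ξ) ξ j y
  rw [sub_add_cancel] at this; linarith

/-- Completeness serves twice: traces extend to the completion of `X_{2+α}`, and the unknown of the
nonlinear equation ranges over a Banach space. -/
instance (p : Params) (k : ℕ) : CompleteSpace (CPer p k) := by
  refine Metric.complete_of_cauchySeq_tendsto fun u hu => ?_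
  have hval : ∀ j, CauchySeq fun n => (u n).1 j := by
    intro j
    refine Metric.cauchySeq_iff.2 fun ε hε => ?_
    obtain ⟨N, hN⟩ := Metric.cauchySeq_iff.1 hu ε hε
    refine ⟨N, fun m hm n hn => lt_of_le_of_lt ?_ (hN m hm n hn)⟩
    rw [dist_eq_norm, dist_eq_norm]
    exact (u m - u n).norm_apply_le j
  choose G hG using fun j => cauchySeq_tendsto_of_complete (hval j)
  have hGd : ∀ j, ∀ y ∈ cell p, Tendsto (fun n => (u n).d j y) atTop (𝓝 (ev1 (G j) y)) := by
    intro j y hy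
    rw [ev1_of_mem _ hy]
    simp only [CPer.d_of_mem _ _ hy]
    exact ((BoundedContinuousFunction.tendsto_iff_tendstoUniformly.1 (hG j)).tendsto_at _)
  have hmatch : ∀ j, ev1 (G j) (-(p.ℓ / 2)) = ev1 (G j) (p.ℓ / 2) := fun j =>
    tendsto_nhds_unique (hGd j _ (left_mem_cell p)) (by
      simp only [CPer.d_match]; exact hGd j _ (right_mem_cell p))
  -- Passing to the periodic extensions replaces derivatives within a closed interval by derivatives
  -- on the line, where uniform limits of derivatives can be taken directly.
  have hunif : ∀ j, TendstoUniformly (fun n => (u n).ext j) (sharp p (ev1 (G j))) atTop := by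
    intro j
    rw [Metric.tendstoUniformly_iff]
    intro ε hε
    filter_upwards [Metric.tendstoUniformly_iff.1
      (BoundedContinuousFunction.tendsto_iff_tendstoUniformly.1 (hG j)) ε hε] with n hn y
    obtain ⟨m, hm, -⟩ := sharp_eq_sub p (ev1 (G j)) y
    have hm' : y - p.ℓ * m ∈ cell p := Ico_subset_Icc_self hm
    have := hn ⟨_, hm'⟩
    rw [← sharp_sub_int p _ y m, CPer.ext, ← sharp_sub_int p ((u n).d j) y m,
      sharp_of_mem (hmatch j) hm', sharp_of_mem ((u n).d_match j) hm', CPer.d,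
      ev1_of_mem _ hm', ev1_of_mem _ hm']
    exact this
  obtain ⟨M, hM⟩ := hu.isBounded_range.exists_norm_le
  have hM' : ∀ n, ‖u n‖ ≤ M := fun n => hM _ ⟨n, rfl⟩
  have hcp : IsCPer p k M fun j => ev1 (G j) :=
    { deriv := fun j hj y hy => by
        have h1 := hasDerivAt_of_tendstoUniformly (hunif (j + 1))
          (Eventually.of_forall fun n y => (u n).hasDerivAt_ext hj y)
          (fun y => (hunif j).tendsto_at y) y
        rw [sharp_of_mem (hmatch _) hy] at h1
        exact h1.hasDerivWithinAt.congr (fun z hz => (sharp_of_mem (hmatch j) hz).symm)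
          (sharp_of_mem (hmatch j) hy).symm
      per := fun j _ => hmatch j
      bound := fun j _ y hy => le_of_tendsto (hGd j y hy).abs
        (Eventually.of_forall fun n => ((u n).abs_d_le j y).trans (hM' n))
      hol := BHOn.tendsto
        (Eventually.of_forall fun n => (u n).BHOn_d.mono (hM' n)) (hGd k) }
  refine ⟨hcp.toCPer, Metric.tendsto_atTop.2 fun ε hε => ?_⟩
  -- The norm estimate below costs a factor `k + 2`; the tolerance `ε / (k + 3)` turns it into a
  -- strict inequality.
  have hk : (0 : ℝ) < k + 3 := by positivity
  obtain ⟨N, hN⟩ := Metric.cauchySeq_iff.1 hu (ε / (k + 3)) (by positivity)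
  refine ⟨N, fun n hn => ?_⟩
  have hle : ∀ m ≥ N, ‖u n - u m‖ ≤ ε / (k + 3) := fun m hm => by
    rw [← dist_eq_norm]; exact (hN n hn m hm).le
  have hlim : ∀ j ≤ k, ∀ y ∈ cell p,
      Tendsto (fun m => (u n - u m).d j y) atTop (𝓝 ((u n - hcp.toCPer).d j y)) := by
    intro j hj y hy
    simp only [CPer.sub_d, hcp.toCPer_d hj hy]
    exact (hGd j y hy).const_sub _
  rw [dist_eq_norm]
  have := (u n - hcp.toCPer).norm_le (C := ε / (k + 3)) (by positivity)
    (fun j hj y hy => le_of_tendsto (hlim j hj y hy).abs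
      (eventually_atTop.2 ⟨N, fun m hm => ((u n - u m).abs_d_le j y).trans (hle m hm)⟩))
    (BHOn.tendsto
      (eventually_atTop.2 ⟨N, fun m hm => (u n - u m).BHOn_d.mono (hle m hm)⟩) (hlim k le_rfl))
  calc _ ≤ _ := this
    _ < (k + 3) * (ε / (k + 3)) := by
        refine mul_lt_mul_of_pos_right (by linarith) (by positivity)
    _ = ε := by field_simp

end ThickFlame

namespace ThickFlame

/-! ### Products in `C_♯^{k+α}`, `k ≤ 1` -/

section product

variable {p : Params} {k : ℕ}

/-- The derivatives of order at most `1` of a product. -/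
noncomputable def CPer.mulFam (f g : CPer p k) : ℕ → ℝ → ℝ
  | 0 => fun y => f.d 0 y * g.d 0 y
  | 1 => fun y => f.d 1 y * g.d 0 y + f.d 0 y * g.d 1 y
  | _ => 0

/-- By `BHOn.mul`, a product of derivatives has Hölder constant `2 · 2‖f‖ · 2‖g‖`, and the Leibniz
rule at order one has two such terms, which gives `16`. Orders `0` and `1` are all that the
nonlinear boundary conditions require. -/
theorem CPer.isCPer_mulFam (hk : k ≤ 1) (f g : CPer p k) :
    IsCPer p k (16 * ‖f‖ * ‖g‖) (CPer.mulFam f g) := by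
  have hfg : 0 ≤ ‖f‖ * ‖g‖ := by positivity
  have hb : ∀ i j y, |f.d i y * g.d j y| ≤ ‖f‖ * ‖g‖ := fun i j y => by
    rw [abs_mul]
    exact mul_le_mul (f.abs_d_le i y) (g.abs_d_le j y) (abs_nonneg _) (norm_nonneg _)
  have hH : ∀ i ≤ k, ∀ j ≤ k, BHOn p.α (8 * (‖f‖ * ‖g‖)) (fun y => f.d i y * g.d j y) (cell p) :=
    fun i hi j hj => ((f.BHOn_d_of_le hi).mul (g.BHOn_d_of_le hj)).mono (by linarith)
  refine ⟨fun j hj y hy => ?_, fun j hj => ?_, fun j hj y hy => ?_, ?_⟩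
  · obtain rfl : j = 0 := by omega
    exact (f.hasDerivWithinAt hj hy).mul (g.hasDerivWithinAt hj hy)
  · match j with
    | 0 => simp only [CPer.mulFam, CPer.d_match]
    | 1 => simp only [CPer.mulFam, CPer.d_match]
    | (n + 2) => rfl
  · match j with
    | 0 => exact (hb 0 0 y).trans (by linarith)
    | 1 => exact (abs_add_le _ _).trans (by linarith [hb 1 0 y, hb 0 1 y])
    | (n + 2) => simpa [CPer.mulFam, mul_assoc] using hfg
  · match k, hk with
    | 0, _ => exact (hH 0 le_rfl 0 le_rfl).mono (by linarith)
    | 1, _ =>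
      have := (hH 1 le_rfl 0 zero_le_one).add (hH 0 zero_le_one 1 le_rfl)
      exact this.mono (by linarith)

/-- Multiplication of functions of class `C_♯^{k+α}`, `k ≤ 1`. -/
noncomputable def CPer.mulL (p : Params) {k : ℕ} (hk : k ≤ 1) :
    CPer p k →L[ℝ] CPer p k →L[ℝ] CPer p k :=
  have hd : ∀ f g : CPer p k, ∀ y ∈ cell p,
      (CPer.isCPer_mulFam hk f g).toCPer.d 0 y = f.d 0 y * g.d 0 y :=
    fun f g y hy => (CPer.isCPer_mulFam hk f g).toCPer_d (Nat.zero_le _) hy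
  LinearMap.mkContinuous₂
    (LinearMap.mk₂ ℝ (fun f g => (CPer.isCPer_mulFam hk f g).toCPer)
      (fun f f' g => CPer.ext_d fun y hy => by
        simp only [CPer.d_add, hd _ _ y hy]; ring)
      (fun c f g => CPer.ext_d fun y hy => by
        simp only [CPer.d_smul, hd _ _ y hy]; ring)
      (fun f g g' => CPer.ext_d fun y hy => by
        simp only [CPer.d_add, hd _ _ y hy]; ring)
      (fun c f g => CPer.ext_d fun y hy => by
        simp only [CPer.d_smul, hd _ _ y hy]; ring))
    ((k + 2) * 16) fun f g => by
      have := (CPer.isCPer_mulFam hk f g).norm_toCPer_le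
      refine this.trans (le_of_eq (by ring))

theorem CPer.mulL_d (hk : k ≤ 1) (f g : CPer p k) {y : ℝ} (hy : y ∈ cell p) :
    (CPer.mulL p hk f g).d 0 y = f.d 0 y * g.d 0 y :=
  (CPer.isCPer_mulFam hk f g).toCPer_d (Nat.zero_le _) hy

theorem CPer.zero_d (j : ℕ) (y : ℝ) : (0 : CPer p k).d j y = 0 := ev1_zero y

end product

/-! ### The spaces `X_{2+α}` -/

section X

variable {p : Params} {k : ℕ}

theorem ev_of_mem {K : Set (ℝ × ℝ)} (f : K →ᵇ ℝ) {x y : ℝ} (h : (x, y) ∈ K) :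
    ev f x y = f ⟨(x, y), h⟩ := by
  simp [ev, h]

theorem norm_le_pairSup (f : (i : Piece) → (Piece.dom p i →ᵇ ℝ)) (i : Piece) :
    ‖f i‖ ≤ pairSup f := by
  unfold pairSup
  have h1 : 0 ≤ max (max ‖f .m1‖ ‖f .c1‖) ‖f .p1‖ := by positivity
  have h2 : 0 ≤ max ‖f .c2‖ ‖f .p2‖ := by positivity
  cases i
  · exact le_add_of_le_of_nonneg ((le_max_left _ _).trans (le_max_left _ _)) h2
  · exact le_add_of_le_of_nonneg ((le_max_right _ _).trans (le_max_left _ _)) h2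
  · exact le_add_of_le_of_nonneg (le_max_right _ _) h2
  · exact le_add_of_nonneg_of_le h1 (le_max_left _ _)
  · exact le_add_of_nonneg_of_le h1 (le_max_right _ _)

theorem holNorm_le_pairHol (f : (i : Piece) → (Piece.dom p i →ᵇ ℝ)) (i : Piece) :
    holNorm p.α (f i) ≤ pairHol f := by
  unfold pairHol
  have := fun i => holNorm_nonneg (α := p.α) (f i)
  have h1 := this .m1
  have h2 := this .c1
  have h3 := this .p1
  have h4 := this .c2
  have h5 := this .p2
  cases i <;> linarith

theorem X.norm_def (u : X p k) :
    ‖u‖ = (∑ m ∈ Finset.range k, ∑ γ ∈ Finset.HasAntidiagonal.antidiagonal m,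
        pairSup fun i => u.1 i γ)
      + ∑ γ ∈ Finset.HasAntidiagonal.antidiagonal k, pairHol fun i => u.1 i γ := rfl

theorem X.sum_nonneg (u : X p k) : 0 ≤ ∑ m ∈ Finset.range k,
    ∑ γ ∈ Finset.HasAntidiagonal.antidiagonal m, pairSup fun i => u.1 i γ :=
  Finset.sum_nonneg fun _ _ => Finset.sum_nonneg fun _ _ => pairSup_nonneg _

theorem X.holNorm_le (u : X p k) (i : Piece) {a b : ℕ} (h : a + b = k) :
    holNorm p.α (u.1 i (a, b)) ≤ ‖u‖ := by
  have h1 := Finset.single_le_sum (f := fun γ => pairHol fun i => u.1 i γ)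
    (fun γ _ => pairHol_nonneg _)
    (Finset.HasAntidiagonal.mem_antidiagonal.2 (show (a, b).1 + (a, b).2 = k from h))
  have h2 := holNorm_le_pairHol (fun i => u.1 i (a, b)) i
  rw [X.norm_def]
  have h3 := u.sum_nonneg
  linarith

theorem X.norm_apply_le (u : X p k) (i : Piece) (a b : ℕ) : ‖u.1 i (a, b)‖ ≤ ‖u‖ := by
  rcases lt_trichotomy (a + b) k with h | h | h
  · have h1 := Finset.single_le_sum (f := fun γ => pairSup fun i => u.1 i γ)
      (fun γ _ => pairSup_nonneg _)
      (Finset.HasAntidiagonal.mem_antidiagonal.2 (rfl : (a, b).1 + (a, b).2 = a + b))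
    have h2 := Finset.single_le_sum (f := fun m => ∑ γ ∈ Finset.HasAntidiagonal.antidiagonal m,
        pairSup fun i => u.1 i γ)
      (fun m _ => Finset.sum_nonneg fun _ _ => pairSup_nonneg _) (Finset.mem_range.2 h)
    have h3 := norm_le_pairSup (fun i => u.1 i (a, b)) i
    have h4 : 0 ≤ ∑ γ ∈ Finset.HasAntidiagonal.antidiagonal k, pairHol fun i => u.1 i γ :=
      Finset.sum_nonneg fun _ _ => pairHol_nonneg _
    rw [X.norm_def]
    simp only at h1 h2 h3
    linarith
  · exact (norm_le_holNorm _).trans (u.holNorm_le i h)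
  · have := u.2.1 i a b h
    rw [this]; simp

theorem X.abs_D_le (u : X p k) (i : Piece) (a b : ℕ) (x y : ℝ) : |u.D a b i x y| ≤ ‖u‖ := by
  by_cases h : (x, y) ∈ Piece.dom p i
  · rw [X.D, ev_of_mem _ h]
    exact ((u.1 i (a, b)).norm_coe_le_norm _).trans (u.norm_apply_le i a b)
  · simp [X.D, ev, h]

theorem X.BHOn_D (u : X p k) (i : Piece) {a b : ℕ} (h : a + b = k) :
    BHOn p.α ‖u‖ (fun z => u.D a b i z.1 z.2) (Piece.dom p i) :=
  (BHOn_of_memHolder (u.2.2.2.2.2.2.2 i a b h) fun z => (ev_of_mem _ z.2).symm).mono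
    (u.holNorm_le i h)

/-- The trace of `D_x^a u` on the line `{x} × [-ℓ/2, ℓ/2]`. -/
noncomputable def X.tr {p : Params} {k : ℕ} (i : Piece) {x : ℝ} (hx : x ∈ i.reg.ivl p) {a m : ℕ}
    (h : a + m = k) : X p k →L[ℝ] CPer p m :=
  CPer.mkL (fun u j => u.D a j i x) 1
    (fun u =>
      { deriv := fun j hj y hy => u.2.2.2.1 i a j (by omega) x hx y hy
        per := fun j hj => u.2.2.2.2.1 i a j (by omega) x hx
        bound := fun j _ y _ => by rw [one_mul]; exact u.abs_D_le i a j x y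
        hol := by
          rw [one_mul]
          refine ⟨fun y _ => u.abs_D_le i a m x y, fun y hy z hz => ?_⟩
          have := (u.BHOn_D i h).2 (x, y) ⟨hx, hy⟩ (x, z) ⟨hx, hz⟩
          simpa [Prod.dist_eq] using this })
    (fun _ _ _ => X.D_add _ _ _ _ _ _ _) (fun _ _ _ => X.D_smul _ _ _ _ _ _ _)

theorem X.tr_d (i : Piece) {x : ℝ} (hx : x ∈ i.reg.ivl p) {a m : ℕ} (h : a + m = k) (u : X p k)
    {j : ℕ} (hj : j ≤ m) {y : ℝ} (hy : y ∈ cell p) :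
    (X.tr i hx h u).d j y = u.D a j i x y :=
  CPer.mkL_d _ _ _ u hj hy

/-- A family of functions which has the properties of the derivatives of a pair of class
`X_{2+α}`. -/
structure IsX (p : Params) (C : ℝ) (g : Piece → ℕ → ℕ → ℝ → ℝ → ℝ) : Prop where
  dx : ∀ i a b, a + b < 2 → ∀ x ∈ i.reg.ivl p, ∀ y ∈ cell p,
    HasDerivWithinAt (fun s => g i a b s y) (g i (a + 1) b x y) (i.reg.ivl p) x
  dy : ∀ i a b, a + b < 2 → ∀ x ∈ i.reg.ivl p, ∀ y ∈ cell p,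
    HasDerivWithinAt (fun s => g i a b x s) (g i a (b + 1) x y) (cell p) y
  per : ∀ i a b, a + b ≤ 2 → ∀ x ∈ i.reg.ivl p, g i a b x (-(p.ℓ / 2)) = g i a b x (p.ℓ / 2)
  lim_bot : ∀ i a b, a + b ≤ 2 → i.reg = Reg.minus → ∀ y ∈ cell p,
    Tendsto (fun x => g i a b x y) atBot (𝓝 0)
  lim_top : ∀ i a b, a + b ≤ 2 → i.reg = Reg.plus → ∀ y ∈ cell p,
    Tendsto (fun x => g i a b x y) atTop (𝓝 0)
  hol : ∀ i a b, a + b ≤ 2 → BHOn p.α C (fun z => g i a b z.1 z.2) (Piece.dom p i)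

theorem IsX.nonneg {C : ℝ} {g : Piece → ℕ → ℕ → ℝ → ℝ → ℝ} (h : IsX p C g) : 0 ≤ C :=
  (abs_nonneg _).trans ((h.hol .m1 0 0 (by norm_num)).1 (0, -(p.ℓ / 2))
    ⟨le_rfl (a := (0 : ℝ)), left_mem_cell p⟩)

open Classical in
/-- The element of `X_{2+α}` with the given family of derivatives. -/
noncomputable def IsX.toX {C : ℝ} {g : Piece → ℕ → ℕ → ℝ → ℝ → ℝ} (h : IsX p C g) : X p 2 :=
  let G : (i : Piece) → ℕ × ℕ → (Piece.dom p i →ᵇ ℝ) := fun i γ =>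
    if hγ : γ.1 + γ.2 ≤ 2 then
      BoundedContinuousFunction.ofNormedAddCommGroup
        (fun z : Piece.dom p i => g i γ.1 γ.2 z.1.1 z.1.2)
        (continuousOn_iff_continuous_domRestrict.1 ((h.hol i _ _ hγ).continuousOn p.α_pos)) C
        (fun z => (h.hol i _ _ hγ).1 z z.2)
    else 0
  have hG' : ∀ i a b, a + b ≤ 2 → ∀ x ∈ i.reg.ivl p, ∀ y ∈ cell p,
      ev (G i (a, b)) x y = g i a b x y := by
    intro i a b hab x hx y hy
    rw [ev_of_mem _ (show (x, y) ∈ Piece.dom p i from ⟨hx, hy⟩)]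
    simp only [G, hab, dite_true]; rfl
  ⟨G, fun i a b hab => by simp [G, not_le.2 hab],
    fun i a b hab x hx y hy => by
      rw [hG' _ _ _ (by omega) x hx y hy]
      exact (h.dx i a b hab x hx y hy).congr (fun s hs => hG' _ _ _ hab.le s hs y hy)
        (hG' _ _ _ hab.le x hx y hy),
    fun i a b hab x hx y hy => by
      rw [hG' _ _ _ (by omega) x hx y hy]
      exact (h.dy i a b hab x hx y hy).congr (fun s hs => hG' _ _ _ hab.le x hx s hs)
        (hG' _ _ _ hab.le x hx y hy),
    fun i a b hab x hx => by
      rw [hG' _ _ _ hab x hx _ (left_mem_cell p), hG' _ _ _ hab x hx _ (right_mem_cell p)]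
      exact h.per i a b hab x hx,
    fun i a b hab hi y hy => by
      refine (h.lim_bot i a b hab hi y hy).congr' ?_
      filter_upwards [eventually_le_atBot 0] with x hx
      exact (hG' i a b hab x (by rw [hi]; exact hx) y hy).symm,
    fun i a b hab hi y hy => by
      refine (h.lim_top i a b hab hi y hy).congr' ?_
      filter_upwards [eventually_ge_atTop p.R] with x hx
      exact (hG' i a b hab x (by rw [hi]; exact hx) y hy).symm,
    fun i a b hab => by
      have : (G i (a, b) : Piece.dom p i → ℝ) = fun z : Piece.dom p i => g i a b z.1.1 z.1.2 := by
        simp only [G, hab.le, dite_true]; rfl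
      rw [this]
      exact ((h.hol i a b hab.le).holderWith h.nonneg).memHolder⟩

theorem IsX.toX_D {C : ℝ} {g : Piece → ℕ → ℕ → ℝ → ℝ → ℝ} (h : IsX p C g) {i : Piece} {a b : ℕ}
    (hab : a + b ≤ 2) {x y : ℝ} (hx : x ∈ i.reg.ivl p) (hy : y ∈ cell p) :
    h.toX.D a b i x y = g i a b x y := by
  rw [X.D, ev_of_mem _ (show (x, y) ∈ Piece.dom p i from ⟨hx, hy⟩)]
  simp only [IsX.toX, hab, dite_true]; rfl

theorem X.ext_D {u v : X p k} (h : ∀ i a b, a + b ≤ k → ∀ x ∈ i.reg.ivl p, ∀ y ∈ cell p,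
    u.D a b i x y = v.D a b i x y) : u = v := by
  refine Subtype.ext (funext fun i => funext fun ⟨a, b⟩ => ?_)
  rcases le_or_gt (a + b) k with hab | hab
  · ext ⟨⟨x, y⟩, hz⟩
    have := h i a b hab x hz.1 y hz.2
    rwa [X.D, X.D, ev_of_mem _ hz, ev_of_mem _ hz] at this
  · rw [u.2.1 i a b hab, v.2.1 i a b hab]

/-- The orders `0` and `1` are estimated by `4 C` each, and the three derivatives of order two by
`10 C` each (five pieces, `2 C` per Hölder norm). The sum `38 C` is rounded up. -/
theorem X.norm_le {C : ℝ} (u : X p 2) (hC : 0 ≤ C)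
    (hH : ∀ i a b, a + b ≤ 2 → BHOn p.α C (fun z => u.D a b i z.1 z.2) (Piece.dom p i)) :
    ‖u‖ ≤ 40 * C := by
  have h1 : ∀ i a b, a + b ≤ 2 → ‖u.1 i (a, b)‖ ≤ C := fun i a b hab =>
    (BoundedContinuousFunction.norm_le hC).2 fun z => by
      have := (hH i a b hab).1 z z.2
      exact (ev_of_mem (u.1 i (a, b)) z.2) ▸ this
  have h2 : ∀ i a b, a + b ≤ 2 → holNorm p.α (u.1 i (a, b)) ≤ 2 * C := fun i a b hab =>
    holNorm_le_of_BHOn hC (hH i a b hab) fun z => (ev_of_mem _ z.2).symm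
  have h3 : ∀ a b, a + b ≤ 2 → (pairSup fun i => u.1 i (a, b)) ≤ 2 * C := fun a b hab => by
    unfold pairSup
    have e1 : max (max ‖u.1 .m1 (a, b)‖ ‖u.1 .c1 (a, b)‖) ‖u.1 .p1 (a, b)‖ ≤ C :=
      max_le (max_le (h1 _ _ _ hab) (h1 _ _ _ hab)) (h1 _ _ _ hab)
    have e2 : max ‖u.1 .c2 (a, b)‖ ‖u.1 .p2 (a, b)‖ ≤ C := max_le (h1 _ _ _ hab) (h1 _ _ _ hab)
    linarith
  have h4 : ∀ a b, a + b ≤ 2 → (pairHol fun i => u.1 i (a, b)) ≤ 10 * C := fun a b hab => by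
    unfold pairHol
    linarith [h2 .m1 a b hab, h2 .c1 a b hab, h2 .p1 a b hab, h2 .c2 a b hab, h2 .p2 a b hab]
  have h5 : ∀ m ∈ Finset.range 2, (∑ γ ∈ Finset.HasAntidiagonal.antidiagonal m,
      pairSup fun i => u.1 i γ) ≤ (2 : ℕ) • (2 * C) := fun m hm => by
    have hm' := Finset.mem_range.1 hm
    refine (Finset.sum_le_card_nsmul _ _ (2 * C) fun γ hγ => ?_).trans ?_
    · have := Finset.HasAntidiagonal.mem_antidiagonal.1 hγ
      exact h3 γ.1 γ.2 (by omega)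
    · rw [Finset.Nat.card_antidiagonal]
      exact nsmul_le_nsmul_left (by linarith) (by omega)
  have h6 := Finset.sum_le_card_nsmul _ _ _ h5
  have h7 := Finset.sum_le_card_nsmul (Finset.HasAntidiagonal.antidiagonal 2)
    (fun γ => pairHol fun i => u.1 i γ) (10 * C) fun γ hγ =>
      h4 γ.1 γ.2 (Finset.HasAntidiagonal.mem_antidiagonal.1 hγ).le
  rw [Finset.Nat.card_antidiagonal] at h7
  rw [X.norm_def]
  simp only [nsmul_eq_mul, Finset.card_range] at h6 h7
  norm_num at h6 h7
  linarith

/-- A continuous linear map into `X_{2+α}`, given by the derivatives of its values. -/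
noncomputable def X.mkL {V : Type*} [NormedAddCommGroup V] [NormedSpace ℝ V]
    (G : V → Piece → ℕ → ℕ → ℝ → ℝ → ℝ) (K : ℝ) (hG : ∀ v, IsX p (K * ‖v‖) (G v))
    (hadd : ∀ v w i a b x y, G (v + w) i a b x y = G v i a b x y + G w i a b x y)
    (hsmul : ∀ (c : ℝ) v i a b x y, G (c • v) i a b x y = c * G v i a b x y) : V →L[ℝ] X p 2 :=
  LinearMap.mkContinuous
    { toFun := fun v => (hG v).toX
      map_add' := fun v w => X.ext_D fun i a b hab x hx y hy => by
        rw [X.D_add, (hG _).toX_D hab hx hy, (hG _).toX_D hab hx hy, (hG _).toX_D hab hx hy, hadd]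
      map_smul' := fun c v => X.ext_D fun i a b hab x hx y hy => by
        rw [RingHom.id_apply, X.D_smul, (hG _).toX_D hab hx hy, (hG _).toX_D hab hx hy, hsmul] }
    (40 * K) fun v => by
      rw [mul_assoc]
      exact X.norm_le _ (hG v).nonneg fun i a b hab => ((hG v).hol i a b hab).congr
        fun z hz => (hG v).toX_D hab hz.1 hz.2

theorem X.mkL_D {V : Type*} [NormedAddCommGroup V] [NormedSpace ℝ V]
    {G : V → Piece → ℕ → ℕ → ℝ → ℝ → ℝ} {K : ℝ} (hG : ∀ v, IsX p (K * ‖v‖) (G v))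
    (hadd : ∀ v w i a b x y, G (v + w) i a b x y = G v i a b x y + G w i a b x y)
    (hsmul : ∀ (c : ℝ) v i a b x y, G (c • v) i a b x y = c * G v i a b x y) (v : V)
    {i : Piece} {a b : ℕ} (hab : a + b ≤ 2) {x y : ℝ} (hx : x ∈ i.reg.ivl p) (hy : y ∈ cell p) :
    (X.mkL G K hG hadd hsmul v).D a b i x y = G v i a b x y :=
  (hG v).toX_D hab hx hy

end X

/-! ### The operator `𝓑_*` -/

section Bs

variable {p : Params}

theorem zero_mem_ivl_m1 (p : Params) : (0 : ℝ) ∈ Piece.m1.reg.ivl p := le_rfl (a := (0 : ℝ))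
theorem zero_mem_ivl_c1 (p : Params) : (0 : ℝ) ∈ Piece.c1.reg.ivl p := ⟨le_rfl, p.R_pos.le⟩
theorem R_mem_ivl_c1 (p : Params) : p.R ∈ Piece.c1.reg.ivl p := ⟨p.R_pos.le, le_rfl⟩
theorem R_mem_ivl_p1 (p : Params) : p.R ∈ Piece.p1.reg.ivl p := le_rfl (a := p.R)
theorem zero_mem_ivl_c2 (p : Params) : (0 : ℝ) ∈ Piece.c2.reg.ivl p := zero_mem_ivl_c1 p
theorem R_mem_ivl_c2 (p : Params) : p.R ∈ Piece.c2.reg.ivl p := R_mem_ivl_c1 p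
theorem R_mem_ivl_p2 (p : Params) : p.R ∈ Piece.p2.reg.ivl p := R_mem_ivl_p1 p

/-- The trace of `D_x^a D_y^b u` in `C_♯^{m+α}`, where `a + b + m ≤ 2`. -/
noncomputable def X.tD (i : Piece) {x : ℝ} (hx : x ∈ i.reg.ivl p) (a b m : ℕ) (h : a + b + m ≤ 2) :
    X p 2 →L[ℝ] CPer p m :=
  (CPer.der p b (show b + m ≤ 2 - a by omega)).comp (X.tr i hx (show a + (2 - a) = 2 by omega))

theorem X.tD_d (i : Piece) {x : ℝ} (hx : x ∈ i.reg.ivl p) {a b m : ℕ} (h : a + b + m ≤ 2)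
    (u : X p 2) {y : ℝ} (hy : y ∈ cell p) :
    (X.tD i hx a b m h u).d 0 y = u.D a b i x y := by
  rw [X.tD, ContinuousLinearMap.comp_apply, CPer.der_d _ _ (Nat.zero_le _) hy, add_zero,
    X.tr_d _ _ _ _ (by omega) hy]

/-- The first component of `𝓛 u` on the line `{x} × [-ℓ/2, ℓ/2]`. -/
noncomputable def X.tL (i : Piece) {x : ℝ} (hx : x ∈ i.reg.ivl p) : X p 2 →L[ℝ] CPer p 0 :=
  X.tD i hx 2 0 0 (by norm_num) + X.tD i hx 0 2 0 (by norm_num) + X.tD i hx 1 0 0 (by norm_num)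

/-- The entries of class `C_♯^{2+α}` of `𝓑_*`. -/
noncomputable def bs2 (p : Params) : X p 2 →L[ℝ] (Fin 3 → CPer p 2) :=
  ContinuousLinearMap.pi ![
    X.tD .c1 (zero_mem_ivl_c1 p) 0 0 2 (by norm_num)
      - X.tD .m1 (zero_mem_ivl_m1 p) 0 0 2 (by norm_num),
    X.tD .p1 (R_mem_ivl_p1 p) 0 0 2 (by norm_num) - X.tD .c1 (R_mem_ivl_c1 p) 0 0 2 (by norm_num),
    X.tD .p2 (R_mem_ivl_p2 p) 0 0 2 (by norm_num) - X.tD .c2 (R_mem_ivl_c2 p) 0 0 2 (by norm_num)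
      - (p.Le / (p.θ * p.R) / 2) • (X.tD .p1 (R_mem_ivl_p1 p) 0 0 2 (by norm_num)
        + X.tD .c1 (R_mem_ivl_c1 p) 0 0 2 (by norm_num))]

/-- The entries of class `C_♯^{1+α}` of `𝓑_*`. -/
noncomputable def bs1 (p : Params) : X p 2 →L[ℝ] (Fin 5 → CPer p 1) :=
  ContinuousLinearMap.pi ![
    p.Le • (X.tD .c1 (zero_mem_ivl_c1 p) 1 0 1 (by norm_num)
      - X.tD .m1 (zero_mem_ivl_m1 p) 1 0 1 (by norm_num))
      + X.tD .c2 (zero_mem_ivl_c2 p) 0 0 1 (by norm_num),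
    p.Le • X.tD .c2 (zero_mem_ivl_c2 p) 0 0 1 (by norm_num)
      + X.tD .c2 (zero_mem_ivl_c2 p) 1 0 1 (by norm_num),
    (1 / 2 : ℝ) • (X.tD .p1 (R_mem_ivl_p1 p) 0 0 1 (by norm_num)
        + X.tD .c1 (R_mem_ivl_c1 p) 0 0 1 (by norm_num))
      + (p.θ * p.R) • (X.tD .p1 (R_mem_ivl_p1 p) 1 0 1 (by norm_num)
        - X.tD .c1 (R_mem_ivl_c1 p) 1 0 1 (by norm_num)),
    p.Le • (X.tD .p1 (R_mem_ivl_p1 p) 1 0 1 (by norm_num)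
        - X.tD .c1 (R_mem_ivl_c1 p) 1 0 1 (by norm_num))
      + (X.tD .p2 (R_mem_ivl_p2 p) 0 0 1 (by norm_num)
        - X.tD .c2 (R_mem_ivl_c2 p) 0 0 1 (by norm_num)),
    p.Le • (X.tD .p2 (R_mem_ivl_p2 p) 0 0 1 (by norm_num)
        - X.tD .c2 (R_mem_ivl_c2 p) 0 0 1 (by norm_num))
      + (X.tD .p2 (R_mem_ivl_p2 p) 1 0 1 (by norm_num)
        - X.tD .c2 (R_mem_ivl_c2 p) 1 0 1 (by norm_num))]

/-- The entries of class `C_♯^α` of `𝓑_*`. -/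
noncomputable def bs0 (p : Params) : X p 2 →L[ℝ] (Fin 2 → CPer p 0) :=
  ContinuousLinearMap.pi ![
    X.tL .c1 (zero_mem_ivl_c1 p) - X.tL .m1 (zero_mem_ivl_m1 p),
    X.tL .p1 (R_mem_ivl_p1 p) - X.tL .c1 (R_mem_ivl_c1 p)]

/-- In `h₆ - (Le / (θ R)) h₅` the jumps of `ζ_x` cancel. Only traces of order zero remain, namely
those in the third entry of `bs2`, and they are of class `C^{2+α}`. -/
theorem bs_mem (u : X p 2) : (bs2 p u, bs1 p u, bs0 p u) ∈ DataSub p := by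
  intro y hy
  have h1 := p.θ_pos.ne'
  have h2 := p.R_pos.ne'
  simp [bs2, bs1, CPer.d_add, CPer.sub_d, CPer.d_smul, X.tD_d _ _ _ _ hy]
  field_simp
  ring

/-- The operator `𝓑_*` from `X_{2+α}` to the space of data. -/
noncomputable def Bs (p : Params) : X p 2 →L[ℝ] Data p :=
  ((bs2 p).prod ((bs1 p).prod (bs0 p))).codRestrict (DataSub p) bs_mem

theorem Bs_fn (u : X p 2) (j : Fin 9) {y : ℝ} (hy : y ∈ cell p) :
    (Bs p u).fn j y = Bstar u y j := by
  fin_cases j <;>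
  simp [Bs, Data.fn, Bstar, bs2, bs1, bs0, Bop, B0, Lop, X.tL, CPer.d_add, CPer.sub_d,
    CPer.d_smul, X.tD_d _ _ _ _ hy]
  ring

/-- The extra function stored among those of class `C^{2+α}` is not one of the nine, but the
constraint defining the data determines it from `h₅` and `h₆`. -/
theorem Data.ext_fn {h g : Data p} (H : ∀ j, ∀ y ∈ cell p, h.fn j y = g.fn j y) : h = g := by
  refine Subtype.ext (Prod.ext (funext fun j => CPer.ext_d fun y hy => ?_)
    (Prod.ext (funext fun j => CPer.ext_d fun y hy => ?_)
      (funext fun j => CPer.ext_d fun y hy => ?_)))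
  · fin_cases j
    · exact H 0 y hy
    · exact H 1 y hy
    · have h1 := h.2 y hy
      have h2 := g.2 y hy
      have h3 := H 4 y hy
      have h4 := H 5 y hy
      simp only [Data.fn] at h3 h4
      change (h.1.2.1 2).d 0 y = (g.1.2.1 2).d 0 y at h3
      change (h.1.2.1 3).d 0 y = (g.1.2.1 3).d 0 y at h4
      change (h.1.1 2).d 0 y = (g.1.1 2).d 0 y
      rw [h1, h2, h3, h4]
  · fin_cases j
    · exact H 2 y hy
    · exact H 3 y hy
    · exact H 4 y hy
    · exact H 5 y hy
    · exact H 6 y hy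
  · fin_cases j
    · exact H 7 y hy
    · exact H 8 y hy

theorem Data.fn_zero (j : Fin 9) (y : ℝ) : (0 : Data p).fn j y = 0 := by
  fin_cases j <;> exact CPer.zero_d _ _

theorem X.tendsto_D_atBot (u : X p 2) {i : Piece} (hi : i.reg = Reg.minus) {a b : ℕ}
    (h : a + b ≤ 2) {y : ℝ} (hy : y ∈ cell p) : Tendsto (fun x => u.D a b i x y) atBot (𝓝 0) :=
  u.2.2.2.2.2.1 i a b h hi y hy

theorem X.tendsto_D_atTop (u : X p 2) {i : Piece} (hi : i.reg = Reg.plus) {a b : ℕ}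
    (h : a + b ≤ 2) {y : ℝ} (hy : y ∈ cell p) : Tendsto (fun x => u.D a b i x y) atTop (𝓝 0) :=
  u.2.2.2.2.2.2.1 i a b h hi y hy

/-- The fifth entries of `𝓑` and `𝓑̃` differ by half of the jump `[ζ]_R`, which is zero on either
side of the equivalence. The limits of `𝓛 u` at infinity come for free from the decay of the
derivatives of `u`. -/
theorem Bs_eq_zero_iff (u : X p 2) : Bs p u = 0 ↔ u ∈ DL p := by
  constructor
  · intro h
    have H : ∀ y ∈ cell p, ∀ j, Bstar u y j = 0 := fun y hy j => by
      rw [← Bs_fn u j hy, h, Data.fn_zero]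
    refine ⟨fun y hy => ?_, fun y hy => ?_, fun y hy => ?_, fun y hy => ?_, fun y hy => ?_⟩
    · have H' := H y hy
      funext j
      have e1 := H' 1
      have e4 := H' 4
      fin_cases j
      · exact H' 0
      · exact H' 1
      · exact H' 2
      · exact H' 3
      · simp [Bstar, Bop] at e1 e4 ⊢
        linarith
      · exact H' 5
      · exact H' 6
    · funext j
      fin_cases j
      · exact H y hy 7
      · exact H y hy 8
    · simpa [Lop] using ((u.tendsto_D_atBot (i := .m1) rfl (a := 2) (b := 0) (by norm_num) hy).add
        (u.tendsto_D_atBot rfl (a := 0) (b := 2) (by norm_num) hy)).add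
        (u.tendsto_D_atBot rfl (a := 1) (b := 0) (by norm_num) hy)
    · simpa [Lop] using ((u.tendsto_D_atTop (i := .p1) rfl (a := 2) (b := 0) (by norm_num) hy).add
        (u.tendsto_D_atTop rfl (a := 0) (b := 2) (by norm_num) hy)).add
        (u.tendsto_D_atTop rfl (a := 1) (b := 0) (by norm_num) hy)
    · simpa [Lop] using (((u.tendsto_D_atTop (i := .p2) rfl (a := 2) (b := 0) (by norm_num) hy).add
        (u.tendsto_D_atTop rfl (a := 0) (b := 2) (by norm_num) hy)).const_mul p.Le⁻¹).add
        (u.tendsto_D_atTop rfl (a := 1) (b := 0) (by norm_num) hy)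
  · rintro ⟨h1, h2, -⟩
    refine Data.ext_fn fun j y hy => ?_
    rw [Bs_fn u j hy, Data.fn_zero]
    have e := fun j => congrFun (h1 y hy) j
    have e' := fun j => congrFun (h2 y hy) j
    fin_cases j
    · exact e 0
    · exact e 1
    · exact e 2
    · exact e 3
    · have e1 := e 1
      have e4 := e 4
      simp [Bstar, Bop] at e1 e4 ⊢
      linarith
    · exact e 5
    · exact e 6
    · exact e' 0
    · exact e' 1

end Bs

end ThickFlame

namespace ThickFlame

/-! ### Averages with a smooth kernel -/

open MeasureTheory in
/-- The average `∫ ψ(t) g(y + t s) dt`. -/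
noncomputable def avg (ψ g : ℝ → ℝ) (s y : ℝ) : ℝ := ∫ t, ψ t * g (y + t * s)

/-- Smooth compactly supported kernels. -/
structure IsKer (ψ : ℝ → ℝ) : Prop where
  smooth : ContDiff ℝ ∞ ψ
  compact : HasCompactSupport ψ

namespace IsKer

variable {ψ χ : ℝ → ℝ}

theorem continuous (h : IsKer ψ) : Continuous ψ := h.smooth.continuous

theorem add (h : IsKer ψ) (h' : IsKer χ) : IsKer fun t => ψ t + χ t :=
  ⟨h.smooth.add h'.smooth, h.compact.add h'.compact⟩

theorem deriv (h : IsKer ψ) : IsKer (deriv ψ) :=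
  ⟨(contDiff_infty_iff_deriv.1 h.smooth).2, h.compact.deriv⟩

theorem mul_left {f : ℝ → ℝ} (h : IsKer ψ) (hf : ContDiff ℝ ∞ f) : IsKer fun t => f t * ψ t :=
  ⟨hf.mul h.smooth, h.compact.mul_left⟩

theorem id_mul (h : IsKer ψ) : IsKer fun t => t * ψ t := h.mul_left contDiff_id

theorem hasDerivAt (h : IsKer ψ) (t : ℝ) : HasDerivAt ψ (_root_.deriv ψ t) t :=
  (h.smooth.differentiable (by simp) t).hasDerivAt

theorem hasDerivAt_id_mul {ψ' : ℝ → ℝ} (h : ∀ t, HasDerivAt ψ (ψ' t) t) (t : ℝ) :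
    HasDerivAt (fun t => t * ψ t) (ψ t + t * ψ' t) t := by
  simpa using! (hasDerivAt_id t).fun_mul (h t)

theorem integrable_mul (h : IsKer ψ) {f : ℝ → ℝ} (hf : Continuous f) :
    MeasureTheory.Integrable fun t => ψ t * f t :=
  (h.continuous.mul hf).integrable_of_hasCompactSupport h.compact.mul_right

theorem integrable (h : IsKer ψ) : MeasureTheory.Integrable ψ :=
  h.continuous.integrable_of_hasCompactSupport h.compact

theorem integral_deriv_eq_zero {ψ' : ℝ → ℝ} (h : IsKer ψ) (h' : IsKer ψ')
    (hd : ∀ t, HasDerivAt ψ (ψ' t) t) : ∫ t, ψ' t = 0 :=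
  MeasureTheory.integral_eq_zero_of_hasDerivAt_of_integrable hd h'.integrable h.integrable

/-- One dominated differentiation covers both variables of an average: `a t = t s`, `b = 1`
differentiates in `y`, while `a = y`, `b t = t` differentiates in `s`. -/
theorem hasDerivAt_integral (h : IsKer ψ) {g g' : ℝ → ℝ} {M : ℝ}
    (hg : ∀ x, HasDerivAt g (g' x) x) (hg' : Continuous g') (hM : ∀ x, |g' x| ≤ M)
    {a b : ℝ → ℝ} (ha : Continuous a) (hb : Continuous b) (r : ℝ) :
    HasDerivAt (fun r => ∫ t, ψ t * g (a t + b t * r)) (∫ t, ψ t * (b t * g' (a t + b t * r))) r := by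
  have hgc : Continuous g := continuous_iff_continuousAt.2 fun x => (hg x).continuousAt
  have hc : ∀ r, Continuous fun t => ψ t * g (a t + b t * r) := fun r =>
    h.continuous.mul (hgc.comp (ha.add (hb.mul continuous_const)))
  have hc' : ∀ r, Continuous fun t => ψ t * (b t * g' (a t + b t * r)) := fun r =>
    h.continuous.mul (hb.mul (hg'.comp (ha.add (hb.mul continuous_const))))
  refine (hasDerivAt_integral_of_dominated_loc_of_deriv_le (s := univ)
    (F' := fun r t => ψ t * (b t * g' (a t + b t * r)))
    (bound := fun t => |ψ t * (b t * M)|) univ_mem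
    (Eventually.of_forall fun r => (hc r).aestronglyMeasurable)
    (h.integrable_mul (hgc.comp (ha.add (hb.mul continuous_const))))
    (hc' r).aestronglyMeasurable (Eventually.of_forall fun t r _ => ?_)
    (h.integrable_mul (hb.mul continuous_const)).abs
    (Eventually.of_forall fun t r _ => ?_)).2
  · rw [Real.norm_eq_abs, abs_mul, abs_mul, abs_mul, abs_mul]
    exact mul_le_mul_of_nonneg_left (mul_le_mul_of_nonneg_left
      ((hM _).trans (le_abs_self M)) (abs_nonneg _)) (abs_nonneg _)
  · have h1 : HasDerivAt (fun r => a t + b t * r) (b t) r := by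
      simpa using ((hasDerivAt_id r).const_mul (b t)).const_add (a t)
    have h2 := ((hg (a t + b t * r)).comp r h1).const_mul (ψ t)
    rwa [mul_comm (g' _)] at h2

section

variable {g g' : ℝ → ℝ} {M : ℝ}

theorem avg_dy (h : IsKer ψ) (hg : ∀ x, HasDerivAt g (g' x) x) (hg' : Continuous g')
    (hM : ∀ x, |g' x| ≤ M) (s y : ℝ) :
    HasDerivAt (fun y => avg ψ g s y) (avg ψ g' s y) y := by
  have := h.hasDerivAt_integral hg hg' hM (a := fun t => t * s) (b := fun _ => 1) (by fun_prop)
    (by fun_prop) y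
  simpa only [one_mul, add_comm, avg] using this

theorem avg_ds (h : IsKer ψ) (hg : ∀ x, HasDerivAt g (g' x) x) (hg' : Continuous g')
    (hM : ∀ x, |g' x| ≤ M) (s y : ℝ) :
    HasDerivAt (fun s => avg ψ g s y) (avg (fun t => t * ψ t) g' s y) s := by
  have := h.hasDerivAt_integral hg hg' hM (a := fun _ => y) (b := fun t => t) (by fun_prop)
    (by fun_prop) s
  convert! this using 1
  unfold avg
  congr 1; funext t; ring

/-- The function `t ↦ g(y + t s)` has derivative `s g'(y + t s)`, so integration by parts in `t`
moves the derivative to the kernel. This is the source of every gain of regularity in the lifting.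
-/
theorem mul_avg (h : IsKer ψ) {ψ' : ℝ → ℝ} (h' : IsKer ψ') (hd : ∀ t, HasDerivAt ψ (ψ' t) t)
    (hg : ∀ x, HasDerivAt g (g' x) x) (hg' : Continuous g') (s y : ℝ) :
    s * avg ψ g' s y = -avg ψ' g s y := by
  have hgc : Continuous g := continuous_iff_continuousAt.2 fun x => (hg x).continuousAt
  have hv : ∀ t, HasDerivAt (fun t => g (y + t * s)) (g' (y + t * s) * s) t := fun t => by
    have h1 : HasDerivAt (fun t => y + t * s) s t := by
      simpa using ((hasDerivAt_id t).mul_const s).const_add y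
    exact (hg (y + t * s)).comp t h1
  have := MeasureTheory.integral_mul_deriv_eq_deriv_mul_of_integrable (fun t _ => hd t)
    (fun t _ => hv t) (h.integrable_mul (by fun_prop)) (h'.integrable_mul (by fun_prop))
    (h.integrable_mul (by fun_prop))
  unfold avg
  rw [← this, ← MeasureTheory.integral_const_mul]
  congr 1; funext t; ring

theorem exists_primitive (hg : Continuous g) : ∃ G : ℝ → ℝ, ∀ x, HasDerivAt G (g x) x :=
  ⟨fun x => ∫ t in (0 : ℝ)..x, g t, fun _ => intervalIntegral.integral_hasDerivAt_right
    (hg.intervalIntegrable _ _) (hg.stronglyMeasurableAtFilter _ _) hg.continuousAt⟩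

/-- Applied to a primitive of `g`, `mul_avg` rewrites the product as an average of a `C¹` function.
So a factor `s` makes the average differentiable although `g` is only continuous. -/
theorem mul_avg_dy (h : IsKer ψ) {ψ' : ℝ → ℝ} (h' : IsKer ψ') (hd : ∀ t, HasDerivAt ψ (ψ' t) t)
    (hg : Continuous g) (hM : ∀ x, |g x| ≤ M) (s y : ℝ) :
    HasDerivAt (fun y => s * avg ψ g s y) (-avg ψ' g s y) y := by
  obtain ⟨G, hG⟩ := exists_primitive hg
  simp only [h.mul_avg h' hd hG hg]
  exact (h'.avg_dy hG hg hM s y).neg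

theorem mul_avg_ds (h : IsKer ψ) {ψ' : ℝ → ℝ} (h' : IsKer ψ') (hd : ∀ t, HasDerivAt ψ (ψ' t) t)
    (hg : Continuous g) (hM : ∀ x, |g x| ≤ M) (s y : ℝ) :
    HasDerivAt (fun s => s * avg ψ g s y) (-avg (fun t => t * ψ' t) g s y) s := by
  obtain ⟨G, hG⟩ := exists_primitive hg
  simp only [h.mul_avg h' hd hG hg]
  exact (h'.avg_ds hG hg hM s y).neg

theorem avg_add_left (h : IsKer ψ) (h' : IsKer χ) (hg : Continuous g) (s y : ℝ) :
    avg (fun t => ψ t + χ t) g s y = avg ψ g s y + avg χ g s y := by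
  unfold avg
  rw [← MeasureTheory.integral_add (h.integrable_mul (by fun_prop))
    (h'.integrable_mul (by fun_prop))]
  congr 1; funext t; ring

theorem avg_add_right (h : IsKer ψ) {f : ℝ → ℝ} (hg : Continuous g) (hf : Continuous f) (s y : ℝ) :
    avg ψ (fun x => g x + f x) s y = avg ψ g s y + avg ψ f s y := by
  unfold avg
  rw [← MeasureTheory.integral_add (h.integrable_mul (by fun_prop))
    (h.integrable_mul (by fun_prop))]
  congr 1; funext t; ring

end

/-- Moving `(s, y)` moves the argument `y + t s` by at most `(1 + |t|)` times the distance, hence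
the weighted integral of `|ψ|` as constant. It does not depend on `g`. -/
theorem exists_BHOn_avg (h : IsKer ψ) {α : ℝ≥0} (hα0 : 0 < α) (hα : α ≤ 1) :
    ∃ K : ℝ, 0 ≤ K ∧ ∀ g : ℝ → ℝ, ∀ C : ℝ, BHOn α C g univ →
      BHOn α (K * C) (fun z : ℝ × ℝ => avg ψ g z.1 z.2) univ := by
  have hK := (h.integrable_mul (f := fun t => 1 + |t|) (by fun_prop)).abs
  refine ⟨∫ t, |ψ t * (1 + |t|)|, MeasureTheory.integral_nonneg fun t => abs_nonneg _,
    fun g C hg => ?_⟩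
  have hC : 0 ≤ C := (abs_nonneg _).trans (hg.1 0 (mem_univ _))
  have hgc : Continuous g := continuousOn_univ.1 (hg.continuousOn hα0)
  have key : ∀ f : ℝ → ℝ, ∀ D : ℝ, (∀ t, |f t| ≤ (1 + |t|) * D) →
      |∫ t, ψ t * f t| ≤ (∫ t, |ψ t * (1 + |t|)|) * D := by
    intro f D hf
    rw [← MeasureTheory.integral_mul_const, ← Real.norm_eq_abs]
    refine MeasureTheory.norm_integral_le_of_norm_le (hK.mul_const D)
      (Eventually.of_forall fun t => ?_)
    have h1 : abs (1 + |t|) = 1 + |t| := abs_of_nonneg (by positivity)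
    rw [Real.norm_eq_abs, abs_mul, abs_mul, h1, mul_assoc]
    exact mul_le_mul_of_nonneg_left (hf t) (abs_nonneg _)
  refine ⟨fun z _ => key _ _ fun t => ?_, fun z _ w _ => ?_⟩
  · exact (hg.1 _ (mem_univ _)).trans (le_mul_of_one_le_left hC (by linarith [abs_nonneg t]))
  · unfold avg
    rw [← MeasureTheory.integral_sub (h.integrable_mul (by fun_prop))
      (h.integrable_mul (by fun_prop))]
    simp only [← mul_sub]
    rw [mul_assoc]
    refine key _ _ fun t => ?_
    have h0 : dist z.1 w.1 ≤ dist z w := le_max_left _ _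
    have h0' : dist z.2 w.2 ≤ dist z w := le_max_right _ _
    have h1 : (1 : ℝ) ≤ 1 + |t| := by linarith [abs_nonneg t]
    have h2 : dist (z.2 + t * z.1) (w.2 + t * w.1) ≤ (1 + |t|) * dist z w := by
      rw [Real.dist_eq] at h0 h0' ⊢
      have := abs_add_le (z.2 - w.2) (t * (z.1 - w.1))
      rw [abs_mul] at this
      have e := mul_le_mul_of_nonneg_left h0 (abs_nonneg t)
      rw [show z.2 + t * z.1 - (w.2 + t * w.1) = z.2 - w.2 + t * (z.1 - w.1) by ring]
      linarith
    refine (hg.2 _ (mem_univ _) _ (mem_univ _)).trans ?_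
    rw [← mul_assoc, mul_comm (1 + |t|) C, mul_assoc]
    refine mul_le_mul_of_nonneg_left ?_ hC
    calc _ ≤ ((1 + |t|) * dist z w) ^ (α : ℝ) := Real.rpow_le_rpow dist_nonneg h2 α.coe_nonneg
      _ = (1 + |t|) ^ (α : ℝ) * dist z w ^ (α : ℝ) := Real.mul_rpow (by linarith) dist_nonneg
      _ ≤ (1 + |t|) * dist z w ^ (α : ℝ) := by
        refine mul_le_mul_of_nonneg_right ?_ (Real.rpow_nonneg dist_nonneg _)
        simpa using Real.rpow_le_rpow_of_exponent_le h1 (show (α : ℝ) ≤ 1 by exact_mod_cast hα)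

end IsKer

theorem avg_smul_right (ψ g : ℝ → ℝ) (c s y : ℝ) :
    avg ψ (fun x => c * g x) s y = c * avg ψ g s y := by
  unfold avg
  rw [← MeasureTheory.integral_const_mul]
  congr 1; funext t; ring

theorem avg_zero (ψ g : ℝ → ℝ) (y : ℝ) : avg ψ g 0 y = (∫ t, ψ t) * g y := by
  simp [avg, MeasureTheory.integral_mul_const]

theorem avg_periodic {ψ g : ℝ → ℝ} {T : ℝ} (hg : Function.Periodic g T) (s y : ℝ) :
    avg ψ g s (y + T) = avg ψ g s y := by
  unfold avg
  congr 1; funext t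
  rw [show y + T + t * s = y + t * s + T by ring, hg]

/-- The substitution `t ↦ -t` lets `|x|` be replaced by `x` in the averages of `N₂`, so that one
formula is used on both sides of an interface. -/
theorem avg_neg {ψ g : ℝ → ℝ} (hψ : ∀ t, ψ (-t) = ψ t) (s y : ℝ) :
    avg ψ g (-s) y = avg ψ g s y := by
  unfold avg
  rw [← MeasureTheory.integral_neg_eq_self]
  congr 1; funext t
  rw [hψ]; congr 2; ring

/-! ### Functions of class `C^{2+α}` on the plane, and their restrictions -/

section jets

variable {p : Params}

/-- A smooth function of `x` which vanishes for `|x| > R/2`. -/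
structure IsCut (p : Params) (e : ℝ → ℝ) : Prop where
  smooth : ContDiff ℝ ∞ e
  supp : ∀ x, p.R / 2 < |x| → e x = 0

theorem IsCut.mul_right {e f : ℝ → ℝ} (h : IsCut p e) (hf : ContDiff ℝ ∞ f) :
    IsCut p fun x => e x * f x :=
  ⟨h.smooth.mul hf, fun x hx => by rw [h.supp x hx, zero_mul]⟩

theorem IsCut.hasDerivAt {e : ℝ → ℝ} (h : IsCut p e) (x : ℝ) : HasDerivAt e (deriv e x) x :=
  (h.smooth.differentiable (by simp) x).hasDerivAt

theorem IsCut.deriv {e : ℝ → ℝ} (h : IsCut p e) : IsCut p (deriv e) := by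
  refine ⟨(contDiff_infty_iff_deriv.1 h.smooth).2, fun x hx => ?_⟩
  have : e =ᶠ[𝓝 x] fun _ => 0 := by
    filter_upwards [continuous_abs.continuousAt.eventually (lt_mem_nhds hx)] with z hz
    exact h.supp z hz
  rw [this.deriv_eq, deriv_const]

theorem IsCut.hasCompactSupport {e : ℝ → ℝ} (h : IsCut p e) : HasCompactSupport e := by
  refine HasCompactSupport.intro (isCompact_Icc (a := -(p.R / 2)) (b := p.R / 2)) fun x hx => ?_
  refine h.supp x (not_le.1 fun h' => hx (abs_le.1 h'))

theorem IsCut.exists_BHOn {e : ℝ → ℝ} (h : IsCut p e) : ∃ E, 0 ≤ E ∧ BHOn p.α E e univ := by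
  obtain ⟨C, hC⟩ := h.hasCompactSupport.exists_bound_of_continuous h.smooth.continuous
  obtain ⟨L, hL⟩ := h.smooth.lipschitzWith_of_hasCompactSupport h.hasCompactSupport (by simp)
  have hC0 : 0 ≤ C := (norm_nonneg _).trans (hC 0)
  refine ⟨2 * (C + L), by positivity, BHOn.of_lipschitz p.α_le_one (fun x _ => ?_)
    fun x _ y _ => ?_⟩
  · have := hC x
    rw [Real.norm_eq_abs] at this
    linarith [L.coe_nonneg]
  · have := hL.dist_le_mul x y
    rw [Real.dist_eq] at this
    exact this.trans (mul_le_mul_of_nonneg_right (by linarith) dist_nonneg)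

/-- The functions `T v` on the plane are bounded and Hölder continuous, with constants which are
bounded by a multiple of `‖v‖`. -/
def HolBdd (p : Params) {V : Type*} [NormedAddCommGroup V] (T : V → ℝ → ℝ → ℝ) : Prop :=
  ∃ K : ℝ, 0 ≤ K ∧ ∀ v, BHOn p.α (K * ‖v‖) (fun z : ℝ × ℝ => T v z.1 z.2) univ

variable {V : Type*} [NormedAddCommGroup V]

theorem HolBdd.add {T S : V → ℝ → ℝ → ℝ} (hT : HolBdd p T) (hS : HolBdd p S) :
    HolBdd p fun v x y => T v x y + S v x y := by
  obtain ⟨K, hK, h⟩ := hT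
  obtain ⟨K', hK', h'⟩ := hS
  exact ⟨K + K', by positivity, fun v => by rw [add_mul]; exact (h v).add (h' v)⟩

theorem HolBdd.congr {T S : V → ℝ → ℝ → ℝ} (hT : HolBdd p T)
    (h : ∀ v x y, S v x y = T v x y) : HolBdd p S := by
  have : S = T := funext fun v => funext fun x => funext fun y => h v x y
  rwa [this]

/-- The reparametrization `τ`, such as `x³`, need not be Lipschitz on the whole line. Its argument
is therefore projected to `[-R/2, R/2]`, outside of which the cut-off vanishes anyway. -/
theorem HolBdd.term {e ψ τ : ℝ → ℝ} (he : IsCut p e) (hψ : IsKer ψ) {G : V → ℝ → ℝ}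
    (hG : ∀ v, BHOn p.α (4 * ‖v‖) (G v) univ) {L : ℝ} (hL : 1 ≤ L)
    (hτ : ∀ x ∈ Icc (-(p.R / 2)) (p.R / 2), ∀ y ∈ Icc (-(p.R / 2)) (p.R / 2),
      dist (τ x) (τ y) ≤ L * dist x y) :
    HolBdd p fun v x y => e x * avg ψ (G v) (τ x) y := by
  obtain ⟨E, hE, hE'⟩ := he.exists_BHOn
  obtain ⟨K, hK, hK'⟩ := hψ.exists_BHOn_avg p.α_pos p.α_le_one
  have hR : -(p.R / 2) ≤ p.R / 2 := by linarith [p.R_pos]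
  refine ⟨2 * (E * (K * 4 * L)), by positivity, fun v => ?_⟩
  set cl : ℝ → ℝ := fun x => projIcc (-(p.R / 2)) (p.R / 2) hR x with hcl
  have hclL : ∀ x y, dist (cl x) (cl y) ≤ dist x y := fun x y => by
    have := (LipschitzWith.projIcc hR).dist_le_mul x y
    simpa [Subtype.dist_eq] using this
  have h1 : BHOn p.α (E * 1) (fun z : ℝ × ℝ => e z.1) univ :=
    hE'.comp p.α_le_one le_rfl (fun _ _ => mem_univ _) fun z _ w _ => by
      rw [one_mul]; exact le_max_left _ _
  have h2 : BHOn p.α (K * (4 * ‖v‖) * L) (fun z : ℝ × ℝ => avg ψ (G v) (τ (cl z.1)) z.2) univ := by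
    refine (hK' (G v) _ (hG v)).comp (φ := fun z : ℝ × ℝ => (τ (cl z.1), z.2)) p.α_le_one hL
      (fun _ _ => mem_univ _) fun z _ w _ => ?_
    have a1 := hτ (cl z.1) (Subtype.coe_prop _) (cl w.1) (Subtype.coe_prop _)
    have a2 := mul_le_mul_of_nonneg_left ((hclL z.1 w.1).trans (le_max_left _ (dist z.2 w.2)))
      (zero_le_one.trans hL)
    have a3 : dist z.2 w.2 ≤ dist z w := le_max_right _ _
    have a4 : dist z w ≤ L * dist z w := le_mul_of_one_le_left dist_nonneg hL
    exact max_le (a1.trans a2) (a3.trans a4)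
  refine ((h1.mul h2).congr fun z _ => ?_).mono (le_of_eq (by ring))
  by_cases hz : z.1 ∈ Icc (-(p.R / 2)) (p.R / 2)
  · simp only [hcl, projIcc_of_mem hR hz]
  · have : e z.1 = 0 := he.supp _ (not_le.1 fun h' => hz (abs_le.1 h'))
    simp only [this, zero_mul]

/-- A family of functions on the plane, linear in `v ∈ V`, which has the properties of the
derivatives of functions of class `C^{2+α}`, periodic in `y` and supported in `|x| ≤ R/2`. -/
structure IsJet (p : Params) {V : Type*} [NormedAddCommGroup V] [NormedSpace ℝ V]
    (f : V → ℕ → ℕ → ℝ → ℝ → ℝ) : Prop where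
  dx : ∀ v a b, a + b < 2 → ∀ x y, HasDerivAt (fun s => f v a b s y) (f v (a + 1) b x y) x
  dy : ∀ v a b, a + b < 2 → ∀ x y, HasDerivAt (fun s => f v a b x s) (f v a (b + 1) x y) y
  per : ∀ v a b x, f v a b x (-(p.ℓ / 2)) = f v a b x (p.ℓ / 2)
  supp : ∀ v a b x y, p.R / 2 < |x| → f v a b x y = 0
  hol : ∀ a b, a + b ≤ 2 → HolBdd p fun v => f v a b
  map_add : ∀ v w a b x y, f (v + w) a b x y = f v a b x y + f w a b x y
  map_smul : ∀ (c : ℝ) v a b x y, f (c • v) a b x y = c * f v a b x y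

/-- Multiplying by a constant `ε i` on each piece creates the prescribed jumps while keeping every
piece of class `C^{2+α}`. Periodicity is that of the jet, and decay at infinity follows from its
compact support in `x`. -/
theorem IsJet.exists_lift {V : Type*} [NormedAddCommGroup V] [NormedSpace ℝ V]
    {f : V → ℕ → ℕ → ℝ → ℝ → ℝ} (hf : IsJet p f) (ε : Piece → ℝ) (hε : ∀ i, |ε i| ≤ 1) (x₀ : ℝ) :
    ∃ N : V →L[ℝ] X p 2, ∀ v i a b, a + b ≤ 2 → ∀ x ∈ i.reg.ivl p, ∀ y ∈ cell p,
      (N v).D a b i x y = ε i * f v a b (x - x₀) y := by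
  choose! K hK0 hK using hf.hol
  set M : ℝ := ∑ a ∈ Finset.range 3, ∑ b ∈ Finset.range 3, |K a b| with hM
  have hM0 : 0 ≤ M := Finset.sum_nonneg fun _ _ => Finset.sum_nonneg fun _ _ => abs_nonneg _
  have hKM : ∀ a b, a + b ≤ 2 → K a b ≤ M := fun a b hab => by
    have h1 := Finset.single_le_sum (f := fun b => |K a b|) (fun _ _ => abs_nonneg _)
      (Finset.mem_range.2 (show b < 3 by omega))
    have h2 := Finset.single_le_sum (f := fun a => ∑ b ∈ Finset.range 3, |K a b|)
      (fun _ _ => Finset.sum_nonneg fun _ _ => abs_nonneg _)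
      (Finset.mem_range.2 (show a < 3 by omega))
    exact (le_abs_self _).trans (h1.trans h2)
  have hX : ∀ v, IsX p (M * ‖v‖) fun i a b x y => ε i * f v a b (x - x₀) y := fun v =>
    { dx := fun i a b hab x _ y _ =>
        (((hf.dx v a b hab (x - x₀) y).comp_sub_const x x₀).const_mul _).hasDerivWithinAt
      dy := fun i a b hab x _ y _ => ((hf.dy v a b hab (x - x₀) y).const_mul _).hasDerivWithinAt
      per := fun i a b _ x _ => by rw [hf.per]
      lim_bot := fun i a b _ _ y _ => by
        refine tendsto_const_nhds.congr' ?_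
        filter_upwards [eventually_lt_atBot (x₀ - p.R / 2)] with x hx
        rw [hf.supp, mul_zero]
        exact lt_abs.2 (Or.inr (by linarith))
      lim_top := fun i a b _ _ y _ => by
        refine tendsto_const_nhds.congr' ?_
        filter_upwards [eventually_gt_atTop (x₀ + p.R / 2)] with x hx
        rw [hf.supp, mul_zero]
        exact lt_abs.2 (Or.inl (by linarith))
      hol := fun i a b hab => by
        have h1 := ((hK a b hab v).mono
          (mul_le_mul_of_nonneg_right (hKM a b hab) (norm_nonneg v))).comp
          (φ := fun z : ℝ × ℝ => (z.1 - x₀, z.2)) (t := Piece.dom p i) p.α_le_one le_rfl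
          (fun _ _ => mem_univ _) fun z _ w _ => by
            rw [one_mul, Prod.dist_eq, Prod.dist_eq, dist_sub_right]
        refine (h1.const_mul (ε i)).mono ?_
        rw [mul_one]
        exact mul_le_of_le_one_left (mul_nonneg hM0 (norm_nonneg v)) (hε i) }
  exact ⟨X.mkL _ M hX (fun v w i a b x y => by rw [hf.map_add, mul_add])
    (fun c v i a b x y => by rw [hf.map_smul]; ring),
    fun v i a b hab x hx y hy => X.mkL_D _ _ _ v hab hx hy⟩

end jets

end ThickFlame

namespace ThickFlame

/-! ### The smooth cores of the lifting and their derivatives -/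

section cores

variable {p : Params} (c : Cutoffs p)

theorem Cutoffs.isCut_η : IsCut p c.η := by
  refine ⟨c.η_smooth, fun x hx => ?_⟩
  have h1 := c.η_lower x
  have h2 := c.η_upper x
  have hR := p.R_pos
  have h3 : x ∉ Ioo (-p.R / 2) (p.R / 2) := fun h =>
    absurd (abs_lt.2 ⟨by linarith [h.1], h.2⟩) (not_lt.2 hx.le)
  have h4 : x ∉ Ioo (-p.R / 4) (p.R / 4) := fun h =>
    h3 ⟨by linarith [h.1], by linarith [h.2]⟩
  rw [indicator_of_notMem h4] at h1
  rw [indicator_of_notMem h3] at h2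
  exact le_antisymm h2 h1

theorem Cutoffs.η_eventually : ∀ᶠ x in 𝓝 (0 : ℝ), c.η x = 1 := by
  have hR := p.R_pos
  filter_upwards [Ioo_mem_nhds (show -p.R / 4 < 0 by linarith) (show 0 < p.R / 4 by linarith)]
    with x hx
  have h1 := c.η_lower x
  have h2 := c.η_upper x
  have h3 : x ∈ Ioo (-p.R / 2) (p.R / 2) := ⟨by linarith [hx.1], by linarith [hx.2]⟩
  rw [indicator_of_mem hx] at h1
  rw [indicator_of_mem h3] at h2
  exact le_antisymm h2 h1

theorem Cutoffs.η_zero : c.η 0 = 1 := c.η_eventually.self_of_nhds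

theorem Cutoffs.deriv_η_eventually : ∀ᶠ x in 𝓝 (0 : ℝ), deriv c.η x = 0 := by
  filter_upwards [c.η_eventually.eventually_nhds] with x hx
  have : c.η =ᶠ[𝓝 x] fun _ => 1 := hx
  rw [this.deriv_eq, deriv_const]

theorem Cutoffs.deriv_η_zero : deriv c.η 0 = 0 := c.deriv_η_eventually.self_of_nhds

theorem Cutoffs.deriv_deriv_η_zero : deriv (deriv c.η) 0 = 0 := by
  have : deriv c.η =ᶠ[𝓝 0] fun _ => 0 := c.deriv_η_eventually
  rw [this.deriv_eq, deriv_const]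

theorem Cutoffs.isKer_φ : IsKer c.φ := ⟨c.φ_smooth, c.φ_compact⟩

theorem Cutoffs.hasDerivAt_φ (t : ℝ) : HasDerivAt c.φ (deriv c.φ t) t := c.isKer_φ.hasDerivAt t

theorem Cutoffs.hasDerivAt_deriv_φ (t : ℝ) :
    HasDerivAt (deriv c.φ) (deriv (deriv c.φ) t) t := c.isKer_φ.deriv.hasDerivAt t

/-! Moments of the kernel. -/

theorem Cutoffs.integral_deriv_φ : ∫ t, deriv c.φ t = 0 :=
  c.isKer_φ.integral_deriv_eq_zero c.isKer_φ.deriv c.hasDerivAt_φ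

theorem Cutoffs.integral_deriv_deriv_φ : ∫ t, deriv (deriv c.φ) t = 0 :=
  c.isKer_φ.deriv.integral_deriv_eq_zero c.isKer_φ.deriv.deriv c.hasDerivAt_deriv_φ

/-- The compactly supported function `t ψ(t)` has the derivative `ψ + t ψ'`, whose integral is zero.
-/
theorem IsKer.integral_id_mul {ψ ψ' : ℝ → ℝ} (h : IsKer ψ) (h' : IsKer ψ')
    (hd : ∀ t, HasDerivAt ψ (ψ' t) t) : ∫ t, t * ψ' t = -∫ t, ψ t := by
  have := h.id_mul.integral_deriv_eq_zero (h.add h'.id_mul) (IsKer.hasDerivAt_id_mul hd)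
  rw [MeasureTheory.integral_add h.integrable h'.id_mul.integrable] at this
  linarith

theorem Cutoffs.integral_id_mul_φ : ∫ t, t * c.φ t = 0 := by
  have h := MeasureTheory.integral_neg_eq_self (fun t => t * c.φ t) MeasureTheory.volume
  simp only [c.φ_even, neg_mul, MeasureTheory.integral_neg] at h
  linarith

theorem Cutoffs.integral_id_mul_deriv_φ : ∫ t, t * deriv c.φ t = -1 := by
  rw [c.isKer_φ.integral_id_mul c.isKer_φ.deriv c.hasDerivAt_φ, c.φ_integral]

/-- This is `IsKer.integral_id_mul` for the kernel `t ψ(t)`. -/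
theorem IsKer.integral_sq_mul {ψ ψ' : ℝ → ℝ} (h : IsKer ψ) (h' : IsKer ψ')
    (hd : ∀ t, HasDerivAt ψ (ψ' t) t) : ∫ t, t * (t * ψ' t) = -2 * ∫ t, t * ψ t := by
  have := h.id_mul.integral_id_mul (h.add h'.id_mul) (IsKer.hasDerivAt_id_mul hd)
  simp only [mul_add] at this
  rw [MeasureTheory.integral_add h.id_mul.integrable h'.id_mul.id_mul.integrable] at this
  linarith

theorem Cutoffs.integral_sq_mul_deriv_φ : ∫ t, t * (t * deriv c.φ t) = 0 := by
  rw [c.isKer_φ.integral_sq_mul c.isKer_φ.deriv c.hasDerivAt_φ, c.integral_id_mul_φ, mul_zero]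

theorem Cutoffs.integral_sq_mul_deriv_deriv_φ : ∫ t, t * (t * deriv (deriv c.φ) t) = 2 := by
  rw [c.isKer_φ.deriv.integral_sq_mul c.isKer_φ.deriv.deriv c.hasDerivAt_deriv_φ,
    c.integral_id_mul_deriv_φ]
  norm_num

/-! Averages of the periodic extensions. -/

section avg

variable {k : ℕ} {ψ : ℝ → ℝ}

theorem avg_ext_match (ψ : ℝ → ℝ) (ζ : CPer p k) (j : ℕ) (s : ℝ) :
    avg ψ (ζ.ext j) s (-(p.ℓ / 2)) = avg ψ (ζ.ext j) s (p.ℓ / 2) := by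
  have h : Function.Periodic (ζ.ext j) p.ℓ := sharp_periodic p (ζ.d j)
  rw [← avg_periodic h s (-(p.ℓ / 2)), show -(p.ℓ / 2) + p.ℓ = p.ℓ / 2 by ring]

theorem avg_ext_add (hψ : IsKer ψ) (ζ ξ : CPer p k) {j : ℕ} (hj : j ≤ k) (s y : ℝ) :
    avg ψ ((ζ + ξ).ext j) s y = avg ψ (ζ.ext j) s y + avg ψ (ξ.ext j) s y := by
  rw [← hψ.avg_add_right (ζ.continuous_ext hj) (ξ.continuous_ext hj)]
  congr 1; funext x; exact CPer.ext_add _ _ _ _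

theorem avg_ext_smul (ψ : ℝ → ℝ) (r : ℝ) (ζ : CPer p k) (j : ℕ) (s y : ℝ) :
    avg ψ ((r • ζ).ext j) s y = r * avg ψ (ζ.ext j) s y := by
  rw [← avg_smul_right]
  congr 1; funext x; exact CPer.ext_smul _ _ _ _

theorem avg_ext_dy (hψ : IsKer ψ) (ζ : CPer p k) {j : ℕ} (hj : j < k) (s y : ℝ) :
    HasDerivAt (fun y => avg ψ (ζ.ext j) s y) (avg ψ (ζ.ext (j + 1)) s y) y :=
  hψ.avg_dy (ζ.hasDerivAt_ext hj) (ζ.continuous_ext hj) (ζ.abs_ext_le (j + 1)) s y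

theorem avg_ext_ds (hψ : IsKer ψ) (ζ : CPer p k) {j : ℕ} (hj : j < k) (s y : ℝ) :
    HasDerivAt (fun s => avg ψ (ζ.ext j) s y) (avg (fun t => t * ψ t) (ζ.ext (j + 1)) s y) s :=
  hψ.avg_ds (ζ.hasDerivAt_ext hj) (ζ.continuous_ext hj) (ζ.abs_ext_le (j + 1)) s y

theorem mul_avg_ext_dy (hψ : IsKer ψ) {ψ' : ℝ → ℝ} (hψ' : IsKer ψ')
    (hd : ∀ t, HasDerivAt ψ (ψ' t) t) (ζ : CPer p k) {j : ℕ} (hj : j ≤ k) (s y : ℝ) :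
    HasDerivAt (fun y => s * avg ψ (ζ.ext j) s y) (-avg ψ' (ζ.ext j) s y) y :=
  hψ.mul_avg_dy hψ' hd (ζ.continuous_ext hj) (ζ.abs_ext_le j) s y

theorem mul_avg_ext_ds (hψ : IsKer ψ) {ψ' : ℝ → ℝ} (hψ' : IsKer ψ')
    (hd : ∀ t, HasDerivAt ψ (ψ' t) t) (ζ : CPer p k) {j : ℕ} (hj : j ≤ k) (s y : ℝ) :
    HasDerivAt (fun s => s * avg ψ (ζ.ext j) s y) (-avg (fun t => t * ψ' t) (ζ.ext j) s y) s :=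
  hψ.mul_avg_ds hψ' hd (ζ.continuous_ext hj) (ζ.abs_ext_le j) s y

theorem avg_ext_cube_dx (hψ : IsKer ψ) (ζ : CPer p k) {j : ℕ} (hj : j < k) (x y : ℝ) :
    HasDerivAt (fun x => avg ψ (ζ.ext j) (x ^ 3) y)
      (avg (fun t => t * ψ t) (ζ.ext (j + 1)) (x ^ 3) y * (3 * x ^ 2)) x := by
  have h : HasDerivAt (fun x : ℝ => x ^ 3) (3 * x ^ 2) x := by simpa using hasDerivAt_pow 3 x
  exact (avg_ext_ds hψ ζ hj (x ^ 3) y).comp x h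

theorem avg_ext_add_kernel {χ : ℝ → ℝ} (hψ : IsKer ψ) (hχ : IsKer χ) (ζ : CPer p k) {j : ℕ}
    (hj : j ≤ k) (s y : ℝ) :
    avg (fun t => ψ t + χ t) (ζ.ext j) s y = avg ψ (ζ.ext j) s y + avg χ (ζ.ext j) s y :=
  hψ.avg_add_left hχ (ζ.continuous_ext hj) s y

theorem HolBdd.avg_ext {e : ℝ → ℝ} (he : IsCut p e) (hψ : IsKer ψ) {j : ℕ} (hj : j ≤ k) :
    HolBdd p fun (ζ : CPer p k) x y => e x * avg ψ (ζ.ext j) x y :=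
  HolBdd.term (τ := fun x => x) he hψ (fun ζ => ζ.BHOn_ext hj) le_rfl
    fun _ _ _ _ => (one_mul _).ge

theorem HolBdd.avg_ext_cube {e : ℝ → ℝ} (he : IsCut p e) (hψ : IsKer ψ) {j : ℕ} (hj : j ≤ k) :
    HolBdd p fun (ζ : CPer p k) x y => e x * avg ψ (ζ.ext j) (x ^ 3) y := by
  refine HolBdd.term (τ := fun x => x ^ 3) he hψ (fun ζ => ζ.BHOn_ext hj)
    (L := 1 + 3 * (p.R / 2) ^ 2) (by nlinarith [sq_nonneg p.R]) fun x hx y hy => ?_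
  have hx' := abs_le.2 hx
  have hy' := abs_le.2 hy
  rw [Real.dist_eq, Real.dist_eq, show x ^ 3 - y ^ 3 = (x ^ 2 + x * y + y ^ 2) * (x - y) by ring,
    abs_mul]
  refine mul_le_mul_of_nonneg_right ?_ (abs_nonneg _)
  have h1 : x ^ 2 ≤ (p.R / 2) ^ 2 := sq_le_sq' hx.1 hx.2
  have h2 : y ^ 2 ≤ (p.R / 2) ^ 2 := sq_le_sq' hy.1 hy.2
  rw [abs_le]
  constructor <;> nlinarith [sq_nonneg (x - y), sq_nonneg (x + y)]

end avg

theorem of_add_lt_two {P : ℕ → ℕ → Prop} (h00 : P 0 0) (h10 : P 1 0) (h01 : P 0 1) (a b : ℕ)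
    (hab : a + b < 2) : P a b := by
  match a, b, hab with
  | 0, 0, _ => exact h00
  | 1, 0, _ => exact h10
  | 0, 1, _ => exact h01
  | a + 2, b, h => omega
  | 1, b + 1, h => omega
  | 0, b + 2, h => omega

theorem of_add_le_two {P : ℕ → ℕ → Prop} (h00 : P 0 0) (h10 : P 1 0) (h01 : P 0 1)
    (h20 : P 2 0) (h11 : P 1 1) (h02 : P 0 2) (a b : ℕ) (hab : a + b ≤ 2) : P a b := by
  match a, b, hab with
  | 0, 0, _ => exact h00
  | 1, 0, _ => exact h10
  | 0, 1, _ => exact h01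
  | 2, 0, _ => exact h20
  | 1, 1, _ => exact h11
  | 0, 2, _ => exact h02
  | a + 3, b, h => omega
  | 2, b + 1, h => omega
  | 1, b + 2, h => omega
  | 0, b + 3, h => omega

/-- A family of functions with given entries for `a + b ≤ 2`. -/
def jetOf (f00 f10 f01 f20 f11 f02 : ℝ → ℝ → ℝ) : ℕ → ℕ → ℝ → ℝ → ℝ
  | 0, 0 => f00
  | 1, 0 => f10
  | 0, 1 => f01
  | 2, 0 => f20
  | 1, 1 => f11
  | 0, 2 => f02
  | _, _ => fun _ _ => 0

/-- The core `η(x) ∫ φ(t) ζ(y + t x³) dt` of `N₁`. -/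
noncomputable def core1 (ζ : CPer p 2) : ℕ → ℕ → ℝ → ℝ → ℝ :=
  jetOf
    (fun x y => c.η x * avg c.φ (ζ.ext 0) (x ^ 3) y)
    (fun x y => deriv c.η x * avg c.φ (ζ.ext 0) (x ^ 3) y
      + c.η x * (3 * x ^ 2) * avg (fun t => t * c.φ t) (ζ.ext 1) (x ^ 3) y)
    (fun x y => c.η x * avg c.φ (ζ.ext 1) (x ^ 3) y)
    (fun x y => deriv (deriv c.η) x * avg c.φ (ζ.ext 0) (x ^ 3) y
      + (deriv c.η x * (6 * x ^ 2) + c.η x * (6 * x))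
        * avg (fun t => t * c.φ t) (ζ.ext 1) (x ^ 3) y
      + c.η x * (9 * x ^ 4) * avg (fun t => t * (t * c.φ t)) (ζ.ext 2) (x ^ 3) y)
    (fun x y => deriv c.η x * avg c.φ (ζ.ext 1) (x ^ 3) y
      + c.η x * (3 * x ^ 2) * avg (fun t => t * c.φ t) (ζ.ext 2) (x ^ 3) y)
    (fun x y => c.η x * avg c.φ (ζ.ext 2) (x ^ 3) y)

/-- Here `ζ` is twice differentiable, so no smoothing is needed to differentiate. The argument `x³`
is chosen so that the chain rule produces the factors `3 x²`, `6 x`, `9 x⁴`, all zero at `x = 0`: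
the core then has no normal derivatives of order one and two there. -/
theorem isJet_core1 : IsJet p (core1 c) := by
  have hφ := c.isKer_φ
  have hη := c.isCut_η
  refine ⟨fun ζ => ?_, fun ζ => ?_, fun ζ => ?_, fun ζ => ?_, ?_, fun ζ ξ => ?_, fun r ζ => ?_⟩
  · refine of_add_lt_two (fun x y => ?_) (fun x y => ?_) (fun x y => ?_)
    · refine ((hη.hasDerivAt x).mul (avg_ext_cube_dx hφ ζ (j := 0) (by norm_num) x y)).congr_deriv
        ?_
      simp only [core1, jetOf, zero_add]; ring
    · have h2 : HasDerivAt (fun x : ℝ => 3 * x ^ 2) (6 * x) x :=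
        ((hasDerivAt_pow 2 x).const_mul 3).congr_deriv (by norm_num; ring)
      refine (((hη.deriv.hasDerivAt x).mul
        (avg_ext_cube_dx hφ ζ (j := 0) (by norm_num) x y)).add
        (((hη.hasDerivAt x).mul h2).mul
          (avg_ext_cube_dx hφ.id_mul ζ (j := 1) (by norm_num) x y))).congr_deriv ?_
      simp only [core1, jetOf, zero_add, one_add_one_eq_two, Pi.mul_apply]; ring
    · refine ((hη.hasDerivAt x).mul (avg_ext_cube_dx hφ ζ (j := 1) (by norm_num) x y)).congr_deriv
        ?_
      simp only [core1, jetOf, zero_add, one_add_one_eq_two]; ring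
  · refine of_add_lt_two (fun x y => ?_) (fun x y => ?_) (fun x y => ?_)
    · exact (avg_ext_dy hφ ζ (j := 0) (by norm_num) (x ^ 3) y).const_mul (c.η x)
    · exact ((avg_ext_dy hφ ζ (j := 0) (by norm_num) (x ^ 3) y).const_mul _).add
        ((avg_ext_dy hφ.id_mul ζ (j := 1) (by norm_num) (x ^ 3) y).const_mul _)
    · exact (avg_ext_dy hφ ζ (j := 1) (by norm_num) (x ^ 3) y).const_mul (c.η x)
  · intro a b x
    unfold core1 jetOf
    split <;> simp only [avg_ext_match]
  · intro a b x y hx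
    unfold core1 jetOf
    split <;> simp only [hη.supp x hx, hη.deriv.supp x hx, hη.deriv.deriv.supp x hx, zero_mul, add_zero]
  · refine of_add_le_two ?_ ?_ ?_ ?_ ?_ ?_
    · exact HolBdd.avg_ext_cube hη hφ (by norm_num)
    · exact (HolBdd.avg_ext_cube hη.deriv hφ (by norm_num)).add
        (HolBdd.avg_ext_cube (hη.mul_right (by fun_prop)) hφ.id_mul (by norm_num))
    · exact HolBdd.avg_ext_cube hη hφ (by norm_num)
    · refine ((HolBdd.avg_ext_cube hη.deriv.deriv hφ (by norm_num)).add
        (HolBdd.avg_ext_cube ⟨?_, fun x hx => ?_⟩ hφ.id_mul (by norm_num))).add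
        (HolBdd.avg_ext_cube (hη.mul_right (by fun_prop)) hφ.id_mul.id_mul (by norm_num))
      · exact (hη.deriv.mul_right (by fun_prop)).smooth.add (hη.mul_right (by fun_prop)).smooth
      · simp only [hη.supp x hx, hη.deriv.supp x hx, zero_mul, add_zero]
    · exact (HolBdd.avg_ext_cube hη.deriv hφ (by norm_num)).add
        (HolBdd.avg_ext_cube (hη.mul_right (by fun_prop)) hφ.id_mul (by norm_num))
    · exact HolBdd.avg_ext_cube hη hφ (by norm_num)
  · intro a b x y
    unfold core1 jetOf
    split <;> simp only [avg_ext_add hφ, avg_ext_add hφ.id_mul, avg_ext_add hφ.id_mul.id_mul,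
      Nat.zero_le, le_refl, one_le_two, add_zero] <;> ring
  · intro a b x y
    unfold core1 jetOf
    split <;> simp only [avg_ext_smul] <;> ring

/-- The core `x η(x) ∫ φ(t) ζ(y + t x) dt` of `N₂`. -/
noncomputable def core2 (ζ : CPer p 1) : ℕ → ℕ → ℝ → ℝ → ℝ :=
  jetOf
    (fun x y => c.η x * (x * avg c.φ (ζ.ext 0) x y))
    (fun x y => deriv c.η x * (x * avg c.φ (ζ.ext 0) x y)
      + c.η x * -avg (fun t => t * deriv c.φ t) (ζ.ext 0) x y)
    (fun x y => c.η x * (x * avg c.φ (ζ.ext 1) x y))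
    (fun x y => deriv (deriv c.η) x * (x * avg c.φ (ζ.ext 0) x y)
      + deriv c.η x * (-2) * avg (fun t => t * deriv c.φ t) (ζ.ext 0) x y
      + c.η x * -avg (fun t => t * (t * deriv c.φ t)) (ζ.ext 1) x y)
    (fun x y => deriv c.η x * (x * avg c.φ (ζ.ext 1) x y)
      + c.η x * -avg (fun t => t * deriv c.φ t) (ζ.ext 1) x y)
    (fun x y => c.η x * -avg (deriv c.φ) (ζ.ext 1) x y)

theorem HolBdd.mul_avg_ext {k : ℕ} {ψ : ℝ → ℝ} {e : ℝ → ℝ} (he : IsCut p e) (hψ : IsKer ψ)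
    {j : ℕ} (hj : j ≤ k) :
    HolBdd p fun (ζ : CPer p k) x y => e x * (x * avg ψ (ζ.ext j) x y) :=
  (HolBdd.avg_ext (he.mul_right contDiff_id) hψ hj).congr fun _ _ _ => by simp only [id]; ring

theorem HolBdd.neg_avg_ext {k : ℕ} {ψ : ℝ → ℝ} {e : ℝ → ℝ} (he : IsCut p e) (hψ : IsKer ψ)
    {j : ℕ} (hj : j ≤ k) :
    HolBdd p fun (ζ : CPer p k) x y => e x * -avg ψ (ζ.ext j) x y :=
  (HolBdd.avg_ext (he.mul_right (contDiff_const (c := -1))) hψ hj).congr fun _ _ _ => by ring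

/-- With `ζ` of class `C^{1+α}`, one derivative may fall on `ζ`, and the factor `x` pays for the
other by `mul_avg_ext_ds` and `mul_avg_ext_dy`. -/
theorem isJet_core2 : IsJet p (core2 c) := by
  have hφ := c.isKer_φ
  have hη := c.isCut_η
  have hφ1 := hφ.deriv
  have hd := c.hasDerivAt_φ
  refine ⟨fun ζ => ?_, fun ζ => ?_, fun ζ => ?_, fun ζ => ?_, ?_, fun ζ ξ => ?_, fun r ζ => ?_⟩
  · refine of_add_lt_two (fun x y => ?_) (fun x y => ?_) (fun x y => ?_)
    · exact (hη.hasDerivAt x).mul (mul_avg_ext_ds hφ hφ1 hd ζ (j := 0) (by norm_num) x y)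
    · refine (((hη.deriv.hasDerivAt x).mul
        (mul_avg_ext_ds hφ hφ1 hd ζ (j := 0) (by norm_num) x y)).add
        ((hη.hasDerivAt x).mul
          (avg_ext_ds hφ1.id_mul ζ (j := 0) (by norm_num) x y).fun_neg)).congr_deriv ?_
      simp only [core2, jetOf, zero_add]; ring
    · exact (hη.hasDerivAt x).mul (mul_avg_ext_ds hφ hφ1 hd ζ (j := 1) (by norm_num) x y)
  · refine of_add_lt_two (fun x y => ?_) (fun x y => ?_) (fun x y => ?_)
    · exact ((avg_ext_dy hφ ζ (j := 0) (by norm_num) x y).const_mul x).const_mul (c.η x)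
    · exact (((avg_ext_dy hφ ζ (j := 0) (by norm_num) x y).const_mul x).const_mul _).add
        ((avg_ext_dy hφ1.id_mul ζ (j := 0) (by norm_num) x y).fun_neg.const_mul _)
    · exact (mul_avg_ext_dy hφ hφ1 hd ζ (j := 1) (by norm_num) x y).const_mul (c.η x)
  · intro a b x
    unfold core2 jetOf
    split <;> simp only [avg_ext_match]
  · intro a b x y hx
    unfold core2 jetOf
    split <;> simp only [hη.supp x hx, hη.deriv.supp x hx, hη.deriv.deriv.supp x hx, zero_mul, add_zero]
  · refine of_add_le_two ?_ ?_ ?_ ?_ ?_ ?_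
    · exact HolBdd.mul_avg_ext hη hφ (by norm_num)
    · exact (HolBdd.mul_avg_ext hη.deriv hφ (by norm_num)).add
        (HolBdd.neg_avg_ext hη hφ1.id_mul (by norm_num))
    · exact HolBdd.mul_avg_ext hη hφ (by norm_num)
    · exact ((HolBdd.mul_avg_ext hη.deriv.deriv hφ (by norm_num)).add
        (HolBdd.avg_ext (hη.deriv.mul_right contDiff_const) hφ1.id_mul (by norm_num))).add
        (HolBdd.neg_avg_ext hη hφ1.id_mul.id_mul (by norm_num))
    · exact (HolBdd.mul_avg_ext hη.deriv hφ (by norm_num)).add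
        (HolBdd.neg_avg_ext hη hφ1.id_mul (by norm_num))
    · exact HolBdd.neg_avg_ext hη hφ1 (by norm_num)
  · intro a b x y
    unfold core2 jetOf
    split <;> simp only [avg_ext_add hφ, avg_ext_add hφ1, avg_ext_add hφ1.id_mul,
      avg_ext_add hφ1.id_mul.id_mul, Nat.zero_le, le_refl, add_zero] <;> ring
  · intro a b x y
    unfold core2 jetOf
    split <;> simp only [avg_ext_smul] <;> ring

/-- The core `x² η(x) ∫ φ(t) ζ(y + t x) dt` of `4 N₃`. -/
noncomputable def core3 (ζ : CPer p 0) : ℕ → ℕ → ℝ → ℝ → ℝ :=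
  jetOf
    (fun x y => c.η x * (x * (x * avg c.φ (ζ.ext 0) x y)))
    (fun x y => deriv c.η x * (x * (x * avg c.φ (ζ.ext 0) x y))
      + c.η x * (x * avg c.φ (ζ.ext 0) x y)
      + c.η x * (-1) * (x * avg (fun t => t * deriv c.φ t) (ζ.ext 0) x y))
    (fun x y => c.η x * (-1) * (x * avg (deriv c.φ) (ζ.ext 0) x y))
    (fun x y => deriv (deriv c.η) x * (x * (x * avg c.φ (ζ.ext 0) x y))
      + deriv c.η x * 2 * (x * avg c.φ (ζ.ext 0) x y)
      + deriv c.η x * (-2) * (x * avg (fun t => t * deriv c.φ t) (ζ.ext 0) x y)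
      + c.η x * avg (fun t => t * (t * deriv (deriv c.φ) t)) (ζ.ext 0) x y)
    (fun x y => deriv c.η x * (-1) * (x * avg (deriv c.φ) (ζ.ext 0) x y)
      + c.η x * avg (fun t => t * deriv (deriv c.φ) t) (ζ.ext 0) x y)
    (fun x y => c.η x * avg (deriv (deriv c.φ)) (ζ.ext 0) x y)

theorem HolBdd.mul_mul_avg_ext {k : ℕ} {ψ : ℝ → ℝ} {e : ℝ → ℝ} (he : IsCut p e) (hψ : IsKer ψ)
    {j : ℕ} (hj : j ≤ k) :
    HolBdd p fun (ζ : CPer p k) x y => e x * (x * (x * avg ψ (ζ.ext j) x y)) :=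
  (HolBdd.mul_avg_ext (he.mul_right contDiff_id) hψ hj).congr fun _ _ _ => by simp only [id]; ring

/-- With `ζ` only Hölder continuous, no derivative may fall on it; each of the two factors `x` pays
for one, and all derivatives end on the kernel. -/
theorem isJet_core3 : IsJet p (core3 c) := by
  have hφ := c.isKer_φ
  have hη := c.isCut_η
  have hφ1 := hφ.deriv
  have hφ2 := hφ1.deriv
  have hd := c.hasDerivAt_φ
  have hd1 := c.hasDerivAt_deriv_φ
  have hd2 := IsKer.hasDerivAt_id_mul hd1
  have hk := hφ1.add hφ2.id_mul
  refine ⟨fun ζ => ?_, fun ζ => ?_, fun ζ => ?_, fun ζ => ?_, ?_, fun ζ ξ => ?_, fun r ζ => ?_⟩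
  · have e0 := fun x y => mul_avg_ext_ds hφ hφ1 hd ζ (j := 0) le_rfl x y
    refine of_add_lt_two (fun x y => ?_) (fun x y => ?_) (fun x y => ?_)
    · refine ((hη.hasDerivAt x).mul ((hasDerivAt_id' x).mul (e0 x y))).congr_deriv ?_
      simp only [core3, jetOf, zero_add, Pi.mul_apply]; ring
    · refine ((((hη.deriv.hasDerivAt x).mul ((hasDerivAt_id' x).mul (e0 x y))).add
        ((hη.hasDerivAt x).mul (e0 x y))).add (((hη.hasDerivAt x).mul_const (-1)).mul
          (mul_avg_ext_ds hφ1.id_mul hk hd2 ζ (j := 0) le_rfl x y))).congr_deriv ?_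
      -- The kernel `t φ'` has the derivative `φ' + t φ''`; the average is split accordingly, to
      -- match the entries of `core3`.
      have : (fun t => t * (deriv c.φ t + t * deriv (deriv c.φ) t))
          = fun t => t * deriv c.φ t + t * (t * deriv (deriv c.φ) t) := by funext t; ring
      rw [this, avg_ext_add_kernel hφ1.id_mul hφ2.id_mul.id_mul ζ le_rfl]
      simp only [core3, jetOf, one_add_one_eq_two, Pi.mul_apply]; ring
    · refine (((hη.hasDerivAt x).mul_const (-1)).mul
        (mul_avg_ext_ds hφ1 hφ2 hd1 ζ (j := 0) le_rfl x y)).congr_deriv ?_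
      simp only [core3, jetOf, zero_add]; ring
  · have e0 := fun x y => mul_avg_ext_dy hφ hφ1 hd ζ (j := 0) le_rfl x y
    refine of_add_lt_two (fun x y => ?_) (fun x y => ?_) (fun x y => ?_)
    · refine (((e0 x y).const_mul x).const_mul (c.η x)).congr_deriv ?_
      simp only [core3, jetOf, zero_add]; ring
    · refine (((((e0 x y).const_mul x).const_mul _).add ((e0 x y).const_mul _)).add
        ((mul_avg_ext_dy hφ1.id_mul hk hd2 ζ (j := 0) le_rfl x y).const_mul _)).congr_deriv ?_
      rw [avg_ext_add_kernel hφ1 hφ2.id_mul ζ le_rfl]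
      simp only [core3, jetOf, zero_add]; ring
    · refine ((mul_avg_ext_dy hφ1 hφ2 hd1 ζ (j := 0) le_rfl x y).const_mul _).congr_deriv ?_
      simp only [core3, jetOf, one_add_one_eq_two]; ring
  · intro a b x
    unfold core3 jetOf
    split <;> simp only [avg_ext_match]
  · intro a b x y hx
    unfold core3 jetOf
    split <;> simp only [hη.supp x hx, hη.deriv.supp x hx, hη.deriv.deriv.supp x hx, zero_mul, add_zero]
  · refine of_add_le_two ?_ ?_ ?_ ?_ ?_ ?_
    · exact HolBdd.mul_mul_avg_ext hη hφ le_rfl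
    · exact ((HolBdd.mul_mul_avg_ext hη.deriv hφ le_rfl).add
        (HolBdd.mul_avg_ext hη hφ le_rfl)).add
        (HolBdd.mul_avg_ext (hη.mul_right contDiff_const) hφ1.id_mul le_rfl)
    · exact HolBdd.mul_avg_ext (hη.mul_right contDiff_const) hφ1 le_rfl
    · exact (((HolBdd.mul_mul_avg_ext hη.deriv.deriv hφ le_rfl).add
        (HolBdd.mul_avg_ext (hη.deriv.mul_right contDiff_const) hφ le_rfl)).add
        (HolBdd.mul_avg_ext (hη.deriv.mul_right contDiff_const) hφ1.id_mul le_rfl)).add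
        (HolBdd.avg_ext hη hφ2.id_mul.id_mul le_rfl)
    · exact (HolBdd.mul_avg_ext (hη.deriv.mul_right contDiff_const) hφ1 le_rfl).add
        (HolBdd.avg_ext hη hφ2.id_mul le_rfl)
    · exact HolBdd.avg_ext hη hφ2 le_rfl
  · intro a b x y
    unfold core3 jetOf
    split <;> simp only [avg_ext_add hφ, avg_ext_add hφ1, avg_ext_add hφ1.id_mul,
      avg_ext_add hφ2, avg_ext_add hφ2.id_mul, avg_ext_add hφ2.id_mul.id_mul, le_refl, add_zero]
      <;> ring
  · intro a b x y
    unfold core3 jetOf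
    split <;> simp only [avg_ext_smul] <;> ring

end cores

end ThickFlame

namespace ThickFlame

/-! ### The lifting operator -/

section lifting

variable {p : Params} (c : Cutoffs p)

/-- For `x ≠ 0` the difference of indicators is the sign of `x`. At `x = 0` it is zero, so the
pointwise formula does not give the one-sided traces, and the inequality must be strict. -/
theorem N1_of_pos {f : ℝ → ℝ} {ζ : CPer p 2} (hf : ∀ y ∈ cell p, f y = ζ.d 0 y) {x : ℝ}
    (hx : 0 < x) (y : ℝ) : N1 c f x y = 1 / 2 * core1 c ζ 0 0 x y := by
  have h : sharp p f = ζ.ext 0 := funext (sharp_congr p hf)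
  simp only [N1, core1, jetOf, h, avg, indicator_of_mem (mem_Ici.2 hx.le),
    indicator_of_notMem (notMem_Iic.2 hx)]
  ring

theorem N1_of_neg {f : ℝ → ℝ} {ζ : CPer p 2} (hf : ∀ y ∈ cell p, f y = ζ.d 0 y) {x : ℝ}
    (hx : x < 0) (y : ℝ) : N1 c f x y = -(1 / 2 * core1 c ζ 0 0 x y) := by
  have h : sharp p f = ζ.ext 0 := funext (sharp_congr p hf)
  simp only [N1, core1, jetOf, h, avg, indicator_of_mem (mem_Iic.2 hx.le),
    indicator_of_notMem (notMem_Ici.2 hx)]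
  ring

theorem N2_of_pos {f : ℝ → ℝ} {ζ : CPer p 1} (hf : ∀ y ∈ cell p, f y = ζ.d 0 y) {x : ℝ}
    (hx : 0 < x) (y : ℝ) : N2 c f x y = core2 c ζ 0 0 x y := by
  have h : sharp p f = ζ.ext 0 := funext (sharp_congr p hf)
  simp only [N2, core2, jetOf, h, avg, abs_of_pos hx]
  ring

/-- Evenness of `φ` removes the absolute value inside the average; the one in front leaves the sign.
-/
theorem N2_of_neg {f : ℝ → ℝ} {ζ : CPer p 1} (hf : ∀ y ∈ cell p, f y = ζ.d 0 y) {x : ℝ}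
    (hx : x < 0) (y : ℝ) : N2 c f x y = -core2 c ζ 0 0 x y := by
  have h : sharp p f = ζ.ext 0 := funext (sharp_congr p hf)
  have h2 := avg_neg (g := ζ.ext 0) c.φ_even x y
  simp only [avg] at h2
  simp only [N2, core2, jetOf, h, avg, abs_of_neg hx, h2]
  ring

theorem N3_of_pos {f : ℝ → ℝ} {ζ : CPer p 0} (hf : ∀ y ∈ cell p, f y = ζ.d 0 y) {x : ℝ}
    (hx : 0 < x) (y : ℝ) : N3 c f x y = 1 / 4 * core3 c ζ 0 0 x y := by
  have h : sharp p f = ζ.ext 0 := funext (sharp_congr p hf)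
  simp only [N3, N2, core3, jetOf, h, avg, abs_of_pos hx]
  ring

theorem N3_of_neg {f : ℝ → ℝ} {ζ : CPer p 0} (hf : ∀ y ∈ cell p, f y = ζ.d 0 y) {x : ℝ}
    (hx : x < 0) (y : ℝ) : N3 c f x y = -(1 / 4 * core3 c ζ 0 0 x y) := by
  have h : sharp p f = ζ.ext 0 := funext (sharp_congr p hf)
  have h2 := avg_neg (g := ζ.ext 0) c.φ_even x y
  simp only [avg] at h2
  simp only [N3, N2, core3, jetOf, h, avg, abs_of_neg hx, h2]
  ring

/-! Boundary values of the cores. -/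

/-- Near `0` the cut-off is constant, so its derivatives drop out, and an average at `s = 0` is the
value of the function times the integral of the kernel. -/
theorem core1_zero {y : ℝ} (hy : y ∈ cell p) (ζ : CPer p 2) : core1 c ζ 0 0 0 y = ζ.d 0 y ∧ core1 c ζ 1 0 0 y = 0 ∧
    core1 c ζ 2 0 0 y = 0 ∧ core1 c ζ 0 2 0 y = ζ.d 2 y := by
  simp [core1, jetOf, avg_zero, c.φ_integral, c.η_zero, c.deriv_η_zero, c.deriv_deriv_η_zero,
    ζ.ext_of_mem _ hy]

/-- The normal derivative is `-(∫ t φ') ζ = ζ`. The second derivatives carry `∫ t² φ'` and `∫ φ'`,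
both zero, so this core does not disturb the conditions of second order. -/
theorem core2_zero {y : ℝ} (hy : y ∈ cell p) (ζ : CPer p 1) : core2 c ζ 0 0 0 y = 0 ∧ core2 c ζ 1 0 0 y = ζ.d 0 y ∧
    core2 c ζ 2 0 0 y = 0 ∧ core2 c ζ 0 2 0 y = 0 := by
  simp [core2, jetOf, avg_zero, c.integral_id_mul_deriv_φ, c.integral_sq_mul_deriv_φ,
    c.integral_deriv_φ, c.η_zero, c.deriv_η_zero, ζ.ext_of_mem _ hy]

/-- The second normal derivative comes from `∫ t² φ'' = 2`, the tangential one from `∫ φ'' = 0`. The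
value `2` and the jump between signs `±1` account for the weight `1/4` in `N₃`. -/
theorem core3_zero {y : ℝ} (hy : y ∈ cell p) (ζ : CPer p 0) : core3 c ζ 0 0 0 y = 0 ∧ core3 c ζ 1 0 0 y = 0 ∧
    core3 c ζ 2 0 0 y = 2 * ζ.d 0 y ∧ core3 c ζ 0 2 0 y = 0 := by
  simp [core3, jetOf, avg_zero, c.integral_deriv_deriv_φ, c.integral_sq_mul_deriv_deriv_φ,
    c.η_zero, c.deriv_η_zero, ζ.ext_of_mem _ hy]

/-- The lifting of a jet, with sign `ε i` on the piece `i` and centred at `x = x₀`. -/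
noncomputable def IsJet.lift {V : Type*} [NormedAddCommGroup V] [NormedSpace ℝ V]
    {f : V → ℕ → ℕ → ℝ → ℝ → ℝ} (hf : IsJet p f) (ε : Piece → ℝ) (hε : ∀ i, |ε i| ≤ 1) (x₀ : ℝ) :
    V →L[ℝ] X p 2 := (hf.exists_lift ε hε x₀).choose

theorem IsJet.lift_D {V : Type*} [NormedAddCommGroup V] [NormedSpace ℝ V]
    {f : V → ℕ → ℕ → ℝ → ℝ → ℝ} (hf : IsJet p f) (ε : Piece → ℝ) (hε : ∀ i, |ε i| ≤ 1) (x₀ : ℝ)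
    (v : V) {i : Piece} {a b : ℕ} (hab : a + b ≤ 2) {x y : ℝ} (hx : x ∈ i.reg.ivl p)
    (hy : y ∈ cell p) : (hf.lift ε hε x₀ v).D a b i x y = ε i * f v a b (x - x₀) y :=
  (hf.exists_lift ε hε x₀).choose_spec v i a b hab x hx y hy

/-- Sign of `x` on the pieces of the first component, and `0` on those of the second one. -/
def Piece.sgnZero1 : Piece → ℝ
  | .m1 => -1
  | .c1 => 1
  | .p1 => 1
  | .c2 => 0
  | .p2 => 0

/-- Sign of `x - R` on the pieces of the first component, and `0` on those of the second one. -/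
def Piece.sgnR1 : Piece → ℝ
  | .m1 => -1
  | .c1 => -1
  | .p1 => 1
  | .c2 => 0
  | .p2 => 0

/-- Sign of `x` on the pieces of the second component, and `0` on those of the first one. -/
def Piece.sgnZero2 : Piece → ℝ
  | .m1 => 0
  | .c1 => 0
  | .p1 => 0
  | .c2 => 1
  | .p2 => 1

/-- Sign of `x - R` on the pieces of the second component, and `0` on those of the first one. -/
def Piece.sgnR2 : Piece → ℝ
  | .m1 => 0
  | .c1 => 0
  | .p1 => 0
  | .c2 => -1
  | .p2 => 1

theorem Piece.abs_sgnZero1 (i : Piece) : |i.sgnZero1| ≤ 1 := by cases i <;> simp [Piece.sgnZero1]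
theorem Piece.abs_sgnR1 (i : Piece) : |i.sgnR1| ≤ 1 := by cases i <;> simp [Piece.sgnR1]
theorem Piece.abs_sgnZero2 (i : Piece) : |i.sgnZero2| ≤ 1 := by cases i <;> simp [Piece.sgnZero2]
theorem Piece.abs_sgnR2 (i : Piece) : |i.sgnR2| ≤ 1 := by cases i <;> simp [Piece.sgnR2]

noncomputable def Data.p2 (p : Params) (j : Fin 3) : Data p →L[ℝ] CPer p 2 :=
  (ContinuousLinearMap.proj j).comp ((ContinuousLinearMap.fst ℝ _ _).comp (DataSub p).subtypeL)

noncomputable def Data.p1 (p : Params) (j : Fin 5) : Data p →L[ℝ] CPer p 1 :=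
  (ContinuousLinearMap.proj j).comp ((ContinuousLinearMap.fst ℝ _ _).comp
    ((ContinuousLinearMap.snd ℝ _ _).comp (DataSub p).subtypeL))

noncomputable def Data.p0 (p : Params) (j : Fin 2) : Data p →L[ℝ] CPer p 0 :=
  (ContinuousLinearMap.proj j).comp ((ContinuousLinearMap.snd ℝ _ _).comp
    ((ContinuousLinearMap.snd ℝ _ _).comp (DataSub p).subtypeL))

/-- `h₇ - Le h₆ + Le² / (θ R) h₅`. -/
noncomputable def Data.w7 (p : Params) : Data p →L[ℝ] CPer p 1 :=
  Data.p1 p 4 - p.Le • Data.p1 p 3 + (p.Le ^ 2 / (p.θ * p.R)) • Data.p1 p 2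

/-- `h₈ - h₃ / Le` minus the second derivative of `h₁`. -/
noncomputable def Data.w8 (p : Params) : Data p →L[ℝ] CPer p 0 :=
  Data.p0 p 0 - (1 / p.Le) • (CPer.der p 0 (by norm_num)).comp (Data.p1 p 0)
    - (CPer.der p 2 (by norm_num)).comp (Data.p2 p 0)

/-- `h₉ - h₅ / (θ R)` minus the second derivative of `h₂`. -/
noncomputable def Data.w9 (p : Params) : Data p →L[ℝ] CPer p 0 :=
  Data.p0 p 1 - (1 / (p.θ * p.R)) • (CPer.der p 0 (by norm_num)).comp (Data.p1 p 2)
    - (CPer.der p 2 (by norm_num)).comp (Data.p2 p 1)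

theorem Data.w7_d (h : Data p) (y : ℝ) :
    (Data.w7 p h).d 0 y = h.fn 6 y - p.Le * h.fn 5 y + p.Le ^ 2 / (p.θ * p.R) * h.fn 4 y := by
  simp [Data.w7, CPer.d_add, CPer.sub_d, CPer.d_smul]; rfl

theorem Data.w8_d (h : Data p) {y : ℝ} (hy : y ∈ cell p) :
    (Data.w8 p h).d 0 y = h.fn 7 y - 1 / p.Le * h.fn 2 y - (h.1.1 0).d 2 y := by
  simp [Data.w8, CPer.sub_d, CPer.d_smul, CPer.der_d _ _ le_rfl hy]; rfl

theorem Data.w9_d (h : Data p) {y : ℝ} (hy : y ∈ cell p) :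
    (Data.w9 p h).d 0 y = h.fn 8 y - 1 / (p.θ * p.R) * h.fn 4 y - (h.1.1 1).d 2 y := by
  simp [Data.w9, CPer.sub_d, CPer.d_smul, CPer.der_d _ _ le_rfl hy]; rfl

/-- The lifting operator `𝓝`. -/
noncomputable def liftN : Data p →L[ℝ] X p 2 :=
  (1 / 2 : ℝ) • ((isJet_core1 c).lift _ Piece.abs_sgnZero1 0).comp (Data.p2 p 0)
  + (1 / 2 : ℝ) • ((isJet_core1 c).lift _ Piece.abs_sgnR1 p.R).comp (Data.p2 p 1)
  + (1 / (2 * p.Le)) • ((isJet_core2 c).lift _ Piece.abs_sgnZero1 0).comp (Data.p1 p 0)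
  + (1 / (2 * p.θ * p.R)) • ((isJet_core2 c).lift _ Piece.abs_sgnR1 p.R).comp (Data.p1 p 2)
  + (1 / 4 : ℝ) • ((isJet_core3 c).lift _ Piece.abs_sgnZero1 0).comp (Data.w8 p)
  + (1 / 4 : ℝ) • ((isJet_core3 c).lift _ Piece.abs_sgnR1 p.R).comp (Data.w9 p)
  + (1 / 2 : ℝ) • ((isJet_core1 c).lift _ Piece.abs_sgnR2 p.R).comp (Data.p2 p 2)
  + ((isJet_core2 c).lift _ Piece.abs_sgnZero2 0).comp (Data.p1 p 1)
  + (1 / 2 : ℝ) • ((isJet_core2 c).lift _ Piece.abs_sgnR2 p.R).comp (Data.w7 p)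

theorem liftN_D (h : Data p) {i : Piece} {a b : ℕ} (hab : a + b ≤ 2) {x y : ℝ}
    (hx : x ∈ i.reg.ivl p) (hy : y ∈ cell p) :
    (liftN c h).D a b i x y =
      1 / 2 * (i.sgnZero1 * core1 c (Data.p2 p 0 h) a b x y)
      + 1 / 2 * (i.sgnR1 * core1 c (Data.p2 p 1 h) a b (x - p.R) y)
      + 1 / (2 * p.Le) * (i.sgnZero1 * core2 c (Data.p1 p 0 h) a b x y)
      + 1 / (2 * p.θ * p.R) * (i.sgnR1 * core2 c (Data.p1 p 2 h) a b (x - p.R) y)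
      + 1 / 4 * (i.sgnZero1 * core3 c (Data.w8 p h) a b x y)
      + 1 / 4 * (i.sgnR1 * core3 c (Data.w9 p h) a b (x - p.R) y)
      + 1 / 2 * (i.sgnR2 * core1 c (Data.p2 p 2 h) a b (x - p.R) y)
      + i.sgnZero2 * core2 c (Data.p1 p 1 h) a b x y
      + 1 / 2 * (i.sgnR2 * core2 c (Data.w7 p h) a b (x - p.R) y) := by
  simp only [liftN, add_apply, smul_apply,
    ContinuousLinearMap.comp_apply, X.D_add, X.D_smul, IsJet.lift_D _ _ _ _ _ hab hx hy, sub_zero]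

/-- On the interior of a piece `x` and `x - R` have constant signs wherever the formula depends on
them, and these are the signs attached to the piece. On the interfaces the pieces take one-sided
limits, which the pointwise formula does not see. -/
theorem liftN_eq_lift (h : Data p) (i : Piece) {x : ℝ} (hx : x ∈ interior (i.reg.ivl p)) {y : ℝ}
    (hy : y ∈ cell p) : (liftN c h).D 0 0 i x y = lift c h i x y := by
  rw [liftN_D c h (by norm_num) (interior_subset hx) hy]
  have e0 : ∀ y ∈ cell p, h.fn 0 y = (Data.p2 p 0 h).d 0 y := fun _ _ => rfl
  have e1 : ∀ y ∈ cell p, h.fn 1 y = (Data.p2 p 1 h).d 0 y := fun _ _ => rfl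
  have e2 : ∀ y ∈ cell p, h.fn 2 y = (Data.p1 p 0 h).d 0 y := fun _ _ => rfl
  have e3 : ∀ y ∈ cell p, h.fn 3 y = (Data.p1 p 1 h).d 0 y := fun _ _ => rfl
  have e4 : ∀ y ∈ cell p, h.fn 4 y = (Data.p1 p 2 h).d 0 y := fun _ _ => rfl
  have e5 : ∀ y ∈ cell p, h.fn 5 y - p.Le / (p.θ * p.R) * h.fn 4 y = (Data.p2 p 2 h).d 0 y :=
    fun y hy => (h.2 y hy).symm
  have e7 := fun y (_ : y ∈ cell p) => (Data.w7_d h y).symm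
  have e8 := fun y hy => (Data.w8_d h (y := y) hy).symm
  have e9 := fun y hy => (Data.w9_d h (y := y) hy).symm
  have hR := p.R_pos
  cases i
  · have hx0 : x < 0 := by simpa [Piece.reg, Reg.ivl] using hx
    have hxR : x - p.R < 0 := by linarith
    simp only [lift, lift1, N1_of_neg c e0 hx0, N1_of_neg c e1 hxR, N2_of_neg c e2 hx0,
      N2_of_neg c e4 hxR, N3_of_neg c e8 hx0, N3_of_neg c e9 hxR, Piece.sgnZero1, Piece.sgnR1,
      Piece.sgnZero2, Piece.sgnR2]
    ring
  · have hx' : x ∈ Ioo 0 p.R := by simpa [Piece.reg, Reg.ivl] using hx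
    have hx0 := hx'.1
    have hxR : x - p.R < 0 := by linarith [hx'.2]
    simp only [lift, lift1, N1_of_pos c e0 hx0, N1_of_neg c e1 hxR, N2_of_pos c e2 hx0,
      N2_of_neg c e4 hxR, N3_of_pos c e8 hx0, N3_of_neg c e9 hxR, Piece.sgnZero1, Piece.sgnR1,
      Piece.sgnZero2, Piece.sgnR2]
    ring
  · have hx' : p.R < x := by simpa [Piece.reg, Reg.ivl] using hx
    have hx0 : 0 < x := by linarith
    have hxR : 0 < x - p.R := by linarith
    simp only [lift, lift1, N1_of_pos c e0 hx0, N1_of_pos c e1 hxR, N2_of_pos c e2 hx0,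
      N2_of_pos c e4 hxR, N3_of_pos c e8 hx0, N3_of_pos c e9 hxR, Piece.sgnZero1, Piece.sgnR1,
      Piece.sgnZero2, Piece.sgnR2]
    ring
  · have hx' : x ∈ Ioo 0 p.R := by simpa [Piece.reg, Reg.ivl] using hx
    have hx0 := hx'.1
    have hxR : x - p.R < 0 := by linarith [hx'.2]
    simp only [lift, lift2, N1_of_neg c e5 hxR, N2_of_pos c e3 hx0, N2_of_neg c e7 hxR,
      Piece.sgnZero1, Piece.sgnR1, Piece.sgnZero2, Piece.sgnR2]
    ring
  · have hx' : p.R < x := by simpa [Piece.reg, Reg.ivl] using hx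
    have hx0 : 0 < x := by linarith
    have hxR : 0 < x - p.R := by linarith
    simp only [lift, lift2, N1_of_pos c e5 hxR, N2_of_pos c e3 hx0, N2_of_pos c e7 hxR,
      Piece.sgnZero1, Piece.sgnR1, Piece.sgnZero2, Piece.sgnR2]
    ring

/-- The derivatives of the lifting on the line `x = 0`. -/
theorem liftN_D_zero (h : Data p) {i : Piece} (hi : (0 : ℝ) ∈ i.reg.ivl p) {y : ℝ}
    (hy : y ∈ cell p) :
    (liftN c h).D 0 0 i 0 y = 1 / 2 * (i.sgnZero1 * h.fn 0 y) ∧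
    (liftN c h).D 1 0 i 0 y = 1 / (2 * p.Le) * (i.sgnZero1 * h.fn 2 y)
      + i.sgnZero2 * h.fn 3 y ∧
    (liftN c h).D 2 0 i 0 y + (liftN c h).D 0 2 i 0 y =
      1 / 2 * (i.sgnZero1 * (h.fn 7 y - 1 / p.Le * h.fn 2 y)) := by
  -- On the line `x = 0` all blocks centred at `R` vanish, since the cut-off reaches only to
  -- distance `R/2`.
  have hR : p.R / 2 < |(0 : ℝ) - p.R| := by
    have := p.R_pos
    rw [zero_sub, abs_neg, abs_of_pos this]; linarith
  have e0 : (Data.p2 p 0 h).d 0 y = h.fn 0 y := rfl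
  have e2 : (Data.p1 p 0 h).d 0 y = h.fn 2 y := rfl
  have e3 : (Data.p1 p 1 h).d 0 y = h.fn 3 y := rfl
  have e8 := Data.w8_d h hy
  obtain ⟨a1, a2, a3, a4⟩ := core1_zero c hy (Data.p2 p 0 h)
  obtain ⟨b1, b2, b3, b4⟩ := core2_zero c hy (Data.p1 p 0 h)
  obtain ⟨d1, d2, d3, d4⟩ := core2_zero c hy (Data.p1 p 1 h)
  obtain ⟨f1, f2, f3, f4⟩ := core3_zero c hy (Data.w8 p h)
  refine ⟨?_, ?_, ?_⟩
  · rw [liftN_D c h (by norm_num) hi hy]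
    simp only [(isJet_core1 c).supp _ _ _ _ _ hR, (isJet_core2 c).supp _ _ _ _ _ hR,
      (isJet_core3 c).supp _ _ _ _ _ hR, a1, b1, d1, f1, e0]
    ring
  · rw [liftN_D c h (by norm_num) hi hy]
    simp only [(isJet_core1 c).supp _ _ _ _ _ hR, (isJet_core2 c).supp _ _ _ _ _ hR,
      (isJet_core3 c).supp _ _ _ _ _ hR, a2, b2, d2, f2, e2, e3]
    ring
  · rw [liftN_D c h (by norm_num) hi hy, liftN_D c h (by norm_num) hi hy]
    simp only [(isJet_core1 c).supp _ _ _ _ _ hR, (isJet_core2 c).supp _ _ _ _ _ hR,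
      (isJet_core3 c).supp _ _ _ _ _ hR, a3, b3, d3, f3, a4, b4, d4, f4, e8]
    -- This exhibits the tangential derivative of the first core as the `h₁''` subtracted in
    -- `Data.w8`, so that the two cancel.
    change _ + (_ * (_ * (h.1.1 0).d 2 y) + _ + _ + _ + _ + _ + _ + _ + _) = _
    ring

/-- The derivatives of the lifting on the line `x = R`. -/
theorem liftN_D_R (h : Data p) {i : Piece} (hi : p.R ∈ i.reg.ivl p) {y : ℝ}
    (hy : y ∈ cell p) :
    (liftN c h).D 0 0 i p.R y = 1 / 2 * (i.sgnR1 * h.fn 1 y)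
      + 1 / 2 * (i.sgnR2 * (h.fn 5 y - p.Le / (p.θ * p.R) * h.fn 4 y)) ∧
    (liftN c h).D 1 0 i p.R y = 1 / (2 * p.θ * p.R) * (i.sgnR1 * h.fn 4 y)
      + 1 / 2 * (i.sgnR2 * (h.fn 6 y - p.Le * h.fn 5 y + p.Le ^ 2 / (p.θ * p.R) * h.fn 4 y)) ∧
    (i.sgnR2 = 0 → (liftN c h).D 2 0 i p.R y + (liftN c h).D 0 2 i p.R y =
      1 / 2 * (i.sgnR1 * (h.fn 8 y - 1 / (p.θ * p.R) * h.fn 4 y))) := by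
  have hR : p.R / 2 < |p.R| := by
    have := p.R_pos
    rw [abs_of_pos this]; linarith
  have e1 : (Data.p2 p 1 h).d 0 y = h.fn 1 y := rfl
  have e4 : (Data.p1 p 2 h).d 0 y = h.fn 4 y := rfl
  have e5 : (Data.p2 p 2 h).d 0 y = h.fn 5 y - p.Le / (p.θ * p.R) * h.fn 4 y := h.2 y hy
  have e7 := Data.w7_d h y
  have e9 := Data.w9_d h hy
  obtain ⟨a1, a2, a3, a4⟩ := core1_zero c hy (Data.p2 p 1 h)
  obtain ⟨a1', a2', a3', a4'⟩ := core1_zero c hy (Data.p2 p 2 h)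
  obtain ⟨b1, b2, b3, b4⟩ := core2_zero c hy (Data.p1 p 2 h)
  obtain ⟨d1, d2, d3, d4⟩ := core2_zero c hy (Data.w7 p h)
  obtain ⟨f1, f2, f3, f4⟩ := core3_zero c hy (Data.w9 p h)
  refine ⟨?_, ?_, fun hs => ?_⟩
  · rw [liftN_D c h (by norm_num) hi hy]
    simp only [(isJet_core1 c).supp _ _ _ _ _ hR, (isJet_core2 c).supp _ _ _ _ _ hR,
      (isJet_core3 c).supp _ _ _ _ _ hR, sub_self, a1, a1', b1, d1, f1, e1, e5]
    ring
  · rw [liftN_D c h (by norm_num) hi hy]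
    simp only [(isJet_core1 c).supp _ _ _ _ _ hR, (isJet_core2 c).supp _ _ _ _ _ hR,
      (isJet_core3 c).supp _ _ _ _ _ hR, sub_self, a2, a2', b2, d2, f2, e4, e7]
    ring
  · rw [liftN_D c h (by norm_num) hi hy, liftN_D c h (by norm_num) hi hy]
    simp only [(isJet_core1 c).supp _ _ _ _ _ hR, (isJet_core2 c).supp _ _ _ _ _ hR,
      (isJet_core3 c).supp _ _ _ _ _ hR, sub_self, a3, b3, d3, f3, a4, b4, d4, f4, e9, hs]
    change _ + (_ + _ * (_ * (h.1.1 1).d 2 y) + _ + _ + _ + _ + _ + _ + _) = _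
    ring

/-- The opposite weights `±1/2` at `R` make the mean of the two traces of `ζ` zero, so the modified
fifth entry reads only `θ R [ζ_x]_R = h₅`; with the trace at `R⁺` an extra `h₂ / 2` would appear.
Then `[υ]_R` is fixed by `h₆` and `[ζ_x]_R`, `[υ_x]_R` by `h₇` and `[υ]_R`, and the jumps of `Δζ` by
`h₈`, `h₉` minus the jumps of `ζ_x`. -/
theorem Bs_liftN (h : Data p) : Bs p (liftN c h) = h := by
  refine Data.ext_fn fun j y hy => ?_
  rw [Bs_fn _ j hy]
  have hθ := p.θ_pos.ne'
  have hR := p.R_pos.ne'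
  have hL := p.Le_pos.ne'
  obtain ⟨m1, m2, m3⟩ := liftN_D_zero c h (zero_mem_ivl_m1 p) hy
  obtain ⟨c1, c2, c3⟩ := liftN_D_zero c h (zero_mem_ivl_c1 p) hy
  obtain ⟨d1, d2, -⟩ := liftN_D_zero c h (zero_mem_ivl_c2 p) hy
  obtain ⟨e1, e2, e3⟩ := liftN_D_R c h (R_mem_ivl_c1 p) hy
  obtain ⟨f1, f2, f3⟩ := liftN_D_R c h (R_mem_ivl_p1 p) hy
  obtain ⟨g1, g2, -⟩ := liftN_D_R c h (R_mem_ivl_c2 p) hy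
  obtain ⟨q1, q2, -⟩ := liftN_D_R c h (R_mem_ivl_p2 p) hy
  replace e3 := e3 rfl
  replace f3 := f3 rfl
  simp only [Piece.sgnZero1, Piece.sgnZero2, Piece.sgnR1, Piece.sgnR2] at *
  fin_cases j <;> simp [Bstar, Bop, B0, Lop, *] <;> field_simp <;> ring

end lifting

end ThickFlame

namespace ThickFlame

/-! ### Analytic perturbations of the identity -/

section analytic

variable {E F G H : Type*} [NormedAddCommGroup E] [NormedSpace ℝ E] [NormedAddCommGroup F]
  [NormedSpace ℝ F] [NormedAddCommGroup G] [NormedSpace ℝ G] [NormedAddCommGroup H]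
  [NormedSpace ℝ H]

/-- Analytic maps which vanish at `0`. -/
structure Van (f : E → F) : Prop where
  smooth : ContDiff ℝ ω f
  zero : f 0 = 0

/-- Analytic maps which vanish at `0` together with their derivative. -/
structure Quad (f : E → F) : Prop extends Van f where
  deriv : HasFDerivAt f (0 : E →L[ℝ] F) 0

theorem Van.of_clm (L : E →L[ℝ] F) : Van fun x => L x := ⟨L.contDiff, map_zero L⟩

theorem Van.add {f g : E → F} (hf : Van f) (hg : Van g) : Van fun x => f x + g x :=
  ⟨hf.smooth.add hg.smooth, by rw [hf.zero, hg.zero, add_zero]⟩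

theorem Van.sub {f g : E → F} (hf : Van f) (hg : Van g) : Van fun x => f x - g x :=
  ⟨hf.smooth.sub hg.smooth, by rw [hf.zero, hg.zero, sub_zero]⟩

theorem Van.smul {f : E → F} (hf : Van f) (r : ℝ) : Van fun x => r • f x :=
  ⟨contDiff_const.smul hf.smooth, by rw [hf.zero, smul_zero]⟩

/-- By the product rule each term of the derivative at `0` contains the value of the other factor,
which is zero. -/
theorem Van.bilin {f : E → F} {g : E → G} (hf : Van f) (hg : Van g) (B : F →L[ℝ] G →L[ℝ] H) :
    Quad fun x => B (f x) (g x) := by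
  refine ⟨⟨B.isBoundedBilinearMap.contDiff.comp (hf.smooth.prodMk hg.smooth), ?_⟩, ?_⟩
  · rw [hf.zero, hg.zero, map_zero]
  · have h1 := (hf.smooth.differentiable (by simp) 0).hasFDerivAt
    have h2 := (hg.smooth.differentiable (by simp) 0).hasFDerivAt
    have h3 := B.hasFDerivAt_of_bilinear h1 h2
    refine h3.congr_fderiv ?_
    ext x
    simp [hf.zero, hg.zero]

theorem Quad.add {f g : E → F} (hf : Quad f) (hg : Quad g) : Quad fun x => f x + g x :=
  ⟨hf.toVan.add hg.toVan, by simpa using! hf.deriv.add hg.deriv⟩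

theorem Quad.sub {f g : E → F} (hf : Quad f) (hg : Quad g) : Quad fun x => f x - g x :=
  ⟨hf.toVan.sub hg.toVan, by simpa using! hf.deriv.sub hg.deriv⟩

theorem Quad.smul {f : E → F} (hf : Quad f) (r : ℝ) : Quad fun x => r • f x :=
  ⟨hf.toVan.smul r, by simpa using! hf.deriv.const_smul r⟩

theorem Quad.prodMk {f : E → F} {g : E → G} (hf : Quad f) (hg : Quad g) :
    Quad fun x => (f x, g x) :=
  ⟨⟨hf.smooth.prodMk hg.smooth, by rw [hf.zero, hg.zero]; rfl⟩, hf.deriv.prodMk hg.deriv⟩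

theorem Quad.comp_clm {f : E → F} (hf : Quad f) (L : G →L[ℝ] E) : Quad fun x => f (L x) :=
  ⟨⟨hf.smooth.comp L.contDiff, by rw [map_zero, hf.zero]⟩, by
    have h : HasFDerivAt f (0 : E →L[ℝ] F) (L 0) := by rw [map_zero]; exact hf.deriv
    simpa using! h.comp (0 : G) L.hasFDerivAt⟩

/-- The equation `k + q(v, k) = 0` with `q` of second order has near `0` exactly the solutions
`k = h(v)`, where `h` is analytic. -/
theorem Quad.exists_solution [CompleteSpace E] [CompleteSpace F] {q : E × F → F} (hq : Quad q) :
    ∃ ρ > 0, ∃ σ > 0, ∃ h : E → F, ContDiffOn ℝ ω h (Metric.ball 0 σ) ∧ h 0 = 0 ∧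
      (∀ v ∈ Metric.ball (0 : E) σ, h v ∈ Metric.ball (0 : F) ρ) ∧
      ∀ v ∈ Metric.ball (0 : E) σ, ∀ k ∈ Metric.ball (0 : F) ρ,
        (k + q (v, k) = 0 ↔ k = h v) := by
  -- Keeping the parameter `v` as a first component turns the implicit equation into a local
  -- inversion near `0`, with the identity as derivative.
  let Ψ : E × F → E × F := fun z => (z.1, z.2 + q z)
  have hΨ : ContDiff ℝ ω Ψ := contDiff_fst.prodMk (contDiff_snd.add hq.smooth)
  have hΨd : HasFDerivAt Ψ
      (ContinuousLinearEquiv.refl ℝ (E × F) : (E × F) →L[ℝ] (E × F)) 0 := by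
    have h1 : HasFDerivAt Ψ _ 0 := (hasFDerivAt_fst (𝕜 := ℝ) (p := (0 : E × F))).prodMk
      ((hasFDerivAt_snd (𝕜 := ℝ) (p := (0 : E × F))).add hq.deriv)
    refine h1.congr_fderiv ?_
    ext x <;> simp
  have hω : (ω : WithTop ℕ∞) ≠ 0 := by simp
  have hΨ0 : Ψ 0 = 0 := by simp [Ψ, hq.zero]
  set e := hΨ.contDiffAt.toOpenPartialHomeomorph Ψ hΨd hω with he
  have hee : ∀ z, e z = Ψ z := fun z => rfl
  have h0s : (0 : E × F) ∈ e.source :=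
    hΨ.contDiffAt.mem_toOpenPartialHomeomorph_source hΨd hω
  have h0t : (0 : E × F) ∈ e.target := by
    have := hΨ.contDiffAt.image_mem_toOpenPartialHomeomorph_target hΨd hω
    rwa [hΨ0] at this
  have hsymm0 : e.symm 0 = 0 := by
    have := e.left_inv h0s
    rwa [hee, hΨ0] at this
  have hsm : ContDiffAt ℝ ω e.symm 0 := by
    have := hΨ.contDiffAt.to_localInverse hΨd hω
    rwa [hΨ0] at this
  set h : E → F := fun v => (e.symm (v, 0)).2 with hh
  have hi : ContDiff ℝ ω fun v : E => (v, (0 : F)) := contDiff_id.prodMk contDiff_const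
  have hhsm : ContDiffAt ℝ ω h 0 :=
    contDiff_snd.contDiffAt.comp (0 : E) (hsm.comp (0 : E) hi.contDiffAt)
  have hh0 : h 0 = 0 := by simp only [hh]; rw [← Prod.zero_eq_mk, hsymm0]; rfl
  obtain ⟨ρ, hρ, hρs⟩ := Metric.mem_nhds_iff.1 (e.open_source.mem_nhds h0s)
  have ht : ∀ᶠ v in 𝓝 (0 : E), (v, (0 : F)) ∈ e.target :=
    hi.continuous.continuousAt.eventually (e.open_target.mem_nhds h0t)
  have hb : ∀ᶠ v in 𝓝 (0 : E), h v ∈ Metric.ball (0 : F) ρ :=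
    hhsm.continuousAt.eventually (by rw [hh0]; exact Metric.ball_mem_nhds _ hρ)
  -- Analyticity at `0` holds on a whole neighbourhood, whereas being `C^∞` at the point gives only
  -- neighbourhoods depending on the order. This is why the argument runs in class `ω`. Requiring
  -- also `‖v‖ < ρ` puts `(v, k)` in the `ρ`-ball of the product.
  obtain ⟨σ, hσ, hσs⟩ := Metric.eventually_nhds_iff_ball.1
    ((ht.and hb).and ((hhsm.eventually (by simp)).and (Metric.ball_mem_nhds (0 : E) hρ)))
  refine ⟨ρ, hρ, σ, hσ, h, fun v hv => ((hσs v hv).2.1).contDiffWithinAt, hh0,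
    fun v hv => (hσs v hv).1.2, fun v hv k hk => ?_⟩
  have hvt := (hσs v hv).1.1
  have hvk : (v, k) ∈ e.source := hρs (max_lt (hσs v hv).2.2 hk)
  have h1 : (e.symm (v, 0)).1 = v := by
    have := congrArg Prod.fst (e.right_inv hvt)
    simpa [hee, Ψ] using this
  -- On the source, `Ψ (v, k) = (v, 0)` and `(v, k) = e.symm (v, 0)` are equivalent, which yields
  -- both existence and uniqueness of `k`.
  have h2 := e.eq_symm_apply hvk hvt
  rw [hee] at h2
  constructor
  · intro hk0
    have := h2.2 (by simp only [Ψ, hk0])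
    exact congrArg Prod.snd this
  · intro hkh
    have : (v, k) = e.symm (v, 0) := Prod.ext h1.symm hkh
    exact congrArg Prod.snd (h2.1 this)

end analytic

end ThickFlame

namespace ThickFlame

/-! ### The nonlinear boundary conditions in polynomial form -/

section nonlinear

variable {p : Params}

/-- The completion of `X_{2+α}`; traces extend to it. -/
abbrev XHat (p : Params) : Type := UniformSpace.Completion (X p 2)

/-- The embedding of `X_{2+α}` into its completion. -/
noncomputable def toHat (p : Params) : X p 2 →L[ℝ] XHat p := UniformSpace.Completion.toComplL

/-- The extension of a continuous linear map on `X_{2+α}` to the completion. -/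
noncomputable def hat {F : Type*} [NormedAddCommGroup F] [NormedSpace ℝ F] [CompleteSpace F]
    (f : X p 2 →L[ℝ] F) : XHat p →L[ℝ] F := f.extend (toHat p)

theorem hat_toHat {F : Type*} [NormedAddCommGroup F] [NormedSpace ℝ F] [CompleteSpace F]
    (f : X p 2 →L[ℝ] F) (u : X p 2) : hat f (toHat p u) = f u :=
  ContinuousLinearMap.extend_eq f UniformSpace.Completion.denseRange_coe
    (UniformSpace.Completion.isUniformInducing_coe _) u

theorem norm_toHat (u : X p 2) : ‖toHat p u‖ = ‖u‖ := UniformSpace.Completion.norm_coe u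

/-- The trace of `D_x^a D_y^b u`, extended to the completion. -/
noncomputable def X.tH (i : Piece) {x : ℝ} (hx : x ∈ i.reg.ivl p) (a b m : ℕ) (h : a + b + m ≤ 2) :
    XHat p →L[ℝ] CPer p m := hat (X.tD i hx a b m h)

theorem X.tH_d (i : Piece) {x : ℝ} (hx : x ∈ i.reg.ivl p) {a b m : ℕ} (h : a + b + m ≤ 2)
    (u : X p 2) {y : ℝ} (hy : y ∈ cell p) :
    (X.tH i hx a b m h (toHat p u)).d 0 y = u.D a b i x y := by
  rw [X.tH, hat_toHat, X.tD_d i hx h u hy]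

/-- The product in `C_♯^α`. -/
noncomputable def CPer.mul0 (f g : CPer p 0) : CPer p 0 := CPer.mulL p zero_le_one f g

/-- The product in `C_♯^{1+α}`. -/
noncomputable def CPer.mul1 (f g : CPer p 1) : CPer p 1 := CPer.mulL p le_rfl f g

theorem CPer.mul0_d (f g : CPer p 0) {y : ℝ} (hy : y ∈ cell p) :
    (f.mul0 g).d 0 y = f.d 0 y * g.d 0 y := CPer.mulL_d _ f g hy

theorem CPer.mul1_d (f g : CPer p 1) {y : ℝ} (hy : y ∈ cell p) :
    (f.mul1 g).d 0 y = f.d 0 y * g.d 0 y := CPer.mulL_d _ f g hy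

section

variable {E : Type*} [NormedAddCommGroup E] [NormedSpace ℝ E]

theorem Van.mul0 {f g : E → CPer p 0} (hf : Van f) (hg : Van g) :
    Quad fun x => (f x).mul0 (g x) := hf.bilin hg (CPer.mulL p zero_le_one)

theorem Van.mul1 {f g : E → CPer p 1} (hf : Van f) (hg : Van g) :
    Quad fun x => (f x).mul1 (g x) := hf.bilin hg (CPer.mulL p le_rfl)

end

/-- With `dR`, `d0` the deviations of the normalized denominators of `Λ` from `1` and `nR`, `n0`
its numerators, the remainder of the compatibility condition at an interface after multiplication
by the denominators. -/
noncomputable def compatRem (A B D2 D3 : ℝ) (dR d0 nR n0 r ry ryy jx jxy jxx k : CPer p 0) :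
    CPer p 0 :=
  let f1 := D2 • r + jx
  let f2 := ryy.mul0 f1 + D2 • ry.mul0 ry + (2 : ℝ) • ry.mul0 jxy
    - (ry.mul0 ry).mul0 (D3 • r + jxx)
  dR.mul0 k + d0.mul0 k + (dR.mul0 d0).mul0 k
    + (A • (nR + nR.mul0 d0) - B • (n0 + n0.mul0 dR)).mul0 f1
    - (f2 + dR.mul0 f2 + d0.mul0 f2 + (dR.mul0 d0).mul0 f2)

theorem compatRem_quad {E : Type*} [NormedAddCommGroup E] [NormedSpace ℝ E] (A B D2 D3 : ℝ)
    {dR d0 nR n0 r ry ryy jx jxy jxx k : E → CPer p 0} (hdR : Van dR) (hd0 : Van d0)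
    (hnR : Van nR) (hn0 : Van n0) (hr : Van r) (hry : Van ry) (hryy : Van ryy) (hjx : Van jx)
    (hjxy : Van jxy) (hjxx : Van jxx) (hk : Van k) :
    Quad fun z => compatRem A B D2 D3 (dR z) (d0 z) (nR z) (n0 z) (r z) (ry z) (ryy z) (jx z)
      (jxy z) (jxx z) (k z) := by
  have hf1 : Van fun z => D2 • r z + jx z := (hr.smul D2).add hjx
  have hf2 : Quad fun z => (ryy z).mul0 (D2 • r z + jx z) + D2 • (ry z).mul0 (ry z)
      + (2 : ℝ) • (ry z).mul0 (jxy z) - ((ry z).mul0 (ry z)).mul0 (D3 • r z + jxx z) :=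
    (((hryy.mul0 hf1).add ((hry.mul0 hry).smul D2)).add ((hry.mul0 hjxy).smul 2)).sub
      ((hry.mul0 hry).toVan.mul0 ((hr.smul D3).add hjxx))
  have hd := (hdR.mul0 hd0).toVan
  have hA := ((hnR.add (hnR.mul0 hd0).toVan).smul A).sub ((hn0.add (hn0.mul0 hdR).toVan).smul B)
  exact ((((hdR.mul0 hk).add (hd0.mul0 hk)).add (hd.mul0 hk)).add (hA.mul0 hf1)).sub
    (((hf2.add (hdR.mul0 hf2.toVan)).add (hd0.mul0 hf2.toVan)).add (hd.mul0 hf2.toVan))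

/-- This is the compatibility condition multiplied by both normalized denominators `1 + dR` and `1 +
d0`; once it is expanded, `k` is the only term that is linear in `k` alone, and all the rest is of
second order. -/
theorem compatRem_d (A B D2 D3 : ℝ) (dR d0 nR n0 r ry ryy jx jxy jxx k : CPer p 0) {y : ℝ}
    (hy : y ∈ cell p) :
    (k + compatRem A B D2 D3 dR d0 nR n0 r ry ryy jx jxy jxx k).d 0 y =
      (1 + dR.d 0 y) * (1 + d0.d 0 y) * (k.d 0 y
        - (ryy.d 0 y * (D2 * r.d 0 y + jx.d 0 y) + D2 * ry.d 0 y ^ 2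
          + 2 * ry.d 0 y * jxy.d 0 y - ry.d 0 y ^ 2 * (D3 * r.d 0 y + jxx.d 0 y)))
      + (A * nR.d 0 y * (1 + d0.d 0 y) - B * n0.d 0 y * (1 + dR.d 0 y))
        * (D2 * r.d 0 y + jx.d 0 y) := by
  simp only [compatRem, CPer.d_add, CPer.sub_d, CPer.d_smul, CPer.mul0_d _ _ hy]
  ring

/-! The traces at `x = R⁺` of the first and at `x = 0⁺` of the second component. -/

/-- The trace of `D_x^a D_y^b ζ` at `R⁺`. -/
noncomputable def zT (p : Params) (a b : ℕ) (h : a + b + 0 ≤ 2) : XHat p →L[ℝ] CPer p 0 :=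
  X.tH .p1 (R_mem_ivl_p1 p) a b 0 h

/-- The trace of `D_x^a D_y^b υ` at `0⁺`. -/
noncomputable def wT (p : Params) (a b : ℕ) (h : a + b + 0 ≤ 2) : XHat p →L[ℝ] CPer p 0 :=
  X.tH .c2 (zero_mem_ivl_c2 p) a b 0 h

/-- The deviation from `1` of the denominator of `Λ_R`, divided by `θ`. -/
noncomputable def denR (u : XHat p) : CPer p 0 :=
  (-p.θ⁻¹) • (zT p 0 0 (by norm_num) u + zT p 1 0 (by norm_num) u)

/-- The deviation from `1` of the denominator of `Λ₀`, divided by `Le²`. -/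
noncomputable def denZero (u : XHat p) : CPer p 0 :=
  p.R • wT p 0 0 (by norm_num) u + (p.R / p.Le) • wT p 1 0 (by norm_num) u

/-- The numerator of `Λ_R`. -/
noncomputable def numR (u : XHat p) : CPer p 0 :=
  let z00 := zT p 0 0 (by norm_num) u
  let z10 := zT p 1 0 (by norm_num) u
  let z01 := zT p 0 1 (by norm_num) u
  let z20 := zT p 2 0 (by norm_num) u
  let z11 := zT p 1 1 (by norm_num) u
  let z02 := zT p 0 2 (by norm_num) u
  z10 + (z20 + z02) - p.θ⁻¹ • z02.mul0 z10 - (2 * p.θ⁻¹) • z01.mul0 z11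
    + (p.θ ^ 2)⁻¹ • ((z01.mul0 z01).mul0 (z20 - z00) - p.θ • z01.mul0 z01)
    - p.θ⁻¹ • z00.mul0 z02

/-- The numerator of `Λ₀`. -/
noncomputable def numZero (u : XHat p) : CPer p 0 :=
  let w00 := wT p 0 0 (by norm_num) u
  let w10 := wT p 1 0 (by norm_num) u
  let w01 := wT p 0 1 (by norm_num) u
  let w20 := wT p 2 0 (by norm_num) u
  let w11 := wT p 1 1 (by norm_num) u
  let w02 := wT p 0 2 (by norm_num) u
  p.Le • w10 + (w20 + w02)
    + (p.R * p.Le⁻¹) • (w02.mul0 (p.Le • w00 + w10) + (2 : ℝ) • w01.mul0 w11)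
    + (p.R ^ 2 * (p.Le ^ 2)⁻¹) • ((w01.mul0 w01).mul0 (w20 - p.Le ^ 2 • w00)
      + (p.R⁻¹ * p.Le ^ 2) • w01.mul0 w01)

theorem denR_van : Van (denR (p := p)) :=
  ((Van.of_clm (zT p 0 0 _)).add (Van.of_clm (zT p 1 0 _))).smul _

theorem denZero_van : Van (denZero (p := p)) :=
  ((Van.of_clm (wT p 0 0 _)).smul _).add ((Van.of_clm (wT p 1 0 _)).smul _)

theorem numR_van : Van (numR (p := p)) := by
  have h := fun a b h => Van.of_clm (zT p a b h)
  have h00 := h 0 0 (by norm_num)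
  have h10 := h 1 0 (by norm_num)
  have h01 := h 0 1 (by norm_num)
  have h20 := h 2 0 (by norm_num)
  have h11 := h 1 1 (by norm_num)
  have h02 := h 0 2 (by norm_num)
  exact ((((h10.add (h20.add h02)).sub ((h02.mul0 h10).toVan.smul _)).sub
    ((h01.mul0 h11).toVan.smul _)).add
    ((((h01.mul0 h01).toVan.mul0 (h20.sub h00)).toVan.sub ((h01.mul0 h01).toVan.smul _)).smul
      _)).sub ((h00.mul0 h02).toVan.smul _)

theorem numZero_van : Van (numZero (p := p)) := by
  have h := fun a b h => Van.of_clm (wT p a b h)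
  have h00 := h 0 0 (by norm_num)
  have h10 := h 1 0 (by norm_num)
  have h01 := h 0 1 (by norm_num)
  have h20 := h 2 0 (by norm_num)
  have h11 := h 1 1 (by norm_num)
  have h02 := h 0 2 (by norm_num)
  exact (((h10.smul _).add (h20.add h02)).add (((h02.mul0 ((h00.smul _).add h10)).toVan.add
    ((h01.mul0 h11).toVan.smul _)).smul _)).add
    ((((h01.mul0 h01).toVan.mul0 (h20.sub (h00.smul _))).toVan.add
      ((h01.mul0 h01).toVan.smul _)).smul _)

/-- The four entries of the data which may be different from zero on the nonlinear set. -/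
abbrev Corr (p : Params) : Type := CPer p 1 × CPer p 1 × CPer p 0 × CPer p 0

/-- The entries of class `C_♯^{1+α}` of the data given by corrections. -/
noncomputable def corrIncl1 (p : Params) : Corr p →L[ℝ] (Fin 5 → CPer p 1) :=
  ContinuousLinearMap.pi ![0, ContinuousLinearMap.fst ℝ _ _, 0, 0,
    (ContinuousLinearMap.fst ℝ _ _).comp (ContinuousLinearMap.snd ℝ _ _)]

/-- The entries of class `C_♯^α` of the data given by corrections. -/
noncomputable def corrIncl0 (p : Params) : Corr p →L[ℝ] (Fin 2 → CPer p 0) :=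
  ContinuousLinearMap.pi ![
    (ContinuousLinearMap.fst ℝ _ _).comp
      ((ContinuousLinearMap.snd ℝ _ _).comp (ContinuousLinearMap.snd ℝ _ _)),
    (ContinuousLinearMap.snd ℝ _ _).comp
      ((ContinuousLinearMap.snd ℝ _ _).comp (ContinuousLinearMap.snd ℝ _ _))]

theorem corrIncl1_apply (k : Corr p) (j : Fin 5) :
    corrIncl1 p k j = ![0, k.1, 0, 0, k.2.1] j := by
  fin_cases j <;> rfl

theorem corrIncl0_apply (k : Corr p) (j : Fin 2) : corrIncl0 p k j = ![k.2.2.1, k.2.2.2] j := by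
  fin_cases j <;> rfl

/-- The entries `h₅`, `h₆` and their combination of class `C^{2+α}` are all zero, so the constraint
holds trivially. -/
theorem corrIncl_mem (k : Corr p) :
    ((0 : Corr p →L[ℝ] (Fin 3 → CPer p 2)).prod ((corrIncl1 p).prod (corrIncl0 p))) k
      ∈ DataSub p := by
  intro y _
  simp [CPer.zero_d, corrIncl1_apply]

/-- The inclusion of the corrections into the data. -/
noncomputable def corrIncl (p : Params) : Corr p →L[ℝ] Data p :=
  ((0 : Corr p →L[ℝ] (Fin 3 → CPer p 2)).prod
    ((corrIncl1 p).prod (corrIncl0 p))).codRestrict (DataSub p) corrIncl_mem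

theorem corrIncl_coe (k : Corr p) :
    (corrIncl p k).1 = ((0 : Fin 3 → CPer p 2), corrIncl1 p k, corrIncl0 p k) := rfl

/-- The projection of the data to the corrections. -/
noncomputable def corrProj (p : Params) : Data p →L[ℝ] Corr p :=
  (Data.p1 p 1).prod ((Data.p1 p 4).prod ((Data.p0 p 0).prod (Data.p0 p 1)))

theorem corrIncl_fst (k : Corr p) (j : Fin 3) : (corrIncl p k).1.1 j = 0 := by
  rw [corrIncl_coe]; rfl

theorem corrIncl_snd (k : Corr p) (j : Fin 5) :
    (corrIncl p k).1.2.1 j = ![0, k.1, 0, 0, k.2.1] j := by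
  rw [corrIncl_coe, ← corrIncl1_apply]

theorem corrIncl_thd (k : Corr p) (j : Fin 2) :
    (corrIncl p k).1.2.2 j = ![k.2.2.1, k.2.2.2] j := by
  rw [corrIncl_coe, ← corrIncl0_apply]

theorem corrIncl_fn (k : Corr p) (y : ℝ) : (fun j => (corrIncl p k).fn j y) =
    ![0, 0, 0, k.1.d 0 y, 0, 0, k.2.1.d 0 y, k.2.2.1.d 0 y, k.2.2.2.d 0 y] := by
  funext j
  fin_cases j <;> simp [Data.fn, corrIncl_fst, corrIncl_snd, corrIncl_thd, CPer.zero_d]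

theorem corrProj_apply (h : Data p) :
    corrProj p h = (h.1.2.1 1, h.1.2.1 4, h.1.2.2 0, h.1.2.2 1) := rfl

theorem corrIncl_corrProj_iff (h : Data p) : h = corrIncl p (corrProj p h) ↔
    ∀ y ∈ cell p, h.fn 0 y = 0 ∧ h.fn 1 y = 0 ∧ h.fn 2 y = 0 ∧ h.fn 4 y = 0 ∧ h.fn 5 y = 0 := by
  have key : ∀ j y, (corrIncl p (corrProj p h)).fn j y =
      ![0, 0, 0, h.fn 3 y, 0, 0, h.fn 6 y, h.fn 7 y, h.fn 8 y] j := fun j y => by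
    rw [congrFun (corrIncl_fn (corrProj p h) y) j, corrProj_apply]
    rfl
  constructor
  · intro e y _
    rw [e]
    exact ⟨key 0 y, key 1 y, key 2 y, key 4 y, key 5 y⟩
  · intro H
    refine Data.ext_fn fun j y hy => ?_
    obtain ⟨h0, h1, h2, h4, h5⟩ := H y hy
    rw [key]
    fin_cases j
    exacts [h0, h1, h2, rfl, h4, h5, rfl, rfl, rfl]

theorem corrProj_corrIncl (k : Corr p) : corrProj p (corrIncl p k) = k := by
  rw [corrProj_apply]
  simp only [corrIncl_snd, corrIncl_thd]
  rfl

/-- The jump at `0` of `D_x^a D_y^b ζ`. -/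
noncomputable def jZero (p : Params) (a b : ℕ) (h : a + b + 0 ≤ 2) : XHat p →L[ℝ] CPer p 0 :=
  X.tH .c1 (zero_mem_ivl_c1 p) a b 0 h - X.tH .m1 (zero_mem_ivl_m1 p) a b 0 h

/-- The jump at `R` of `D_x^a D_y^b ζ`. -/
noncomputable def jR (p : Params) (a b : ℕ) (h : a + b + 0 ≤ 2) : XHat p →L[ℝ] CPer p 0 :=
  X.tH .p1 (R_mem_ivl_p1 p) a b 0 h - X.tH .c1 (R_mem_ivl_c1 p) a b 0 h

/-- The part of second order of the nonlinear conditions. -/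
noncomputable def bdryRem (p : Params) (a b : ℝ → ℝ) (s : XHat p × Corr p) : Corr p :=
  let u := s.1
  let k := s.2
  let w1 := X.tH .c2 (zero_mem_ivl_c2 p) 0 1 1 (by norm_num) u
  let z1 := X.tH .p1 (R_mem_ivl_p1 p) 0 1 1 (by norm_num) u
  -- The equations for the fourth and seventh entries of `𝓗`, multiplied by their denominators and
  -- then divided by `Le²` and `R θ²` so that `k` gets the coefficient `1`.
  ((p.R ^ 2 / p.Le ^ 2) • (w1.mul1 w1).mul1 k.1 + (p.R / p.Le) • w1.mul1 w1,
    (p.θ ^ 2)⁻¹ • (z1.mul1 z1).mul1 k.2.1 - (p.Le / (p.R * p.θ ^ 2)) • z1.mul1 z1,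
    compatRem (a 0 / p.θ) (b 0 / p.Le ^ 2)
      (iteratedDeriv 2 (Theta0 p .mid) 0 - iteratedDeriv 2 (Theta0 p .minus) 0)
      (iteratedDeriv 3 (Theta0 p .mid) 0 - iteratedDeriv 3 (Theta0 p .minus) 0)
      (denR u) (denZero u) (numR u) (numZero u)
      ((-(p.R * p.Le⁻¹)) • wT p 0 0 (by norm_num) u) ((-(p.R * p.Le⁻¹)) • wT p 0 1 (by norm_num) u)
      ((-(p.R * p.Le⁻¹)) • wT p 0 2 (by norm_num) u)
      (jZero p 1 0 (by norm_num) u) (jZero p 1 1 (by norm_num) u) (jZero p 2 0 (by norm_num) u)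
      k.2.2.1,
    compatRem (a p.R / p.θ) (b p.R / p.Le ^ 2)
      (iteratedDeriv 2 (Theta0 p .plus) p.R - iteratedDeriv 2 (Theta0 p .mid) p.R)
      (iteratedDeriv 3 (Theta0 p .plus) p.R - iteratedDeriv 3 (Theta0 p .mid) p.R)
      (denR u) (denZero u) (numR u) (numZero u)
      (p.θ⁻¹ • zT p 0 0 (by norm_num) u) (p.θ⁻¹ • zT p 0 1 (by norm_num) u)
      (p.θ⁻¹ • zT p 0 2 (by norm_num) u)
      (jR p 1 0 (by norm_num) u) (jR p 1 1 (by norm_num) u) (jR p 2 0 (by norm_num) u)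
      k.2.2.2)

theorem Van.comp_fst {E F G : Type*} [NormedAddCommGroup E] [NormedSpace ℝ E]
    [NormedAddCommGroup F] [NormedSpace ℝ F] [NormedAddCommGroup G] [NormedSpace ℝ G] {f : E → F}
    (hf : Van f) : Van fun s : E × G => f s.1 :=
  ⟨hf.smooth.comp contDiff_fst, hf.zero⟩

/-- Every term is a product with at least two factors vanishing at `0`, the corrections `k` being
counted among them. The profile enters only through constant coefficients. -/
theorem bdryRem_quad (a b : ℝ → ℝ) : Quad (bdryRem p a b) := by
  have hL : ∀ {F : Type _} [NormedAddCommGroup F] [NormedSpace ℝ F] (L : XHat p →L[ℝ] F),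
      Van fun s : XHat p × Corr p => L s.1 := fun L => (Van.of_clm L).comp_fst
  have hw := fun (i : Piece) (x : ℝ) (hx : x ∈ i.reg.ivl p) => hL (X.tH i hx 0 1 1 (by norm_num))
  have hdR := (denR_van (p := p)).comp_fst (G := Corr p)
  have hd0 := (denZero_van (p := p)).comp_fst (G := Corr p)
  have hnR := (numR_van (p := p)).comp_fst (G := Corr p)
  have hn0 := (numZero_van (p := p)).comp_fst (G := Corr p)
  have k1 : Van fun s : XHat p × Corr p => s.2.1 := ⟨by fun_prop, rfl⟩
  have k2 : Van fun s : XHat p × Corr p => s.2.2.1 := ⟨by fun_prop, rfl⟩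
  have k3 : Van fun s : XHat p × Corr p => s.2.2.2.1 := ⟨by fun_prop, rfl⟩
  have k4 : Van fun s : XHat p × Corr p => s.2.2.2.2 := ⟨by fun_prop, rfl⟩
  have w1 := hw _ _ (zero_mem_ivl_c2 p)
  have z1 := hw _ _ (R_mem_ivl_p1 p)
  refine Quad.prodMk ?_ (Quad.prodMk ?_ (Quad.prodMk ?_ ?_))
  · exact (((w1.mul1 w1).toVan.mul1 k1).smul _).add ((w1.mul1 w1).smul _)
  · exact (((z1.mul1 z1).toVan.mul1 k2).smul _).sub ((z1.mul1 z1).smul _)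
  · exact compatRem_quad _ _ _ _ hdR hd0 hnR hn0 ((hL _).smul _) ((hL _).smul _) ((hL _).smul _)
      (hL _) (hL _) (hL _) k3
  · exact compatRem_quad _ _ _ _ hdR hd0 hnR hn0 ((hL _).smul _) ((hL _).smul _) ((hL _).smul _)
      (hL _) (hL _) (hL _) k4

end nonlinear

end ThickFlame

namespace ThickFlame

/-! ### The nonlinear terms at the interfaces -/

section traces

variable {p : Params} (c : Cutoffs p)

/-- The cut-off `β` is identically `1` near `0`, so all its derivatives at `0` are those of a
constant. -/
theorem Cutoffs.iteratedDeriv_zero (m : ℕ) :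
    iteratedDeriv m c.β 0 = iteratedDeriv m (fun _ : ℝ => (1 : ℝ)) 0 := by
  refine Filter.EventuallyEq.iteratedDeriv_eq m ?_
  filter_upwards [Icc_mem_nhds (neg_neg_of_pos c.δ_pos) c.δ_pos] with x hx using c.β_one x hx

/-- The support of `β` is contained in the open interval `(-R, R)`. At the points `±R` this removes
from `ϱ`, at each interface, the contribution of the other one. -/
theorem Cutoffs.iteratedDeriv_of_notMem (m : ℕ) {x : ℝ} (hx : x ∉ Ioo (-p.R) p.R) :
    iteratedDeriv m c.β x = 0 := by
  have h : c.β =ᶠ[𝓝 x] fun _ => (0 : ℝ) :=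
    notMem_tsupport_iff_eventuallyEq.1 fun h => hx (c.δ_small (c.β_supp h))
  rw [h.iteratedDeriv_eq m, iteratedDeriv_const]
  split_ifs <;> rfl

theorem rho_at_zero (u : X p 2) (m n : ℕ) (y : ℝ) :
    rho c u m n 0 y = if m = 0 then -(p.R * p.Le⁻¹) * u.D 0 n .c2 0 y else 0 := by
  have h : (0 - p.R) ∉ Ioo (-p.R) p.R := fun h => by simpa using h.1
  rw [rho, c.iteratedDeriv_of_notMem m h, c.iteratedDeriv_zero, iteratedDeriv_const]
  split_ifs <;> simp

theorem rho_at_R (u : X p 2) (m n : ℕ) (y : ℝ) :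
    rho c u m n p.R y = if m = 0 then p.θ⁻¹ * u.D 0 n .p1 p.R y else 0 := by
  have h : p.R ∉ Ioo (-p.R) p.R := fun h => lt_irrefl _ h.2
  rw [rho, c.iteratedDeriv_of_notMem m h, sub_self, c.iteratedDeriv_zero, iteratedDeriv_const]
  split_ifs <;> simp

theorem nl1_of_rho {u : X p 2} {x y : ℝ} (h1 : rho c u 1 0 x y = 0) (w2 wx : ℝ) :
    nl1 c u w2 wx x y = rho c u 0 0 x y * w2 + wx := by
  simp [nl1, h1]

/-- All denominators become `1`. The coefficient of `ϱ_y² W_xx` drops from `2` to `1`, because the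
last fraction contributes `-ϱ_y² W_xx`. -/
theorem nl2_of_rho {u : X p 2} {x y : ℝ} (h1 : rho c u 1 0 x y = 0) (h2 : rho c u 2 0 x y = 0)
    (h11 : rho c u 1 1 x y = 0) (κ w2 w3 wx wxy wxx : ℝ) :
    nl2 c κ u w2 w3 wx wxy wxx x y =
      rho c u 0 2 x y * (rho c u 0 0 x y * w2 + wx) + w2 * rho c u 0 1 x y ^ 2
        + 2 * rho c u 0 1 x y * wxy - rho c u 0 1 x y ^ 2 * (w3 * rho c u 0 0 x y + wxx) := by
  simp only [nl2, h1, h2, h11]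
  ring

/-- The denominator of `Λ_R` does not vanish near `0`. -/
theorem one_add_denR_ne {u : X p 2} (hu : 2 * ‖u‖ < p.θ) {y : ℝ} (hy : y ∈ cell p) :
    1 + (denR (toHat p u)).d 0 y ≠ 0 := by
  have h0 := abs_le.1 (u.abs_D_le .p1 0 0 p.R y)
  have h1 := abs_le.1 (u.abs_D_le .p1 1 0 p.R y)
  have hθ := p.θ_pos
  simp only [denR, zT, CPer.d_smul, CPer.d_add, X.tH_d _ _ _ _ hy]
  have : 0 < p.θ - (u.D 0 0 .p1 p.R y + u.D 1 0 .p1 p.R y) := by linarith [h0.2, h1.2]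
  have h := mul_pos (inv_pos.2 hθ) this
  rw [mul_sub, inv_mul_cancel₀ hθ.ne'] at h
  linarith

/-- The denominator of `Λ₀` does not vanish near `0`. -/
theorem one_add_denZero_ne {u : X p 2} (hu : (p.R + p.R / p.Le) * ‖u‖ < 1) {y : ℝ}
    (hy : y ∈ cell p) : 1 + (denZero (toHat p u)).d 0 y ≠ 0 := by
  have h0 := abs_le.1 (u.abs_D_le .c2 0 0 0 y)
  have h1 := abs_le.1 (u.abs_D_le .c2 1 0 0 y)
  have e0 := mul_le_mul_of_nonneg_left h0.1 p.R_pos.le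
  have e1 := mul_le_mul_of_nonneg_left h1.1 (div_pos p.R_pos p.Le_pos).le
  simp only [denZero, wT, CPer.d_smul, CPer.d_add, X.tH_d _ _ _ _ hy]
  have : 0 < 1 + (p.R * u.D 0 0 .c2 0 y + p.R / p.Le * u.D 1 0 .c2 0 y) := by linarith
  exact this.ne'

theorem LamR_eq (u : X p 2) {y : ℝ} (hy : y ∈ cell p) :
    LamR u y = (p.θ * (1 + (denR (toHat p u)).d 0 y))⁻¹ * (numR (toHat p u)).d 0 y := by
  have hθ := p.θ_pos.ne'
  simp only [denR, numR, zT, CPer.d_smul, CPer.d_add, CPer.sub_d, CPer.mul0_d _ _ hy,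
    X.tH_d _ _ _ _ hy, LamR]
  congr 1
  · congr 1
    field_simp
    ring
  · ring

theorem LamZero_eq (u : X p 2) {y : ℝ} (hy : y ∈ cell p) :
    LamZero u y =
      (p.Le ^ 2 * (1 + (denZero (toHat p u)).d 0 y))⁻¹ * (numZero (toHat p u)).d 0 y := by
  have hL := p.Le_pos.ne'
  simp only [denZero, numZero, wT, CPer.d_smul, CPer.d_add, CPer.sub_d, CPer.mul0_d _ _ hy,
    X.tH_d _ _ _ _ hy, LamZero]
  congr 1
  · congr 1
    field_simp
  · ring

/-- The two sides differ by the factor `X Y ≠ 0`, so clearing denominators loses and adds no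
solutions. -/
theorem compat_algebra {θ M X Y a b nR n0 k f1 f2 : ℝ} (hθ : θ ≠ 0) (hM : M ≠ 0) (hX : X ≠ 0)
    (hY : Y ≠ 0) : X * Y * (k - f2) + (a / θ * nR * Y - b / M * n0 * X) * f1 = 0 ↔
      k + ((a * ((θ * X)⁻¹ * nR) - b * ((M * Y)⁻¹ * n0)) * f1 - f2) = 0 := by
  have e : X * Y * (k - f2) + (a / θ * nR * Y - b / M * n0 * X) * f1 =
      X * Y * (k + ((a * ((θ * X)⁻¹ * nR) - b * ((M * Y)⁻¹ * n0)) * f1 - f2)) := by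
    field_simp
    ring
  rw [e, mul_eq_zero]
  exact or_iff_right (mul_ne_zero hX hY)

/-- A bound under which the denominators of `Λ` do not vanish. -/
structure Small (u : X p 2) : Prop where
  R : 2 * ‖u‖ < p.θ
  zero : (p.R + p.R / p.Le) * ‖u‖ < 1

/-- The operator `𝓑₀` sees only the first component, so `𝓖₁`, `𝓖₂` play no role. As `ϱ` is the same
on both sides of the interface and `𝓕₁`, `𝓕₂` are linear in the profile and perturbation terms, only
the jumps of these terms enter. -/
theorem compat_zero_iff (a b : ℝ → ℝ) {u : X p 2} (hu : Small u) {y : ℝ} (hy : y ∈ cell p) :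
    B0 p (Lop u + Fop c a b u) y 0 = 0 ↔
      ((corrProj p (Bs p u)).2.2.1
        + (bdryRem p a b (toHat p u, corrProj p (Bs p u))).2.2.1).d 0 y = 0 := by
  have hk : (corrProj p (Bs p u)).2.2.1.d 0 y = B0 p (Lop u) y 0 := Bs_fn u 7 hy
  have hL : B0 p (Lop u + Fop c a b u) y 0 = B0 p (Lop u) y 0
      + (Lam a b u 0 y * (F1 c u .c1 0 y - F1 c u .m1 0 y)
        - (F2 c u .c1 0 y - F2 c u .m1 0 y)) := by
    rw [B0_add]
    simp only [Pi.add_apply, B0, Fop, Matrix.cons_val_zero]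
    ring
  rw [hL]
  simp only [bdryRem]
  rw [compatRem_d _ _ _ _ _ _ _ _ _ _ _ _ _ _ _ hy, hk,
    compat_algebra p.θ_pos.ne' (pow_ne_zero 2 p.Le_pos.ne') (one_add_denR_ne hu.R hy)
      (one_add_denZero_ne hu.zero hy), ← LamR_eq u hy, ← LamZero_eq u hy]
  simp only [F1, F2, nl1_of_rho c (rho_at_zero c u 1 0 y),
    nl2_of_rho c (rho_at_zero c u 1 0 y) (rho_at_zero c u 2 0 y) (rho_at_zero c u 1 1 y),
    rho_at_zero, if_true, wT, jZero, CPer.d_smul, CPer.sub_d, X.tH_d _ _ _ _ hy, Lam,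
    sub_apply, Piece.reg]
  refine Eq.congr_left ?_
  ring

theorem compat_R_iff (a b : ℝ → ℝ) {u : X p 2} (hu : Small u) {y : ℝ} (hy : y ∈ cell p) :
    B0 p (Lop u + Fop c a b u) y 1 = 0 ↔
      ((corrProj p (Bs p u)).2.2.2
        + (bdryRem p a b (toHat p u, corrProj p (Bs p u))).2.2.2).d 0 y = 0 := by
  have hk : (corrProj p (Bs p u)).2.2.2.d 0 y = B0 p (Lop u) y 1 := Bs_fn u 8 hy
  have hL : B0 p (Lop u + Fop c a b u) y 1 = B0 p (Lop u) y 1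
      + (Lam a b u p.R y * (F1 c u .p1 p.R y - F1 c u .c1 p.R y)
        - (F2 c u .p1 p.R y - F2 c u .c1 p.R y)) := by
    rw [B0_add]
    simp only [Pi.add_apply, B0, Fop, Matrix.cons_val_one, Matrix.cons_val_zero]
    ring
  rw [hL]
  simp only [bdryRem]
  rw [compatRem_d _ _ _ _ _ _ _ _ _ _ _ _ _ _ _ hy, hk,
    compat_algebra p.θ_pos.ne' (pow_ne_zero 2 p.Le_pos.ne') (one_add_denR_ne hu.R hy)
      (one_add_denZero_ne hu.zero hy), ← LamR_eq u hy, ← LamZero_eq u hy]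
  simp only [F1, F2, nl1_of_rho c (rho_at_R c u 1 0 y),
    nl2_of_rho c (rho_at_R c u 1 0 y) (rho_at_R c u 2 0 y) (rho_at_R c u 1 1 y),
    rho_at_R, if_true, zT, jR, CPer.d_smul, CPer.sub_d, X.tH_d _ _ _ _ hy, Lam,
    sub_apply, Piece.reg]
  refine Eq.congr_left ?_
  ring

theorem Hop_three_iff (a b : ℝ → ℝ) (u : X p 2) {y : ℝ} (hy : y ∈ cell p) :
    Bop u y 3 = Hop u y 3 ↔ ((corrProj p (Bs p u)).1
      + (bdryRem p a b (toHat p u, corrProj p (Bs p u))).1).d 0 y = 0 := by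
  have hk : (corrProj p (Bs p u)).1.d 0 y = Bop u y 3 := Bs_fn u 3 hy
  have hL := p.Le_pos
  have h0 : p.Le ^ 2 + p.R ^ 2 * u.D 0 1 .c2 0 y ^ 2 ≠ 0 := by positivity
  have e : Hop u y 3 =
    -(p.R * p.Le * u.D 0 1 .c2 0 y ^ 2) / (p.Le ^ 2 + p.R ^ 2 * u.D 0 1 .c2 0 y ^ 2) := rfl
  simp only [bdryRem, CPer.d_add, CPer.d_smul, CPer.mul1_d _ _ hy, X.tH_d _ _ _ _ hy, hk]
  rw [e, eq_div_iff h0]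
  constructor <;> intro h
  · field_simp
    linear_combination h
  · field_simp at h
    linear_combination h

theorem Hop_six_iff (a b : ℝ → ℝ) (u : X p 2) {y : ℝ} (hy : y ∈ cell p) :
    Bop u y 6 = Hop u y 6 ↔ ((corrProj p (Bs p u)).2.1
      + (bdryRem p a b (toHat p u, corrProj p (Bs p u))).2.1).d 0 y = 0 := by
  have hk : (corrProj p (Bs p u)).2.1.d 0 y = Bop u y 6 := Bs_fn u 6 hy
  have hθ := p.θ_pos
  have hR := p.R_pos
  have h0 : p.R * (p.θ ^ 2 + u.D 0 1 .p1 p.R y ^ 2) ≠ 0 := by positivity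
  have e : Hop u y 6 =
    p.Le * u.D 0 1 .p1 p.R y ^ 2 / (p.R * (p.θ ^ 2 + u.D 0 1 .p1 p.R y ^ 2)) := rfl
  simp only [bdryRem, CPer.d_add, CPer.sub_d, CPer.d_smul, CPer.mul1_d _ _ hy, X.tH_d _ _ _ _ hy,
    hk]
  rw [e, eq_div_iff h0]
  constructor <;> intro h
  · field_simp
    linear_combination h
  · field_simp at h
    linear_combination h

theorem CPer.eq_zero_iff {k : ℕ} (f : CPer p k) : f = 0 ↔ ∀ y ∈ cell p, f.d 0 y = 0 :=
  ⟨fun h y _ => by rw [h, CPer.zero_d],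
    fun h => CPer.ext_d fun y hy => by rw [h y hy, CPer.zero_d]⟩

theorem Fin.forall_seven {P : Fin 7 → Prop} :
    (∀ j, P j) ↔ P 0 ∧ P 1 ∧ P 2 ∧ P 3 ∧ P 4 ∧ P 5 ∧ P 6 := by
  constructor
  · intro h
    exact ⟨h 0, h 1, h 2, h 3, h 4, h 5, h 6⟩
  · rintro ⟨h0, h1, h2, h3, h4, h5, h6⟩ j
    fin_cases j <;> assumption

/-- The components of `𝓗` other than the fourth and the seventh vanish. The fifth conditions for `𝓑`
and `𝓑̃` agree once `[ζ]_R = 0`, which is the second condition. -/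
theorem Bop_eq_Hop_iff (u : X p 2) {y : ℝ} (hy : y ∈ cell p) : Bop u y = Hop u y ↔
    ((Bs p u).fn 0 y = 0 ∧ (Bs p u).fn 1 y = 0 ∧ (Bs p u).fn 2 y = 0 ∧ (Bs p u).fn 4 y = 0 ∧
      (Bs p u).fn 5 y = 0) ∧ Bop u y 3 = Hop u y 3 ∧ Bop u y 6 = Hop u y 6 := by
  have e4 : Bstar u y 4 = Bop u y 4 - Bop u y 1 / 2 := by
    simp only [Bstar, Bop, Matrix.cons_val]
    ring
  have e0 : Bstar u y 0 = Bop u y 0 := rfl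
  have e1 : Bstar u y 1 = Bop u y 1 := rfl
  have e2 : Bstar u y 2 = Bop u y 2 := rfl
  have e5 : Bstar u y 5 = Bop u y 5 := rfl
  have h0 : Hop u y 0 = 0 := rfl
  have h1 : Hop u y 1 = 0 := rfl
  have h2 : Hop u y 2 = 0 := rfl
  have h4 : Hop u y 4 = 0 := rfl
  have h5 : Hop u y 5 = 0 := rfl
  rw [funext_iff, Fin.forall_seven, Bs_fn _ _ hy, Bs_fn _ _ hy, Bs_fn _ _ hy, Bs_fn _ _ hy,
    Bs_fn _ _ hy, e0, e1, e2, e4, e5, h0, h1, h2, h4, h5]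
  constructor
  · rintro ⟨h0, h1, h2, h3, h4, h5, h6⟩
    exact ⟨⟨h0, h1, h2, by rw [h4, h1]; simp, h5⟩, h3, h6⟩
  · rintro ⟨⟨h0, h1, h2, h4, h5⟩, h3, h6⟩
    exact ⟨h0, h1, h2, h3, by rw [h1] at h4; simpa using h4, h5, h6⟩

/-- The set `𝓘` near `0` in terms of the corrections. -/
theorem mem_compatSet_iff (a b : ℝ → ℝ) {u : X p 2} (hu : Small u) :
    u ∈ compatSet c a b ↔ Bs p u = corrIncl p (corrProj p (Bs p u)) ∧
      corrProj p (Bs p u) + bdryRem p a b (toHat p u, corrProj p (Bs p u)) = 0 := by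
  have hsplit : ∀ k : Corr p, k = 0 ↔ k.1 = 0 ∧ k.2.1 = 0 ∧ k.2.2.1 = 0 ∧ k.2.2.2 = 0 := fun k => by
    simp only [Prod.ext_iff, Prod.fst_zero, Prod.snd_zero]
  rw [hsplit, corrIncl_corrProj_iff]
  simp only [CPer.eq_zero_iff, Prod.fst_add, Prod.snd_add]
  constructor
  · rintro ⟨h1, h2⟩
    refine ⟨fun y hy => ((Bop_eq_Hop_iff u hy).1 (h1 y hy)).1,
      fun y hy => (Hop_three_iff a b u hy).1 ((Bop_eq_Hop_iff u hy).1 (h1 y hy)).2.1,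
      fun y hy => (Hop_six_iff a b u hy).1 ((Bop_eq_Hop_iff u hy).1 (h1 y hy)).2.2,
      fun y hy => (compat_zero_iff c a b hu hy).1 (congrFun (h2 y hy) 0),
      fun y hy => (compat_R_iff c a b hu hy).1 (congrFun (h2 y hy) 1)⟩
  · rintro ⟨h, h3, h6, h7, h8⟩
    refine ⟨fun y hy => (Bop_eq_Hop_iff u hy).2 ⟨h y hy, (Hop_three_iff a b u hy).2 (h3 y hy),
      (Hop_six_iff a b u hy).2 (h6 y hy)⟩, fun y hy => ?_⟩
    funext j
    fin_cases j
    · exact (compat_zero_iff c a b hu hy).2 (h7 y hy)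
    · exact (compat_R_iff c a b hu hy).2 (h8 y hy)

end traces

end ThickFlame

namespace ThickFlame

/-! ### The projection onto the domain and the local graph -/

section solution

variable {p : Params}

theorem exists_small (p : Params) : ∃ s > 0, ∀ u : X p 2, ‖u‖ < s → Small u := by
  have hc : 0 < p.R + p.R / p.Le := add_pos p.R_pos (div_pos p.R_pos p.Le_pos)
  refine ⟨min (p.θ / 2) (1 / (p.R + p.R / p.Le)),
    lt_min (half_pos p.θ_pos) (one_div_pos.2 hc), fun u hu => ?_⟩
  have h1 := hu.trans_le (min_le_left _ _)
  have h2 := hu.trans_le (min_le_right _ _)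
  rw [lt_div_iff₀ hc] at h2
  exact ⟨by linarith, by linarith⟩

variable (c : Cutoffs p)

/-- The lifting of the corrections. -/
noncomputable def liftCorr : Corr p →L[ℝ] X p 2 := (liftN c).comp (corrIncl p)

theorem Bs_liftCorr (k : Corr p) : Bs p (liftCorr c k) = corrIncl p k := Bs_liftN c _

/-- The projection `P = I - 𝓝 𝓑_*`. -/
noncomputable def projDL : X p 2 →L[ℝ] X p 2 :=
  ContinuousLinearMap.id ℝ (X p 2) - (liftN c).comp (Bs p)

theorem projDL_apply (u : X p 2) : projDL c u = u - liftN c (Bs p u) := rfl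

theorem Bs_projDL (u : X p 2) : Bs p (projDL c u) = 0 := by
  rw [projDL_apply, map_sub, Bs_liftN, sub_self]

theorem projDL_of_mem {u : X p 2} (hu : u ∈ DL p) : projDL c u = u := by
  rw [projDL_apply, (Bs_eq_zero_iff u).2 hu, map_zero, sub_zero]

theorem projDL_mem (u : X p 2) : projDL c u ∈ DL p := (Bs_eq_zero_iff _).1 (Bs_projDL c u)

theorem projDL_liftN (h : Data p) : projDL c (liftN c h) = 0 := by
  rw [projDL_apply, Bs_liftN, sub_self]

theorem range_projDL : (projDL c).range = (Bs p).ker := by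
  ext u
  constructor
  · rintro ⟨v, rfl⟩
    exact Bs_projDL c v
  · intro hu
    exact ⟨u, projDL_of_mem c ((Bs_eq_zero_iff u).1 hu)⟩

theorem ker_Bs : (Bs p).ker = DL p := by
  ext u
  exact Bs_eq_zero_iff u

theorem liftCorr_mem (k : Corr p) :
    liftCorr c k ∈ (ContinuousLinearMap.id ℝ (X p 2) - projDL c).range := by
  refine ⟨liftCorr c k, ?_⟩
  change liftCorr c k - projDL c (liftCorr c k) = liftCorr c k
  rw [show projDL c (liftCorr c k) = 0 from projDL_liftN c _, sub_zero]

/-- The nonlinear set near `0` as a graph over `D(L_α)`, in terms of the corrections. -/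
theorem exists_corr (a b : ℝ → ℝ) : ∃ r₁ > 0, ∃ r₂ > 0, ∃ h : XHat p → Corr p,
    ContDiffOn ℝ ω h (Metric.ball 0 r₁) ∧ h 0 = 0 ∧
    ∀ u : X p 2, (u ∈ compatSet c a b ∧ ‖projDL c u‖ < r₁ ∧ ‖u - projDL c u‖ < r₂) ↔
      ∃ v ∈ DL p, ‖v‖ < r₁ ∧ u = v + liftCorr c (h (toHat p v)) := by
  -- The substitution `u = v + 𝓝 k`: since `𝓑_* v = 0` and `𝓑_* 𝓝 = I`, the unknown `k` is at once
  -- the lifted correction and the data of `u`. Composition with this linear map keeps the remainder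
  -- of second order.
  let T : XHat p × Corr p →L[ℝ] XHat p × Corr p :=
    (ContinuousLinearMap.fst ℝ _ _ +
      ((toHat p).comp (liftCorr c)).comp (ContinuousLinearMap.snd ℝ _ _)).prod
      (ContinuousLinearMap.snd ℝ _ _)
  have hT : ∀ v k, T (v, k) = (v + toHat p (liftCorr c k), k) := fun v k => rfl
  obtain ⟨ρ, hρ, σ, hσ, h, hh, h0, hball, hsol⟩ :=
    ((bdryRem_quad (p := p) a b).comp_clm T).exists_solution
  simp only [hT] at hsol
  obtain ⟨s, hs, hsmall⟩ := exists_small p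
  let S : X p 2 →L[ℝ] Corr p := (corrProj p).comp (Bs p)
  have hC : 0 < ‖S‖ + 1 := by positivity
  -- The bound `s / 2` is half of the smallness budget for the denominators; `ρ / (‖S‖ + 1)` forces
  -- the correction `S u` into the ball where the solution is unique.
  have hr2 : 0 < min (s / 2) (ρ / (‖S‖ + 1)) := lt_min (half_pos hs) (div_pos hρ hC)
  have hcont : ContinuousAt (fun v : X p 2 => ‖liftCorr c (h (toHat p v))‖) 0 := by
    have h1 : ContinuousAt h (toHat p 0) := by
      rw [map_zero]
      exact hh.continuousOn.continuousAt (Metric.ball_mem_nhds 0 hσ)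
    exact ((liftCorr c).continuous.continuousAt.comp
      (ContinuousAt.comp (f := toHat p) h1 (toHat p).continuous.continuousAt)).norm
  have hev : ∀ᶠ v in 𝓝 (0 : X p 2),
      ‖liftCorr c (h (toHat p v))‖ < min (s / 2) (ρ / (‖S‖ + 1)) := by
    refine hcont.eventually_lt continuousAt_const ?_
    rw [map_zero, h0, map_zero, norm_zero]
    exact hr2
  obtain ⟨ε, hε, hεr⟩ := Metric.eventually_nhds_iff.1 hev
  -- Here `ε` keeps the lifted solution below the second radius, `σ` is the radius on which `h` is
  -- defined, and `s / 2` is the other half of the smallness budget.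
  refine ⟨min ε (min σ (s / 2)), lt_min hε (lt_min hσ (half_pos hs)),
    min (s / 2) (ρ / (‖S‖ + 1)), hr2, h,
    hh.mono (Metric.ball_subset_ball ((min_le_right _ _).trans (min_le_left _ _))), h0, ?_⟩
  have hmem : ∀ v : X p 2, ‖v‖ < min ε (min σ (s / 2)) → toHat p v ∈ Metric.ball 0 σ := by
    intro v hv
    rw [mem_ball_zero_iff, norm_toHat]
    exact hv.trans_le ((min_le_right _ _).trans (min_le_left _ _))
  have hlt : ∀ v w : X p 2, ‖v‖ < min ε (min σ (s / 2)) → ‖w‖ < min (s / 2) (ρ / (‖S‖ + 1)) →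
      Small (v + w) := by
    intro v w hv hw
    refine hsmall _ ?_
    have h1 := hv.trans_le ((min_le_right _ _).trans (min_le_right _ _))
    have h2 := hw.trans_le (min_le_left _ _)
    linarith [norm_add_le v w]
  intro u
  constructor
  · rintro ⟨hu, hu1, hu2⟩
    have hsm : Small u := by
      have := hlt _ _ hu1 hu2
      rwa [add_sub_cancel] at this
    obtain ⟨e1, e2⟩ := (mem_compatSet_iff c a b hsm).1 hu
    have e3 : u - projDL c u = liftCorr c (S u) := by
      rw [projDL_apply, sub_sub_cancel, e1]
      rfl
    have e4 : u = projDL c u + liftCorr c (S u) := by rw [← e3, add_sub_cancel]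
    have e5 : S u = h (toHat p (projDL c u)) := by
      refine (hsol _ (hmem _ hu1) (S u) ?_).1 ?_
      · have e6 : S u = S (u - projDL c u) := by
          change corrProj p (Bs p u) = corrProj p (Bs p (u - projDL c u))
          rw [map_sub, Bs_projDL, sub_zero]
        rw [mem_ball_zero_iff, e6]
        have h2 := hu2.trans_le (min_le_right _ _)
        rw [lt_div_iff₀ hC] at h2
        have h3 := S.le_opNorm (u - projDL c u)
        nlinarith [norm_nonneg (u - projDL c u)]
      · rw [← map_add, ← e4]
        exact e2
    exact ⟨projDL c u, projDL_mem c u, hu1, by rw [← e5]; exact e4⟩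
  · rintro ⟨v, hv, hv1, rfl⟩
    have hk := hball _ (hmem _ hv1)
    have hw : ‖liftCorr c (h (toHat p v))‖ < min (s / 2) (ρ / (‖S‖ + 1)) :=
      hεr (by rw [dist_zero_right]; exact hv1.trans_le (min_le_left _ _))
    have hB : Bs p (v + liftCorr c (h (toHat p v))) = corrIncl p (h (toHat p v)) := by
      rw [map_add, Bs_liftCorr, (Bs_eq_zero_iff v).2 hv, zero_add]
    have hP : projDL c (v + liftCorr c (h (toHat p v))) = v := by
      rw [map_add, projDL_of_mem c hv,
        show projDL c (liftCorr c (h (toHat p v))) = 0 from projDL_liftN c _, add_zero]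
    refine ⟨(mem_compatSet_iff c a b (hlt _ _ hv1 hw)).2 ?_, ?_, ?_⟩
    · rw [hB, corrProj_corrIncl, map_add]
      exact ⟨rfl, (hsol _ (hmem _ hv1) _ hk).2 rfl⟩
    · rw [hP]
      exact hv1
    · rw [hP, add_sub_cancel_left]
      exact hw

/-- The nonlinear set near `0` as a smooth graph over `D(L_α)`. -/
theorem exists_graph (a b : ℝ → ℝ) : ∃ r₀ > 0, ∃ r₁ > 0, ∃ r₂ > 0,
    ∃ Υ : DL p → (ContinuousLinearMap.id ℝ (X p 2) - projDL c).range,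
      ContDiffOn ℝ ∞ Υ (Metric.ball 0 r₁) ∧
      Υ 0 = 0 ∧
      {u | u ∈ compatSet c a b ∧ ‖projDL c u‖ < r₁ ∧ ‖u - projDL c u‖ < r₂}
        = {u | ∃ v ∈ Metric.ball (0 : DL p) r₁, u = (v : X p 2) + (Υ v : X p 2)} ∧
      Metric.ball 0 r₀ ⊆ {u : X p 2 | ‖projDL c u‖ < r₁ ∧ ‖u - projDL c u‖ < r₂} := by
  obtain ⟨r₁, hr₁, r₂, hr₂, h, hh, h0, hiff⟩ := exists_corr c a b
  have hU :
      {u : X p 2 | ‖projDL c u‖ < r₁ ∧ ‖u - projDL c u‖ < r₂} ∈ 𝓝 (0 : X p 2) := by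
    refine IsOpen.mem_nhds (IsOpen.inter
      (isOpen_lt (projDL c).continuous.norm continuous_const)
      (isOpen_lt (continuous_id.sub (projDL c).continuous).norm continuous_const)) ⟨?_, ?_⟩
    · simpa using hr₁
    · simpa using hr₂
  obtain ⟨r₀, hr₀, hball⟩ := Metric.mem_nhds_iff.1 hU
  let L : Corr p →L[ℝ] (ContinuousLinearMap.id ℝ (X p 2) - projDL c).range :=
    (liftCorr c).codRestrict _ (liftCorr_mem c)
  refine ⟨r₀, hr₀, r₁, hr₁, r₂, hr₂, fun v => L (h (toHat p v)), ?_, ?_, ?_, hball⟩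
  · refine L.contDiff.comp_contDiffOn ((hh.of_le le_top).comp
      ((toHat p).comp (DL p).subtypeL).contDiff.contDiffOn fun v hv => ?_)
    rw [mem_ball_zero_iff, norm_toHat]
    exact mem_ball_zero_iff.1 hv
  · change L (h (toHat p 0)) = 0
    rw [map_zero, h0, map_zero]
  · ext u
    refine (hiff u).trans ⟨?_, ?_⟩
    · rintro ⟨v, hv, hv1, hu⟩
      exact ⟨⟨v, hv⟩, mem_ball_zero_iff.2 hv1, hu⟩
    · rintro ⟨v, hv, hu⟩
      exact ⟨v, v.2, mem_ball_zero_iff.1 hv, hu⟩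

end solution

end ThickFlame

theorem mainTheorem10 (p : ThickFlame.Params) (c : ThickFlame.Cutoffs p) (a b : ℝ → ℝ)
    (_ha : ContDiff ℝ ∞ a) (_hb : ContDiff ℝ ∞ b) :
    ∃ (Bs : ThickFlame.X p 2 →L[ℝ] ThickFlame.Data p)
      (N : ThickFlame.Data p →L[ℝ] ThickFlame.X p 2)
      (P : ThickFlame.X p 2 →L[ℝ] ThickFlame.X p 2),
      (∀ u, ∀ j, ∀ y ∈ ThickFlame.cell p, (Bs u).fn j y = ThickFlame.Bstar u y j) ∧
      (∀ h, ∀ i : ThickFlame.Piece, ∀ x ∈ interior (i.reg.ivl p), ∀ y ∈ ThickFlame.cell p,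
        (N h).D 0 0 i x y = ThickFlame.lift c h i x y) ∧
      (∀ h, Bs (N h) = h) ∧
      (∀ u, P u = u - N (Bs u)) ∧
      (∀ u, P (P u) = P u) ∧
      P.range = Bs.ker ∧
      Bs.ker = ThickFlame.DL p ∧
      ∃ r₀ > 0, ∃ r₁ > 0, ∃ r₂ > 0,
        ∃ Υ : ThickFlame.DL p → (ContinuousLinearMap.id ℝ (ThickFlame.X p 2) - P).range,
          ContDiffOn ℝ ∞ Υ (Metric.ball 0 r₁) ∧
          Υ 0 = 0 ∧
          {u | u ∈ ThickFlame.compatSet c a b ∧ ‖P u‖ < r₁ ∧ ‖u - P u‖ < r₂}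
            = {u | ∃ v ∈ Metric.ball (0 : ThickFlame.DL p) r₁,
                u = (v : ThickFlame.X p 2) + (Υ v : ThickFlame.X p 2)} ∧
          Metric.ball 0 r₀ ⊆ {u : ThickFlame.X p 2 | ‖P u‖ < r₁ ∧ ‖u - P u‖ < r₂} := by
  exact ⟨ThickFlame.Bs p, ThickFlame.liftN c, ThickFlame.projDL c,
    fun u j _ hy => ThickFlame.Bs_fn u j hy,
    fun h i _ hx _ hy => ThickFlame.liftN_eq_lift c h i hx hy,
    ThickFlame.Bs_liftN c, ThickFlame.projDL_apply c,
    fun u => ThickFlame.projDL_of_mem c (ThickFlame.projDL_mem c u),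
    ThickFlame.range_projDL c, ThickFlame.ker_Bs, ThickFlame.exists_graph c a b⟩
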